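/- For positive integers $n_1,n_2,n_3$ let $G=[n_1]\times[n_2]\times[n_3]$, where $[m]=\{1,\dots,m\}$, be ordered coordinatewise, and put $N=n_1+n_2+n_3$ and $|x|=x_1+x_2+x_3$ for $x\in G$. Algorithms have query access to a function $F:G\to G$ (a query takes a point $x\in G$ and returns $F(x)$); running time is the number of elementary steps, where an arithmetic operation $+,-,\cdot,\lfloor\cdot/\cdot\rfloor$, a comparison, an access to a variable, or a query counts as one step, and all numbers that occur have $O(\log N)$ bits. (a) There is an algorithm that, given $n_1,n_2,n_3$ and query access to a monotone function $F:G\to G$ (that is, $x\le y$ implies $F(x)\le F(y)$), finds a fixed point $x^\star=F(x^\star)$ of $F$ with $O(\log^2 N)$ queries and in $O(\log^2 N)$ time. (b) There is an algorithm that, given $n_1,n_2,n_3$, an integer $k$ with $3\le k\le N$ and query access to a monotone function $F:G\to G$, finds with $O(\log N)$ queries and in $O(\log N)$ time a point $x\in G$ such that either $F(x)\ge x$ and $|x|\ge k$, or $F(x)\le x$ and $|x|\le k$. In both parts it is a single algorithm for all inputs, and the constants in the $O$-bounds are absolute. -/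

import Mathlib

namespace Tarski

/-! ### Integer grids -/

/-- The grid `[n₁] × ⋯ × [n_d]` with `[m] = {1, …, m}`. Its order `≤` (inherited from the product
order on `Fin d → ℤ`) is the coordinatewise one. -/
abbrev Grid {d : ℕ} (n : Fin d → ℕ) : Type :=
  {x : Fin d → ℤ // ∀ i, 1 ≤ x i ∧ x i ≤ (n i : ℤ)}

/-- The size `N = n₁ + ⋯ + n_d` of a grid. -/
def gridSize {d : ℕ} (n : Fin d → ℕ) : ℕ := ∑ i, n i

/-- The sum `|x| = x₁ + ⋯ + x_d` of the coordinates of a grid point. -/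
def level {d : ℕ} {n : Fin d → ℕ} (x : Grid n) : ℤ := ∑ i, x.1 i

/-- A point is upward for `F` if `F x ≥ x`. -/
def IsUpward {d : ℕ} {n : Fin d → ℕ} (F : Grid n → Grid n) (x : Grid n) : Prop := x ≤ F x

/-- A point is downward for `F` if `F x ≤ x`. -/
def IsDownward {d : ℕ} {n : Fin d → ℕ} (F : Grid n → Grid n) (x : Grid n) : Prop := F x ≤ x

/-! ### The machine model

Programs over integer variables with unit-cost arithmetic operations on words of bounded size and
with query access to a function `F` on a three-dimensional grid. A program is a finite object that
does not depend on the instance; it mentions only finitely many variables. -/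

/-- The contents of the variables. -/
abbrev Store : Type := ℕ → ℤ

/-- Arithmetic expressions. -/
inductive Expr : Type
  /-- an integer constant -/
  | const (c : ℤ)
  /-- the contents of a variable -/
  | var (v : ℕ)
  | add (a b : Expr)
  | sub (a b : Expr)
  | mul (a b : Expr)
  /-- the floor of `a / b`, for `b > 0` -/
  | div (a b : Expr)
  /-- a comparison, with value `1` if `a ≤ b` and `0` otherwise -/
  | le (a b : Expr)

namespace Expr

/-- The value of an expression. -/
def eval (σ : Store) : Expr → ℤ
  | const c => c
  | var v => σ v
  | add a b => a.eval σ + b.eval σ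
  | sub a b => a.eval σ - b.eval σ
  | mul a b => a.eval σ * b.eval σ
  | div a b => a.eval σ / b.eval σ
  | le a b => if a.eval σ ≤ b.eval σ then 1 else 0

/-- The cost of evaluating an expression: one step for each constant, variable access, arithmetic
operation and comparison in it. -/
def cost : Expr → ℕ
  | const _ => 1
  | var _ => 1
  | add a b => a.cost + b.cost + 1
  | sub a b => a.cost + b.cost + 1
  | mul a b => a.cost + b.cost + 1
  | div a b => a.cost + b.cost + 1
  | le a b => a.cost + b.cost + 1

/-- The evaluation succeeds with words bounded by `W`: every number that occurs in it (intermediate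
results included) has absolute value at most `W`, and every divisor is positive. -/
def Fits (W : ℕ) (σ : Store) : Expr → Prop
  | const c => |c| ≤ W
  | var v => |σ v| ≤ W
  | add a b => a.Fits W σ ∧ b.Fits W σ ∧ |a.eval σ + b.eval σ| ≤ W
  | sub a b => a.Fits W σ ∧ b.Fits W σ ∧ |a.eval σ - b.eval σ| ≤ W
  | mul a b => a.Fits W σ ∧ b.Fits W σ ∧ |a.eval σ * b.eval σ| ≤ W
  | div a b => a.Fits W σ ∧ b.Fits W σ ∧ 0 < b.eval σ ∧ |a.eval σ / b.eval σ| ≤ W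
  | le a b => a.Fits W σ ∧ b.Fits W σ ∧ 1 ≤ W

end Expr

/-- Programs. -/
inductive Prog : Type
  | skip
  /-- `v := e` -/
  | assign (v : ℕ) (e : Expr)
  /-- `(b₁, b₂, b₃) := F (a₁, a₂, a₃)` for variables `a₁, a₂, a₃, b₁, b₂, b₃` -/
  | query (a₁ a₂ a₃ b₁ b₂ b₃ : ℕ)
  /-- first `P`, then `Q` -/
  | seq (P Q : Prog)
  /-- `P` if `e ≠ 0`, and `Q` otherwise -/
  | ite (e : Expr) (P Q : Prog)
  /-- repeat `P` while `e ≠ 0` -/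
  | loop (e : Expr) (P : Prog)

/-- `Run F W P σ τ t q`: with query access to `F` and words bounded by `W`, the program `P` started
on the store `σ` halts with the store `τ` after `t` steps, `q` of which are queries to `F`.
A program that evaluates an expression which does not fit into words bounded by `W`, that divides by
a non-positive number, or that queries a point outside the grid has no run. -/
inductive Run {n : Fin 3 → ℕ} (F : Grid n → Grid n) (W : ℕ) :
    Prog → Store → Store → ℕ → ℕ → Prop
  | skip (σ : Store) : Run F W .skip σ σ 1 0
  | assign (v : ℕ) (e : Expr) (σ : Store) (he : e.Fits W σ) :
      Run F W (.assign v e) σ (Function.update σ v (e.eval σ)) (e.cost + 1) 0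
  | query (a₁ a₂ a₃ b₁ b₂ b₃ : ℕ) (σ : Store) (x : Grid n) (hx : x.1 = ![σ a₁, σ a₂, σ a₃]) :
      Run F W (.query a₁ a₂ a₃ b₁ b₂ b₃) σ
        (Function.update (Function.update (Function.update σ
          b₁ ((F x).1 0)) b₂ ((F x).1 1)) b₃ ((F x).1 2)) 1 1
  | seq (P Q : Prog) (σ τ ρ : Store) (t q t' q' : ℕ)
      (hP : Run F W P σ τ t q) (hQ : Run F W Q τ ρ t' q') :
      Run F W (.seq P Q) σ ρ (t + t') (q + q')
  | ite_true (e : Expr) (P Q : Prog) (σ τ : Store) (t q : ℕ)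
      (he : e.Fits W σ) (h : e.eval σ ≠ 0) (hP : Run F W P σ τ t q) :
      Run F W (.ite e P Q) σ τ (e.cost + 1 + t) q
  | ite_false (e : Expr) (P Q : Prog) (σ τ : Store) (t q : ℕ)
      (he : e.Fits W σ) (h : e.eval σ = 0) (hQ : Run F W Q σ τ t q) :
      Run F W (.ite e P Q) σ τ (e.cost + 1 + t) q
  | loop_true (e : Expr) (P : Prog) (σ τ ρ : Store) (t q t' q' : ℕ)
      (he : e.Fits W σ) (h : e.eval σ ≠ 0)
      (hP : Run F W P σ τ t q) (hL : Run F W (.loop e P) τ ρ t' q') :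
      Run F W (.loop e P) σ ρ (e.cost + 1 + t + t') (q + q')
  | loop_false (e : Expr) (P : Prog) (σ : Store)
      (he : e.Fits W σ) (h : e.eval σ = 0) :
      Run F W (.loop e P) σ σ (e.cost + 1) 0

/-- The initial store: variables `0, 1, 2` hold `n₁, n₂, n₃`, variable `3` holds the additional input
`k`, and all other variables hold `0`. -/
def input (n : Fin 3 → ℕ) (k : ℕ) : Store := fun v =>
  if h : v < 3 then (n ⟨v, h⟩ : ℤ) else if v = 3 then (k : ℤ) else 0

/-- The store holds the output `x`: variables `0, 1, 2` hold the coordinates of `x`. -/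
def Outputs {n : Fin 3 → ℕ} (τ : Store) (x : Grid n) : Prop := ∀ i : Fin 3, τ (i : ℕ) = x.1 i

end Tarski

/-!
Both algorithms rest on the level problem: in a box whose least point `lo` is upward and whose
greatest point `hi` is downward, find a point that is upward at level at least `k` or downward at
level at most `k`. The map is extended from the box to a monotone map `G` on `ℤ³` by clamping the
argument, so that no point asked for is ever illegal; solutions for `G` clamp to solutions for `F`
(`Inst.isSol_clamp`).

At a point `x` of level `k` that is not a solution, one coordinate of `G x - x` has a strict sign
and the two others have the opposite sign or vanish (`isSol_or_isLower_or_isUpper`). So `x` is a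
lower or an upper witness in some direction `i`, and the search can be continued on one side of the
line through `x` on which coordinate `i` is constant. The three lower and three upper lines bound a
hexagonal region `l i < p i < h i` of the plane `∑ p = k`, and one query at a suitable center
discards a third of the values of some coordinate (`HasInterior.three_mul_width_le`). As there are
`O(N³)` triples of values in the beginning, the region has no lattice points after `O(log N)`
queries (`exec_mainLoop`).

For a region without lattice points there are three cases: two opposite lines are adjacent, or the
three lower lines bound a triangle of side length two, or the three upper lines do so. The third
case is the order dual of the second. In the first case a binary search along the line finds two
neighbours between which the behaviour of `G` in direction `i` changes, and monotonicity forces one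
of four points near them to be a solution (`LinePair.isSol`). In a triangle of side length two, the
point `l + (1, 1, 1)` or a side midpoint is a solution, or a midpoint starts such a binary search or
cuts off a triangle of side length one (`exists_unitTriangle`). In a triangle of side length one,
`l` or a corner is a solution, or a corner starts a binary search, or the meet of two witnesses
gives a solution (`UnitTriangle.isSol`). All these possibilities are tried in turn, in `O(log N)` steps.

A fixed point is found by solving the level problem for the middle level of the box: the solution
replaces `lo` or `hi`, and half of the levels of the box disappear. When at most two levels are
left, `F lo` is a fixed point, because the chain `lo ≤ F lo ≤ F (F lo) ≤ hi` has no room for two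
strict steps. There are `O(log N)` rounds of `O(log N)` steps each.

For the machine, programs are assembled from straight-line code over terms with case distinctions
(`Term`) and loops, and `Exec` records running times. A word bound linear in `N` suffices.
-/

namespace Tarski

/-! ### Solutions and witnesses at a level -/

/-- `x` solves the level problem for `G` at level `k`: it is upward at level at least `k`, or
downward at level at most `k`. -/
def IsSol (G : (Fin 3 → ℤ) → Fin 3 → ℤ) (k : ℤ) (x : Fin 3 → ℤ) : Prop :=
  (x ≤ G x ∧ k ≤ ∑ i, x i) ∨ (G x ≤ x ∧ ∑ i, x i ≤ k)

/-- A lower witness in direction `i`: a point at level `k` at which `G` increases coordinate `i`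
and increases no other coordinate. -/
structure IsLower (G : (Fin 3 → ℤ) → Fin 3 → ℤ) (k : ℤ) (i : Fin 3) (w : Fin 3 → ℤ) : Prop where
  level_eq : ∑ j, w j = k
  lt : w i < G w i
  le : ∀ j, j ≠ i → G w j ≤ w j

/-- An upper witness in direction `i`: a point at level `k` at which `G` decreases coordinate `i`
and decreases no other coordinate. -/
structure IsUpper (G : (Fin 3 → ℤ) → Fin 3 → ℤ) (k : ℤ) (i : Fin 3) (w : Fin 3 → ℤ) : Prop where
  level_eq : ∑ j, w j = k
  lt : G w i < w i
  le : ∀ j, j ≠ i → w j ≤ G w j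

section
variable {G : (Fin 3 → ℤ) → Fin 3 → ℤ} {k : ℤ}

theorem _root_.Monotone.apply_le_apply (hG : Monotone G) {x y : Fin 3 → ℤ} (h : x ≤ y) (i : Fin 3) :
    G x i ≤ G y i := hG h i

/-- Of the three signs of `G x - x`, one differs from the two others, up to zeros. -/
theorem isSol_or_isLower_or_isUpper {x : Fin 3 → ℤ} (hx : ∑ i, x i = k) :
    IsSol G k x ∨ ∃ i, IsLower G k i x ∨ IsUpper G k i x := by
  by_contra! h
  obtain ⟨h0, h1⟩ := h
  have hL : ∀ i, ¬ (x i < G x i ∧ ∀ j, j ≠ i → G x j ≤ x j) := fun i h => (h1 i).1 ⟨hx, h.1, h.2⟩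
  have hU : ∀ i, ¬ (G x i < x i ∧ ∀ j, j ≠ i → x j ≤ G x j) := fun i h => (h1 i).2 ⟨hx, h.1, h.2⟩
  simp only [IsSol, Pi.le_def, Fin.forall_fin_succ, Fin.sum_univ_three] at h0 hL hU hx
  simp at h0 hL hU
  omega

/-- The hypotheses of the search along a line: a lower witness `w` in direction `2`, and a point
`w'` to its right, on the same line or on the next one, at which `G` decreases neither
coordinate `0` nor coordinate `1`, and which `G` maps to below the line in direction `2`. -/
structure LinePair (G : (Fin 3 → ℤ) → Fin 3 → ℤ) (k : ℤ) (w w' : Fin 3 → ℤ) : Prop where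
  lower : IsLower G k 2 w
  level_eq : ∑ j, w' j = k
  le_zero : w' 0 ≤ G w' 0
  le_one : w' 1 ≤ G w' 1
  le_two : G w' 2 ≤ w 2
  line : w' 2 = w 2 ∨ w' 2 = w 2 + 1
  left : w 0 ≤ w' 0

/-- The four candidates at the end of a search along a line. Here `a` and `b = a + 1` are neighbours
on the line of `w`: at `a` the map increases coordinate `2`, and at `b` it does not, unless `a` is
already the end of the line segment. -/
theorem LinePair.isSol {w w' : Fin 3 → ℤ} (hG : Monotone G) (h : LinePair G k w w')
    {a b e c : ℤ} (hc : c = w 2) (he : e = k - c) (ha : w 0 ≤ a) (ha' : a ≤ w' 0) (hb : b = a + 1)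
    (hac : c < G ![a, e - a, c] 2) (hbc : a = w' 0 ∨ G ![b, e - b, c] 2 ≤ c) :
    IsSol G k ![w' 0, e - a, w' 2] ∨ IsSol G k ![w 0, e - b, c] ∨
      IsSol G k ![b, e - a, c] ∨ IsSol G k ![a, e - b, c] := by
  obtain ⟨⟨hw, hw2, hw01⟩, hw', h0, h1, h2, hl, hlr⟩ := h
  have hw0 := hw01 0 (by decide)
  have hw1 := hw01 1 (by decide)
  have mono : ∀ x y : Fin 3 → ℤ, x 0 ≤ y 0 → x 1 ≤ y 1 → x 2 ≤ y 2 →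
      G x 0 ≤ G y 0 ∧ G x 1 ≤ G y 1 ∧ G x 2 ≤ G y 2 := by
    intro x y h0 h1 h2
    have : x ≤ y := by intro i; fin_cases i <;> assumption
    exact ⟨hG this 0, hG this 1, hG this 2⟩
  simp only [IsSol, Pi.le_def, Fin.forall_fin_succ, Fin.sum_univ_three] at *
  simp at *
  have m1 := mono w' ![w' 0, e - a, w' 2]
  have m2 := mono ![a, e - a, c] ![w' 0, e - a, w' 2]
  have m3 := mono ![w 0, e - b, c] w
  have m4 := mono ![w 0, e - b, c] w'
  have m5 := mono ![w 0, e - b, c] ![b, e - b, c]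
  have m6 := mono ![a, e - a, c] ![b, e - a, c]
  have m7 := mono ![b, e - b, c] ![b, e - a, c]
  have m8 := mono ![a, e - b, c] ![a, e - a, c]
  have m9 := mono ![a, e - b, c] ![b, e - b, c]
  have m10 := mono ![a, e - a, c] w'
  simp at m1 m2 m3 m4 m5 m6 m7 m8 m9 m10
  clear mono hw01
  specialize m1 (by omega)
  specialize m2 (by omega) (by omega)
  specialize m3 (by omega) (by omega)
  specialize m5 (by omega)
  specialize m6 (by omega)
  specialize m7 (by omega)
  specialize m8 (by omega)
  specialize m9 (by omega)
  rcases hbc with hbc | hbc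
  · rcases hl with hl | hl
    · specialize m10 (by omega) (by omega) (by omega)
      omega
    · specialize m4 (by omega) (by omega) (by omega)
      by_cases q : w' 1 < G w' 1
      · left; left; omega
      · right; left; right; omega
  · by_cases q1 : e - a ≤ G ![a, e - a, c] 1
    · left; left; omega
    · by_cases q2 : G ![b, e - b, c] 1 ≤ e - b
      · right; left; right; omega
      · by_cases q3 : b ≤ G ![b, e - b, c] 0
        · right; right; left; left; omega
        · right; right; right; right; omega

/-! ### Symmetries -/

/-- The point with signed and permuted coordinates `s * y (π a)`. -/
def actPt (s : ℤ) (π : Equiv.Perm (Fin 3)) (y : Fin 3 → ℤ) : Fin 3 → ℤ := fun a => s * y (π a)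

/-- The map `G` in the signed and permuted coordinates `y` with `x = actPt s π y`. For `s = -1` this
is the order dual, which exchanges upward and downward points. -/
def conjMap (s : ℤ) (π : Equiv.Perm (Fin 3)) (G : (Fin 3 → ℤ) → Fin 3 → ℤ) :
    (Fin 3 → ℤ) → Fin 3 → ℤ := fun y b => s * G (actPt s π y) (π.symm b)

theorem conjMap_monotone {s : ℤ} (hs : s = 1 ∨ s = -1) (π : Equiv.Perm (Fin 3)) (hG : Monotone G) :
    Monotone (conjMap s π G) := by
  intro x y hxy b
  rcases hs with rfl | rfl
  · have : actPt 1 π x ≤ actPt 1 π y := fun a => by simpa [actPt] using hxy (π a)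
    simpa [conjMap] using hG this (π.symm b)
  · have : actPt (-1) π y ≤ actPt (-1) π x := fun a => by simpa [actPt] using hxy (π a)
    simpa [conjMap] using hG this (π.symm b)

theorem sum_actPt (s : ℤ) (π : Equiv.Perm (Fin 3)) (y : Fin 3 → ℤ) :
    ∑ a, actPt s π y a = s * ∑ a, y a := by
  simp only [actPt, ← Finset.mul_sum, Equiv.sum_comp π y]

theorem IsSol.of_conjMap {s : ℤ} (hs : s = 1 ∨ s = -1) {π : Equiv.Perm (Fin 3)} {y : Fin 3 → ℤ}
    (h : IsSol (conjMap s π G) (s * k) y) : IsSol G k (actPt s π y) := by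
  have key : ∀ a, conjMap s π G y (π a) = s * G (actPt s π y) a := fun a => by simp [conjMap]
  rw [IsSol, sum_actPt]
  rcases hs with rfl | rfl
  · rcases h with ⟨h1, h2⟩ | ⟨h1, h2⟩
    · left
      refine ⟨fun a => ?_, by linarith⟩
      have := h1 (π a); rw [key] at this; simpa [actPt] using this
    · right
      refine ⟨fun a => ?_, by linarith⟩
      have := h1 (π a); rw [key] at this; simpa [actPt] using this
  · rcases h with ⟨h1, h2⟩ | ⟨h1, h2⟩
    · right
      refine ⟨fun a => ?_, by linarith⟩
      have := h1 (π a); rw [key] at this; simp only [actPt]; linarith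
    · left
      refine ⟨fun a => ?_, by linarith⟩
      have := h1 (π a); rw [key] at this; simp only [actPt]; linarith

theorem IsUpper.neg {i : Fin 3} {w : Fin 3 → ℤ} (h : IsUpper G k i w) :
    IsLower (conjMap (-1) 1 G) (-k) i (-w) := by
  have e : actPt (-1) 1 (-w) = w := by ext; simp [actPt]
  refine ⟨by simp [h.level_eq], ?_, fun j hj => ?_⟩
  · change (-w) i < -1 * G (actPt (-1) 1 (-w)) i
    simpa only [e, Pi.neg_apply, neg_one_mul, neg_lt_neg_iff] using h.lt
  · change -1 * G (actPt (-1) 1 (-w)) j ≤ (-w) j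
    simpa only [e, Pi.neg_apply, neg_one_mul, neg_le_neg_iff] using h.le j hj

/-- Two witnesses for adjacent lines, or a lower witness and a point violating it on its line,
form a line pair after a permutation of the coordinates. -/
theorem exists_linePair {i : Fin 3} {w w' : Fin 3 → ℤ} (h : IsLower G k i w)
    (hk : ∑ j, w' j = k) (h1 : ∀ j, j ≠ i → w' j ≤ G w' j) (h2 : G w' i ≤ w i)
    (h3 : w' i = w i ∨ w' i = w i + 1) :
    ∃ π : Equiv.Perm (Fin 3), π.symm 2 = i ∧
      LinePair (conjMap 1 π G) k (w ∘ π.symm) (w' ∘ π.symm) := by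
  obtain ⟨j, l, hjl, hji, hli⟩ : ∃ j l : Fin 3, j ≠ l ∧ j ≠ i ∧ l ≠ i := by
    clear * -
    revert i; decide
  -- Whichever of the two other coordinates places `w` to the left of `w'` becomes coordinate `0`.
  wlog hw : w j ≤ w' j generalizing j l
  · refine this l j hjl.symm hli hji ?_
    have e : ∀ v : Fin 3 → ℤ, ∑ a, v a = v i + v j + v l := by
      intro v
      have : (Finset.univ : Finset (Fin 3)) = {i, j, l} := by
        clear * - hjl hji hli
        revert i j l; decide
      rw [this, Finset.sum_insert (by simp [hji.symm, hli.symm]), Finset.sum_pair hjl]; ring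
    have := h.level_eq
    rw [e] at this hk
    omega
  obtain ⟨π, p0, p1, p2⟩ : ∃ π : Equiv.Perm (Fin 3),
      π.symm 0 = j ∧ π.symm 1 = l ∧ π.symm 2 = i := by
    clear * - hjl hji hli
    revert i j l; decide
  refine ⟨π, p2, ?_⟩
  have e : ∀ v : Fin 3 → ℤ, actPt 1 π (v ∘ π.symm) = v := fun v => by ext; simp [actPt]
  have es : ∀ v : Fin 3 → ℤ, ∑ a, (v ∘ π.symm) a = ∑ a, v a := fun v => Equiv.sum_comp π.symm v
  refine ⟨⟨by rw [es, h.level_eq], ?_, ?_⟩, by rw [es, hk], ?_, ?_, ?_, ?_, ?_⟩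
  · simpa [conjMap, e, p2] using h.lt
  · intro b hb
    have : π.symm b ≠ i := by rw [← p2]; simpa using hb
    simpa [conjMap, e] using h.le _ this
  · simpa [conjMap, e, p0] using h1 j hji
  · simpa [conjMap, e, p1] using h1 l hli
  · simpa [conjMap, e, p2] using h2
  · simpa [p2] using h3
  · simpa [p0] using hw

/-! ### Small triangles -/

/-- The corner `l + e i` of the triangle whose sides lie on the lines of the witnesses `w`, where
`l j = w j j`. -/
def corner (w : Fin 3 → Fin 3 → ℤ) (i : Fin 3) : Fin 3 → ℤ :=
  fun a => if a = i then w a a + 1 else w a a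

/-- The point `l + (1, 1, 1) - e i`, where `l j = w j j`. -/
def midpt (w : Fin 3 → Fin 3 → ℤ) (i : Fin 3) : Fin 3 → ℤ :=
  fun a => if a = i then w a a else w a a + 1

/-- The meet of the two witnesses of the sides through corner `i` and, in the coordinates other
than `i`, of the corner. -/
def cornerMeet (w : Fin 3 → Fin 3 → ℤ) (i : Fin 3) : Fin 3 → ℤ := fun a =>
  if a = i then min (w (i + 1) i) (w (i + 2) i)
  else if a = i + 1 then min (w (i + 1) (i + 1)) (w (i + 2) (i + 1))
  else min (w (i + 2) (i + 2)) (w (i + 1) (i + 2))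

/-- Lower witnesses for three lines bounding a triangle of side length one. -/
structure UnitTriangle (G : (Fin 3 → ℤ) → Fin 3 → ℤ) (k : ℤ) (w : Fin 3 → Fin 3 → ℤ) : Prop where
  lower : ∀ i, IsLower G k i (w i)
  sum : ∑ i, w i i = k - 1

theorem forall_fin_three (i : Fin 3) {p : Fin 3 → Prop} :
    (∀ a, p a) ↔ p i ∧ p (i + 1) ∧ p (i + 2) := by
  refine ⟨fun h => ⟨h _, h _, h _⟩, fun ⟨h0, h1, h2⟩ a => ?_⟩
  have : a = i ∨ a = i + 1 ∨ a = i + 2 := by clear * -; revert i a; decide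
  rcases this with rfl | rfl | rfl <;> assumption

theorem sum_fin_three (i : Fin 3) (f : Fin 3 → ℤ) : ∑ a, f a = f i + f (i + 1) + f (i + 2) := by
  rw [Fin.sum_univ_three]
  fin_cases i
  · rfl
  · change _ = f 1 + f 2 + f 0; ring
  · change _ = f 2 + f 0 + f 1; ring

theorem fin_three_ne (i : Fin 3) : i + 1 ≠ i ∧ i + 2 ≠ i ∧ i + 2 ≠ i + 1 ∧ i + 1 ≠ i + 2 := by
  revert i; decide

theorem IsLower.isSol_cornerMeet {w : Fin 3 → Fin 3 → ℤ} (hG : Monotone G)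
    (h : ∀ i, IsLower G k i (w i)) (hw : ∑ i, w i i = k - 1) {i : Fin 3}
    (h1 : G (corner w i) (i + 1) ≤ w (i + 1) (i + 1))
    (h2 : G (corner w i) (i + 2) ≤ w (i + 2) (i + 2)) : IsSol G k (cornerMeet w i) := by
  obtain ⟨n1, n2, n3, n4⟩ := fin_three_ne i
  have e1 := (h (i + 1)).level_eq
  have e2 := (h (i + 2)).level_eq
  have a1 := (h (i + 1)).le i n1.symm
  have a2 := (h (i + 1)).le (i + 2) n3
  have b1 := (h (i + 2)).le i n2.symm
  have b2 := (h (i + 2)).le (i + 1) n4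
  rw [sum_fin_three i] at e1 e2 hw
  have m1 : cornerMeet w i ≤ w (i + 1) := by
    rw [Pi.le_def, forall_fin_three i]; simp [cornerMeet, n1, n2, n3]
  have m2 : cornerMeet w i ≤ w (i + 2) := by
    rw [Pi.le_def, forall_fin_three i]; simp [cornerMeet, n1, n2, n3]
  have hm : cornerMeet w i i ≤ w (i + 1) i ∧ cornerMeet w i i ≤ w (i + 2) i ∧
      (cornerMeet w i i = w (i + 1) i ∨ cornerMeet w i i = w (i + 2) i) ∧
      cornerMeet w i (i + 1) = min (w (i + 1) (i + 1)) (w (i + 2) (i + 1)) ∧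
      cornerMeet w i (i + 2) = min (w (i + 2) (i + 2)) (w (i + 1) (i + 2)) := by
    simp [cornerMeet, n1, n2, n3]; omega
  have c0 : corner w i i = w i i + 1 := by simp [corner]
  have c1 : corner w i (i + 1) = w (i + 1) (i + 1) := by simp [corner, n1]
  have c2 : corner w i (i + 2) = w (i + 2) (i + 2) := by simp [corner, n2]
  have m3 : cornerMeet w i i ≤ w i i + 1 → cornerMeet w i ≤ corner w i := by
    intro h0
    rw [Pi.le_def, forall_fin_three i, c0, c1, c2]; omega
  have g10 := hG.apply_le_apply m1 i
  have g12 := hG.apply_le_apply m1 (i + 2)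
  have g20 := hG.apply_le_apply m2 i
  have g21 := hG.apply_le_apply m2 (i + 1)
  right
  rw [Pi.le_def, forall_fin_three i, sum_fin_three i]
  refine ⟨⟨by omega, ?_, ?_⟩, by omega⟩
  · by_cases q : w (i + 2) (i + 1) ≤ w (i + 1) (i + 1)
    · omega
    · have := hG.apply_le_apply (m3 (by omega)) (i + 1); omega
  · by_cases q : w (i + 1) (i + 2) ≤ w (i + 2) (i + 2)
    · omega
    · have := hG.apply_le_apply (m3 (by omega)) (i + 2); omega

/-- If the lowest point `l` below the triangle is not downward, then `G` increases some
coordinate `i` of it, hence coordinate `i` of the corner `l + e i`, and each sign pattern of `G` at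
that corner is either inconsistent with a witness or violates the line of one. -/
theorem UnitTriangle.isSol {w : Fin 3 → Fin 3 → ℤ} (hG : Monotone G) (h : UnitTriangle G k w) :
    IsSol G k (fun a => w a a) ∨ (∃ i, IsSol G k (corner w i)) ∨ (∃ i, IsSol G k (cornerMeet w i)) ∨
      ∃ (i : Fin 3) (π : Equiv.Perm (Fin 3)),
        LinePair (conjMap 1 π G) k (w (π.symm 2) ∘ π.symm) (corner w i ∘ π.symm) := by
  obtain ⟨h, hw⟩ := h
  by_cases hd : ∀ i, G (fun a => w a a) i ≤ w i i
  · exact Or.inl (Or.inr ⟨hd, by rw [hw]; omega⟩)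
  push Not at hd
  obtain ⟨i, hi⟩ := hd
  obtain ⟨n1, n2, n3, n4⟩ := fin_three_ne i
  have c0 : corner w i i = w i i + 1 := by simp [corner]
  have c1 : corner w i (i + 1) = w (i + 1) (i + 1) := by simp [corner, n1]
  have c2 : corner w i (i + 2) = w (i + 2) (i + 2) := by simp [corner, n2]
  have hlv : (fun a => w a a) ≤ corner w i := by
    rw [Pi.le_def, forall_fin_three i, c0, c1, c2]; omega
  have g0 := hG.apply_le_apply hlv i
  have hk : ∑ j, corner w i j = k := by
    rw [sum_fin_three i] at hw ⊢; omega
  right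
  rcases le_or_gt (w (i + 1) (i + 1)) (G (corner w i) (i + 1)) with q1 | q1 <;>
    rcases le_or_gt (w (i + 2) (i + 2)) (G (corner w i) (i + 2)) with q2 | q2
  · left
    refine ⟨i, Or.inl ⟨?_, hk.ge⟩⟩
    rw [Pi.le_def, forall_fin_three i, c0, c1, c2]; omega
  · right; right
    obtain ⟨π, p2, hp⟩ := exists_linePair (w' := corner w i) (h (i + 2)) hk
      ((forall_fin_three i).2 ⟨fun _ => by omega, fun _ => by omega, by simp⟩) (by omega)
      (by omega)
    exact ⟨i, π, by rw [p2]; exact hp⟩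
  · right; right
    obtain ⟨π, p2, hp⟩ := exists_linePair (w' := corner w i) (h (i + 1)) hk
      ((forall_fin_three i).2 ⟨fun _ => by omega, by simp, fun _ => by omega⟩) (by omega)
      (by omega)
    exact ⟨i, π, by rw [p2]; exact hp⟩
  · right; left
    exact ⟨i, IsLower.isSol_cornerMeet hG h hw q1.le q2.le⟩

/-- In a triangle of side length two, either a solution is at hand or the midpoint of some side is a
lower witness in another direction, which cuts off a triangle of side length one. -/
theorem exists_unitTriangle {w : Fin 3 → Fin 3 → ℤ} (hG : Monotone G)
    (h : ∀ i, IsLower G k i (w i)) (hw : ∑ i, w i i = k - 2) :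
    IsSol G k (fun a => w a a + 1) ∨ (∃ i, IsSol G k (midpt w i)) ∨
      (∃ (i : Fin 3) (π : Equiv.Perm (Fin 3)),
        LinePair (conjMap 1 π G) k (w (π.symm 2) ∘ π.symm) (midpt w i ∘ π.symm)) ∨
      ∃ i j, UnitTriangle G k (Function.update w j (midpt w i)) := by
  by_cases hd : ∀ i, w i i + 1 ≤ G (fun a => w a a + 1) i
  · exact Or.inl (Or.inl ⟨hd, by rw [Finset.sum_add_distrib, hw]; simp; omega⟩)
  push Not at hd
  obtain ⟨i, hi⟩ := hd
  obtain ⟨n1, n2, n3, n4⟩ := fin_three_ne i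
  have c0 : midpt w i i = w i i := by simp [midpt]
  have c1 : midpt w i (i + 1) = w (i + 1) (i + 1) + 1 := by simp [midpt, n1]
  have c2 : midpt w i (i + 2) = w (i + 2) (i + 2) + 1 := by simp [midpt, n2]
  have hlv : midpt w i ≤ (fun a => w a a + 1) := by
    rw [Pi.le_def, forall_fin_three i, c0, c1, c2]; omega
  have g0 := hG.apply_le_apply hlv i
  have hk : ∑ j, midpt w i j = k := by
    rw [sum_fin_three i] at hw ⊢; omega
  -- A lower witness of direction `j` at the midpoint moves line `j` by one.
  have key : ∀ j, j ≠ i → midpt w i j < G (midpt w i) j →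
      (∀ a, a ≠ j → G (midpt w i) a ≤ midpt w i a) →
      UnitTriangle G k (Function.update w j (midpt w i)) := by
    intro j hj h1 h2
    refine ⟨fun a => ?_, ?_⟩
    · by_cases ha : a = j
      · subst ha; simpa using ⟨hk, h1, h2⟩
      · simpa [ha] using h a
    · have : ∑ a, Function.update w j (midpt w i) a a = ∑ a, w a a + 1 := by
        have e : ∀ a, Function.update w j (midpt w i) a a = w a a + if a = j then 1 else 0 := by
          intro a
          by_cases ha : a = j
          · subst ha; simp [midpt, hj]
          · simp [ha]
        simp [e, Finset.sum_add_distrib]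
      omega
  right
  rcases le_or_gt (G (midpt w i) (i + 1)) (midpt w i (i + 1)) with q1 | q1 <;>
    rcases le_or_gt (G (midpt w i) (i + 2)) (midpt w i (i + 2)) with q2 | q2
  · left
    refine ⟨i, Or.inr ⟨?_, hk.le⟩⟩
    rw [Pi.le_def, forall_fin_three i]; omega
  · right; right
    exact ⟨i, i + 2, key _ n2 q2 ((forall_fin_three i).2 ⟨fun _ => by omega, fun _ => q1, by simp⟩)⟩
  · right; right
    exact ⟨i, i + 1, key _ n1 q1 ((forall_fin_three i).2 ⟨fun _ => by omega, by simp, fun _ => q2⟩)⟩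
  · right; left
    obtain ⟨π, p2, hp⟩ := exists_linePair (w' := midpt w i) (h i) hk
      ((forall_fin_three i).2 ⟨by simp, fun _ => q1.le, fun _ => q2.le⟩) (by omega)
      (by omega)
    exact ⟨i, π, by rw [p2]; exact hp⟩

/-! ### Shrinking the region between the lines -/

/-- The region `{p | ∑ p = k, l i < p i < h i}` contains a lattice point. -/
def HasInterior (k : ℤ) (l h : Fin 3 → ℤ) : Prop :=
  (∀ i, l i + 2 ≤ h i) ∧ ∑ i, l i + 3 ≤ k ∧ k + 3 ≤ ∑ i, h i

/-- The least value of coordinate `i` in the region `{p | ∑ p = k, l i < p i < h i}`. -/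
def tightLow (k : ℤ) (l h : Fin 3 → ℤ) (i : Fin 3) : ℤ :=
  max (l i + 1) (k - (h (i + 1) - 1) - (h (i + 2) - 1))

/-- The greatest value of coordinate `i` in the region `{p | ∑ p = k, l i < p i < h i}`. -/
def tightHigh (k : ℤ) (l h : Fin 3 → ℤ) (i : Fin 3) : ℤ :=
  min (h i - 1) (k - (l (i + 1) + 1) - (l (i + 2) + 1))

/-- The number of values of coordinate `i` in the region. -/
def width (k : ℤ) (l h : Fin 3 → ℤ) (i : Fin 3) : ℤ := tightHigh k l h i - tightLow k l h i + 1

/-- The lower third of the range of coordinate `i`. -/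
def thirdLow (k : ℤ) (l h : Fin 3 → ℤ) (i : Fin 3) : ℤ :=
  tightLow k l h i + (tightHigh k l h i - tightLow k l h i) / 3

/-- The upper third of the range of coordinate `i`. -/
def thirdHigh (k : ℤ) (l h : Fin 3 → ℤ) (i : Fin 3) : ℤ :=
  tightHigh k l h i - (tightHigh k l h i - tightLow k l h i) / 3

/-- A point of the region all of whose coordinates lie in the middle third of their ranges. -/
def center (k : ℤ) (l h : Fin 3 → ℤ) : Fin 3 → ℤ :=
  let x := max (thirdLow k l h 0) (k - thirdHigh k l h 1 - thirdHigh k l h 2)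
  let y := max (thirdLow k l h 1) (k - x - thirdHigh k l h 2)
  ![x, y, k - x - y]

section
variable {l h : Fin 3 → ℤ}

theorem HasInterior.width_pos (H : HasInterior k l h) (i : Fin 3) : 1 ≤ width k l h i := by
  obtain ⟨h0, h1, h2⟩ := H
  rw [forall_fin_three i] at h0
  rw [sum_fin_three i] at h1 h2
  simp only [width, tightLow, tightHigh]
  omega

theorem sum_center : ∑ i, center k l h i = k := by
  simp [center, Fin.sum_univ_three]

theorem HasInterior.tight_le (H : HasInterior k l h) (i : Fin 3) :
    tightHigh k l h i - tightLow k l h i ≤ k - ∑ a, tightLow k l h a ∧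
      tightHigh k l h i - tightLow k l h i ≤ ∑ a, tightHigh k l h a - k := by
  obtain ⟨h0, h1, h2⟩ := H
  rw [forall_fin_three i] at h0
  rw [sum_fin_three i] at h1 h2
  rw [sum_fin_three i, sum_fin_three i]
  have e : ∀ i : Fin 3, i + 1 + 1 = i + 2 ∧ i + 1 + 2 = i ∧ i + 2 + 1 = i ∧ i + 2 + 2 = i + 1 := by
    decide
  simp only [tightLow, tightHigh, e]
  omega

theorem HasInterior.center_mem (H : HasInterior k l h) (i : Fin 3) :
    thirdLow k l h i ≤ center k l h i ∧ center k l h i ≤ thirdHigh k l h i := by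
  have t0 := H.tight_le 0
  have t1 := H.tight_le 1
  have t2 := H.tight_le 2
  have w0 := H.width_pos 0
  have w1 := H.width_pos 1
  have w2 := H.width_pos 2
  simp only [Fin.sum_univ_three, width] at t0 t1 t2 w0 w1 w2
  revert i
  rw [forall_fin_three 0]
  simp only [center, thirdLow, thirdHigh]
  simp
  generalize tightLow k l h = a at *
  generalize tightHigh k l h = b at *
  omega

theorem HasInterior.lt_center (H : HasInterior k l h) (i : Fin 3) :
    l i < center k l h i ∧ center k l h i < h i := by
  have h1 := H.center_mem i
  have h2 := H.width_pos i
  simp only [thirdLow, thirdHigh, width, tightLow, tightHigh] at h1 h2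
  omega

variable {l' h' : Fin 3 → ℤ}

theorem width_le (hl : l ≤ l') (hh : h' ≤ h) (i : Fin 3) : width k l' h' i ≤ width k l h i := by
  rw [Pi.le_def, forall_fin_three i] at hl hh
  simp only [width, tightLow, tightHigh]
  omega

/-- A cut through the center discards a third of the values of the coordinate in question. -/
theorem HasInterior.three_mul_width_le (H : HasInterior k l h) (hl : l ≤ l') (hh : h' ≤ h)
    {i : Fin 3} (hi : l' i = center k l h i ∨ h' i = center k l h i) :
    3 * width k l' h' i ≤ 2 * width k l h i := by
  have h1 := H.center_mem i
  have h2 := H.width_pos i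
  have hl' : tightLow k l h i ≤ tightLow k l' h' i := by
    rw [Pi.le_def, forall_fin_three i] at hl hh
    simp only [tightLow]; omega
  have hh' : tightHigh k l' h' i ≤ tightHigh k l h i := by
    rw [Pi.le_def, forall_fin_three i] at hl hh
    simp only [tightHigh]; omega
  simp only [width, thirdLow, thirdHigh] at *
  rcases hi with hi | hi
  · have : l' i + 1 ≤ tightLow k l' h' i := le_max_left _ _
    omega
  · have : tightHigh k l' h' i ≤ h' i - 1 := min_le_left _ _
    omega

theorem HasInterior.three_mul_prod_width_le (H : HasInterior k l h) (H' : HasInterior k l' h')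
    (hl : l ≤ l') (hh : h' ≤ h) {i : Fin 3}
    (hi : l' i = center k l h i ∨ h' i = center k l h i) :
    3 * ∏ a, width k l' h' a ≤ 2 * ∏ a, width k l h a := by
  have key := H.three_mul_width_le hl hh hi
  have p : ∀ a, 0 ≤ width k l' h' a := fun a => (zero_le_one.trans (H'.width_pos a))
  have q : ∀ a, 0 ≤ width k l h a := fun a => (zero_le_one.trans (H.width_pos a))
  rw [← Finset.mul_prod_erase _ (width k l' h') (Finset.mem_univ i),
    ← Finset.mul_prod_erase _ (width k l h) (Finset.mem_univ i), ← mul_assoc, ← mul_assoc]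
  refine mul_le_mul key (Finset.prod_le_prod (fun a _ => p a) fun a _ => width_le hl hh a)
    (Finset.prod_nonneg fun a _ => p a) (mul_nonneg zero_le_two (q i))

end

end

/-! ### Terms and straight-line code -/

/-- Arithmetic terms with case distinctions, to be compiled to expressions. -/
inductive Term : Type
  | const (c : ℤ)
  | var (v : ℕ)
  | add (a b : Term)
  | sub (a b : Term)
  | smul (c : ℤ) (a : Term)
  /-- the floor of `a / (d + 1)` -/
  | div (a : Term) (d : ℕ)
  /-- `c` if `a ≤ b`, and `d` otherwise -/
  | ifLe (a b c d : Term)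

namespace Term

/-- The value of a term. -/
def eval (σ : Store) : Term → ℤ
  | const c => c
  | var v => σ v
  | add a b => a.eval σ + b.eval σ
  | sub a b => a.eval σ - b.eval σ
  | smul c a => c * a.eval σ
  | div a d => a.eval σ / (d + 1 : ℕ)
  | ifLe a b c d => if a.eval σ ≤ b.eval σ then c.eval σ else d.eval σ

/-- The expression with the same value; a case distinction becomes `d + [a ≤ b] * (c - d)`. -/
def compile : Term → Expr
  | const c => .const c
  | var v => .var v
  | add a b => .add a.compile b.compile
  | sub a b => .sub a.compile b.compile
  | smul c a => .mul (.const c) a.compile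
  | div a d => .div a.compile (.const (d + 1 : ℕ))
  | ifLe a b c d => .add d.compile (.mul (.le a.compile b.compile) (.sub c.compile d.compile))

/-- If all variables are at most `B ≥ 1` in absolute value, then all numbers occurring in the
evaluation of the term are at most `t.grow * B`. -/
def grow : Term → ℕ
  | const c => c.natAbs + 1
  | var _ => 1
  | add a b => a.grow + b.grow
  | sub a b => a.grow + b.grow
  | smul c a => (c.natAbs + 1) * a.grow
  | div a d => a.grow + d + 1
  | ifLe a b c d => a.grow + b.grow + c.grow + d.grow

/-- All variables of the term satisfy `p`. -/
def All (p : ℕ → Prop) : Term → Prop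
  | const _ => True
  | var v => p v
  | add a b => a.All p ∧ b.All p
  | sub a b => a.All p ∧ b.All p
  | smul _ a => a.All p
  | div a _ => a.All p
  | ifLe a b c d => a.All p ∧ b.All p ∧ c.All p ∧ d.All p

theorem eval_congr {p : ℕ → Prop} {σ τ : Store} (h : ∀ v, p v → σ v = τ v) {t : Term}
    (ht : t.All p) : t.eval σ = t.eval τ := by
  induction t <;> simp_all [All, eval]

theorem All.mono {p q : ℕ → Prop} (h : ∀ v, p v → q v) {t : Term} (ht : t.All p) : t.All q := by
  induction t <;> simp_all [All]

theorem eval_compile (σ : Store) (t : Term) : t.compile.eval σ = t.eval σ := by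
  induction t with
  | ifLe a b c d ha hb hc hd =>
    simp only [compile, Expr.eval, eval, ha, hb, hc, hd]
    split_ifs <;> ring
  | _ => simp_all [compile, Expr.eval, eval]

theorem one_le_grow (t : Term) : 1 ≤ t.grow := by
  induction t with
  | smul c a ih => exact Nat.mul_pos (Nat.succ_pos _) ih
  | _ => simp_all only [grow]; omega

theorem abs_eval_le {σ : Store} {B : ℕ} {p : ℕ → Prop} (hB : 1 ≤ B) (hσ : ∀ v, p v → |σ v| ≤ B)
    {t : Term} (ht : t.All p) : |t.eval σ| ≤ (t.grow * B : ℕ) := by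
  induction t with
  | const c =>
    simp only [eval, grow]
    push_cast
    nlinarith [abs_nonneg c]
  | var v => simpa [eval, grow] using hσ v ht
  | add a b ha hb =>
    simp only [eval, grow]; have := ha ht.1; have := hb ht.2; push_cast at *
    exact (abs_add_le _ _).trans (by linarith)
  | sub a b ha hb =>
    simp only [eval, grow]; have := ha ht.1; have := hb ht.2; push_cast at *
    exact (abs_sub _ _).trans (by linarith)
  | smul c a ih =>
    have := ih ht
    simp only [eval, grow, abs_mul]; push_cast at *
    nlinarith [abs_nonneg c, abs_nonneg (a.eval σ)]
  | div a d ih =>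
    have := ih ht
    simp only [eval, grow]
    have h2 : |a.eval σ / ((d + 1 : ℕ) : ℤ)| ≤ |a.eval σ| := Int.abs_ediv_le_abs _ _
    push_cast at *
    nlinarith
  | ifLe a b c d ha hb hc hd =>
    have := ha ht.1; have := hb ht.2.1; have := hc ht.2.2.1; have := hd ht.2.2.2
    have := abs_nonneg (a.eval σ); have := abs_nonneg (b.eval σ)
    have := abs_nonneg (c.eval σ); have := abs_nonneg (d.eval σ)
    simp only [eval, grow]; push_cast at *
    split_ifs <;> linarith

theorem fits_compile {σ : Store} {B W : ℕ} (hB : 1 ≤ B) (hσ : ∀ v, |σ v| ≤ B)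
    {t : Term} (hW : t.grow * B ≤ W) : t.compile.Fits W σ := by
  have key : ∀ t : Term, |t.eval σ| ≤ (t.grow * B : ℕ) := fun t =>
    abs_eval_le (p := fun _ => True) hB (fun v _ => hσ v) (by
      clear hW
      induction t <;> simp_all [All])
  induction t with
  | const c => have := key (.const c); simp only [compile, Expr.Fits, eval] at *; omega
  | var v => have := key (.var v); simp only [compile, Expr.Fits, eval] at *; omega
  | add a b ha hb =>
    have := key (.add a b)
    simp only [grow, add_mul] at hW
    simp only [compile, Expr.Fits, eval, eval_compile] at *
    refine ⟨ha (by omega), hb (by omega), this.trans ?_⟩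
    rw [grow, add_mul]; exact_mod_cast hW
  | sub a b ha hb =>
    have := key (.sub a b)
    simp only [grow, add_mul] at hW
    simp only [compile, Expr.Fits, eval, eval_compile] at *
    refine ⟨ha (by omega), hb (by omega), this.trans ?_⟩
    rw [grow, add_mul]; exact_mod_cast hW
  | smul c a ih =>
    have h1 := key (.smul c a)
    have h2 : c.natAbs + 1 ≤ W := by
      refine le_trans ?_ hW
      rw [grow, mul_assoc]
      exact Nat.le_mul_of_pos_right _ (Nat.mul_pos (one_le_grow a) hB)
    have h3 : a.grow * B ≤ W := by
      refine le_trans ?_ hW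
      simp only [grow]
      nlinarith [Nat.zero_le (c.natAbs * (a.grow * B))]
    simp only [compile, Expr.Fits, Expr.eval, eval, eval_compile] at *
    exact ⟨by rw [Int.abs_eq_natAbs]; omega, ih h3, h1.trans (by exact_mod_cast hW)⟩
  | div a d ih =>
    have h1 := key (.div a d)
    have h2 : a.grow * B + (d + 1) * B ≤ W := by
      refine le_trans (le_of_eq ?_) hW
      simp only [grow]; ring
    have h3 : d + 1 ≤ (d + 1) * B := Nat.le_mul_of_pos_right _ hB
    simp only [compile, Expr.Fits, Expr.eval, eval, eval_compile] at *
    refine ⟨ih (by omega), ?_, by positivity, h1.trans (by exact_mod_cast hW)⟩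
    rw [abs_of_nonneg (by positivity)]
    exact_mod_cast (by omega : d + 1 ≤ W)
  | ifLe a b c d ha hb hc hd =>
    have h1 := key (.ifLe a b c d)
    have k1 := key c
    have k2 := key d
    have e := eval_compile σ (.ifLe a b c d)
    have hW' : a.grow * B + b.grow * B + c.grow * B + d.grow * B ≤ W := by
      simpa [grow, add_mul] using hW
    have p1 : 1 ≤ a.grow * B := Nat.mul_pos (one_le_grow a) hB
    have hcd : |c.eval σ - d.eval σ| ≤ W := by
      refine (abs_sub _ _).trans ?_
      omega
    simp only [compile, Expr.Fits, Expr.eval, eval_compile] at e ⊢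
    refine ⟨hd (by omega), ⟨⟨ha (by omega), hb (by omega), by omega⟩,
      ⟨hc (by omega), hd (by omega), hcd⟩, ?_⟩, ?_⟩
    · split_ifs
      · simpa using hcd
      · simp
    · rw [e]; exact h1.trans (by exact_mod_cast hW)

/-- Conjunction of truth values. -/
def and (a b : Term) : Term := .ifLe (.const 1) a b (.const 0)

/-- Disjunction of truth values. -/
def or (a b : Term) : Term := .ifLe (.const 1) a (.const 1) b

/-- The truth value of `a ≤ b`. -/
def leT (a b : Term) : Term := .ifLe a b (.const 1) (.const 0)

/-- `a` if the truth value `c` is true, and `b` otherwise. -/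
def sel (c a b : Term) : Term := .ifLe (.const 1) c a b

/-- The maximum of two terms. -/
def max (a b : Term) : Term := .ifLe a b b a

/-- The minimum of two terms. -/
def min (a b : Term) : Term := .ifLe a b a b

/-- A term is true in `σ` if its value is positive. -/
def Holds (σ : Store) (t : Term) : Prop := 1 ≤ t.eval σ

instance (σ : Store) (t : Term) : Decidable (t.Holds σ) := inferInstanceAs (Decidable (1 ≤ _))

variable (σ : Store) (a b c : Term)

@[simp] theorem holds_and : (a.and b).Holds σ ↔ a.Holds σ ∧ b.Holds σ := by
  simp only [Holds, and, eval]
  by_cases h : 1 ≤ a.eval σ <;> simp [h]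

@[simp] theorem holds_or : (a.or b).Holds σ ↔ a.Holds σ ∨ b.Holds σ := by
  simp only [Holds, or, eval]
  by_cases h : 1 ≤ a.eval σ <;> simp [h]

@[simp] theorem holds_leT : (a.leT b).Holds σ ↔ a.eval σ ≤ b.eval σ := by
  simp only [Holds, leT, eval]; split_ifs <;> simp_all

@[simp] theorem eval_sel : (c.sel a b).eval σ = if c.Holds σ then a.eval σ else b.eval σ := rfl

@[simp] theorem eval_max : (a.max b).eval σ = Max.max (a.eval σ) (b.eval σ) := by
  simp only [max, eval, max_def]

@[simp] theorem eval_min : (a.min b).eval σ = Min.min (a.eval σ) (b.eval σ) := by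
  simp only [min, eval, min_def]

end Term

/-- A sequence of assignments. -/
def block : List (ℕ × Term) → Prog
  | [] => .skip
  | a :: l => .seq (.assign a.1 a.2.compile) (block l)

/-- The effect of a sequence of assignments. -/
def runBlock : List (ℕ × Term) → Store → Store
  | [], σ => σ
  | a :: l, σ => runBlock l (Function.update σ a.1 (a.2.eval σ))

theorem runBlock_of_notMem {l : List (ℕ × Term)} {v : ℕ} (h : ∀ a ∈ l, a.1 ≠ v) (σ : Store) :
    runBlock l σ v = σ v := by
  induction l generalizing σ with
  | nil => rfl
  | cons a l ih =>
    rw [runBlock, ih (fun b hb => h b (List.mem_cons_of_mem _ hb)),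
      Function.update_of_ne (h a List.mem_cons_self).symm]

/-- Assignments whose terms do not read other assigned variables act simultaneously. -/
theorem runBlock_of_mem {l : List (ℕ × Term)} (hl : (l.map Prod.fst).Nodup)
    (h : ∀ a ∈ l, a.2.All fun v => v = a.1 ∨ v ∉ l.map Prod.fst) (σ : Store) :
    ∀ a ∈ l, runBlock l σ a.1 = a.2.eval σ := by
  induction l generalizing σ with
  | nil => simp
  | cons b l ih =>
    rw [List.map_cons, List.nodup_cons] at hl
    intro a ha
    rcases List.mem_cons.1 ha with rfl | ha'
    · rw [runBlock, runBlock_of_notMem, Function.update_self]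
      intro c hc e
      exact hl.1 (e ▸ List.mem_map_of_mem hc)
    · rw [runBlock, ih hl.2 (fun c hc => (h c (List.mem_cons_of_mem _ hc)).mono ?_) _ a ha']
      · refine (Term.eval_congr (fun v hv => ?_) (h a ha)).symm
        rw [Function.update_of_ne]
        rintro rfl
        rcases hv with hv | hv
        · exact hl.1 (hv ▸ List.mem_map_of_mem ha')
        · simp at hv
      · intro v hv
        refine hv.imp_right fun hv hm => hv ?_
        simp only [List.map_cons, List.mem_cons]
        exact Or.inr hm

/-! ### Execution with bounded time -/

/-- `Exec F W P σ τ c`: the program `P` leads from `σ` to `τ` in at most `c` steps. -/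
def Exec {n : Fin 3 → ℕ} (F : Grid n → Grid n) (W : ℕ) (P : Prog) (σ τ : Store) (c : ℕ) : Prop :=
  ∃ t q, Run F W P σ τ t q ∧ q ≤ t ∧ t ≤ c

section
variable {n : Fin 3 → ℕ} {F : Grid n → Grid n} {W : ℕ} {P Q : Prog} {σ τ ρ : Store} {c d : ℕ}

theorem Exec.mono (h : Exec F W P σ τ c) (hcd : c ≤ d) : Exec F W P σ τ d := by
  obtain ⟨t, q, h1, h2, h3⟩ := h
  exact ⟨t, q, h1, h2, h3.trans hcd⟩

theorem Exec.seq (h : Exec F W P σ τ c) (h' : Exec F W Q τ ρ d) :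
    Exec F W (.seq P Q) σ ρ (c + d) := by
  obtain ⟨t, q, h1, h2, h3⟩ := h
  obtain ⟨t', q', h1', h2', h3'⟩ := h'
  exact ⟨t + t', q + q', .seq P Q σ τ ρ t q t' q' h1 h1', by omega, by omega⟩

end

theorem exec_block (l : List (ℕ × Term)) : ∃ c : ℕ, ∀ {n : Fin 3 → ℕ} (F : Grid n → Grid n)
    (W B : ℕ) (σ : Store), 1 ≤ B → (∀ v, |σ v| ≤ B) → c * B ≤ W →
      Exec F W (block l) σ (runBlock l σ) c := by
  induction l with
  | nil => exact ⟨1, fun F W B σ _ _ _ => ⟨1, 0, .skip σ, by omega, by omega⟩⟩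
  | cons a l ih =>
    obtain ⟨c, hc⟩ := ih
    refine ⟨c * (a.2.grow + 1) + a.2.grow + a.2.compile.cost + 1, fun {n} F W B σ hB hσ hW => ?_⟩
    have hW1 : a.2.grow * B ≤ W := by nlinarith [Nat.zero_le (c * (a.2.grow + 1) * B)]
    have hW2 : c * ((a.2.grow + 1) * B) ≤ W := by
      rw [← mul_assoc]; nlinarith [Nat.zero_le ((a.2.grow + a.2.compile.cost + 1) * B)]
    have h1 := Run.assign (F := F) (W := W) a.1 a.2.compile σ (Term.fits_compile hB hσ hW1)
    rw [Term.eval_compile] at h1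
    have hb : |a.2.eval σ| ≤ (a.2.grow * B : ℕ) :=
      Term.abs_eval_le (p := fun _ => True) hB (fun v _ => hσ v) (by
        generalize a.2 = t
        induction t <;> simp_all [Term.All])
    have h2 := hc F W ((a.2.grow + 1) * B) (Function.update σ a.1 (a.2.eval σ)) (by nlinarith)
      (fun v => by
        push_cast at hb ⊢
        by_cases hv : v = a.1
        · subst hv; simp only [Function.update_self]; nlinarith
        · rw [Function.update_of_ne hv]; have := hσ v; nlinarith) hW2
    refine (Exec.seq ⟨_, _, h1, Nat.zero_le _, le_rfl⟩ h2).mono ?_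
    nlinarith [Nat.zero_le (c * a.2.grow)]

/-- Repeat `P` while the term `g` is true. -/
def whileT (g : Term) (P : Prog) : Prog := .loop (.le (.const 1) g.compile) P

/-- A loop with an invariant `I` that also bounds the number of remaining iterations. -/
theorem exec_whileT (g : Term) (P : Prog) : ∃ c : ℕ, ∀ {n : Fin 3 → ℕ} (F : Grid n → Grid n)
    (W B d : ℕ) (I : ℕ → Store → Prop), 1 ≤ B → c * B ≤ W →
      (∀ T σ, I T σ → (∀ v, |σ v| ≤ B) ∧
        (g.Holds σ → ∃ T' τ, T = T' + 1 ∧ Exec F W P σ τ d ∧ I T' τ)) →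
      ∀ T σ, I T σ → ∃ τ T', Exec F W (whileT g P) σ τ ((c + d) * (T + 1)) ∧ I T' τ ∧
        ¬ g.Holds τ := by
  refine ⟨g.compile.cost + g.grow + 4, fun {n} F W B d I hB hW h T => ?_⟩
  have hfit : ∀ T σ, I T σ → (Expr.le (.const 1) g.compile).Fits W σ := by
    intro T σ hI
    have h1 : g.grow * B ≤ W := by nlinarith
    have h2 : 1 ≤ W := by nlinarith
    exact ⟨by simpa [Expr.Fits] using h2, Term.fits_compile hB (h T σ hI).1 h1, h2⟩
  have hev : ∀ σ, (Expr.le (.const 1) g.compile).eval σ ≠ 0 ↔ g.Holds σ := by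
    intro σ
    simp [Expr.eval, Term.eval_compile, Term.Holds]
  have hcost : (Expr.le (.const 1) g.compile).cost = g.compile.cost + 2 := by
    simp [Expr.cost]; omega
  induction T with
  | zero =>
    intro σ hI
    have hg : ¬ g.Holds σ := fun hg => by
      obtain ⟨T', _, e, _⟩ := (h 0 σ hI).2 hg; omega
    refine ⟨σ, 0, ⟨_, _, .loop_false _ P σ (hfit _ _ hI) ?_, Nat.zero_le _, ?_⟩, hI, hg⟩
    · by_contra e; exact hg ((hev σ).1 e)
    · rw [hcost]; omega
  | succ T ih =>
    intro σ hI
    by_cases hg : g.Holds σ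
    · obtain ⟨T', τ, e, ⟨t, q, r1, r2, r3⟩, hI'⟩ := (h _ σ hI).2 hg
      obtain rfl : T' = T := by omega
      obtain ⟨ρ, T'', ⟨t', q', r1', r2', r3'⟩, hI'', hg'⟩ := ih τ hI'
      refine ⟨ρ, T'', ⟨_, _, .loop_true _ P σ τ ρ t q t' q' (hfit _ _ hI) ((hev σ).2 hg) r1 r1',
        by omega, ?_⟩, hI'', hg'⟩
      rw [hcost]; nlinarith
    · refine ⟨σ, T + 1, ⟨_, _, .loop_false _ P σ (hfit _ _ hI) ?_, Nat.zero_le _, ?_⟩, hI, hg⟩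
      · by_contra e; exact hg ((hev σ).1 e)
      · rw [hcost]; nlinarith

/-! ### Instances of the level problem -/

/-- The map underlying `F`, on all integer points; its values outside the grid are irrelevant. -/
def ext {n : Fin 3 → ℕ} (F : Grid n → Grid n) (p : Fin 3 → ℤ) : Fin 3 → ℤ :=
  open Classical in if h : ∀ i, 1 ≤ p i ∧ p i ≤ (n i : ℤ) then (F ⟨p, h⟩).1 else p

/-- The point of the box `[lo, hi]` closest to `p`. -/
def clamp (lo hi p : Fin 3 → ℤ) : Fin 3 → ℤ := fun i => max (lo i) (min (hi i) (p i))

/-- An instance of the level problem: a box `[lo, hi]` with upward least point and downward greatest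
point, and a level `k` that meets the box; and a bound `W` for the words of the machine. -/
structure Inst where
  n : Fin 3 → ℕ
  F : Grid n → Grid n
  mono : Monotone F
  lo : Fin 3 → ℤ
  hi : Fin 3 → ℤ
  k : ℤ
  W : ℕ
  one_le : ∀ i, 1 ≤ lo i
  lo_le_hi : lo ≤ hi
  hi_le : ∀ i, hi i ≤ n i
  up : lo ≤ ext F lo
  down : ext F hi ≤ hi
  le_k : ∑ i, lo i ≤ k
  k_le : k ≤ ∑ i, hi i

namespace Inst
variable (w : Inst)

/-- The size of the grid. -/
def N : ℕ := gridSize w.n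

/-- The map `F`, extended from the box to all integer points by clamping the argument. -/
def G (p : Fin 3 → ℤ) : Fin 3 → ℤ := ext w.F (clamp w.lo w.hi p)

theorem clamp_mem (p : Fin 3 → ℤ) : w.lo ≤ clamp w.lo w.hi p ∧ clamp w.lo w.hi p ≤ w.hi :=
  ⟨fun _ => le_max_left _ _, fun i => max_le (w.lo_le_hi i) (min_le_left _ _)⟩

theorem mem_grid {p : Fin 3 → ℤ} (h1 : w.lo ≤ p) (h2 : p ≤ w.hi) (i : Fin 3) :
    1 ≤ p i ∧ p i ≤ (w.n i : ℤ) :=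
  ⟨(w.one_le i).trans (h1 i), (h2 i).trans (w.hi_le i)⟩

theorem ext_mono {p q : Fin 3 → ℤ} (h1 : w.lo ≤ p) (h2 : p ≤ q) (h3 : q ≤ w.hi) :
    ext w.F p ≤ ext w.F q := by
  rw [ext, ext, dif_pos (w.mem_grid h1 (h2.trans h3)), dif_pos (w.mem_grid (h1.trans h2) h3)]
  exact w.mono h2

theorem G_monotone : Monotone w.G := fun p q h =>
  w.ext_mono (w.clamp_mem p).1 (fun i => max_le_max le_rfl (min_le_min le_rfl (h i)))
    (w.clamp_mem q).2

theorem lo_le_G (p : Fin 3 → ℤ) : w.lo ≤ w.G p :=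
  w.up.trans (w.ext_mono le_rfl (w.clamp_mem p).1 (w.clamp_mem p).2)

theorem G_le_hi (p : Fin 3 → ℤ) : w.G p ≤ w.hi :=
  (w.ext_mono (w.clamp_mem p).1 (w.clamp_mem p).2 le_rfl).trans w.down

theorem clamp_eq {p : Fin 3 → ℤ} (h1 : w.lo ≤ p) (h2 : p ≤ w.hi) : clamp w.lo w.hi p = p := by
  ext i; rw [clamp, min_eq_right (h2 i), max_eq_right (h1 i)]

theorem G_eq {p : Fin 3 → ℤ} (h1 : w.lo ≤ p) (h2 : p ≤ w.hi) : w.G p = ext w.F p := by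
  rw [G, w.clamp_eq h1 h2]

theorem isSol_clamp {p : Fin 3 → ℤ} (h : IsSol w.G w.k p) :
    IsSol (ext w.F) w.k (clamp w.lo w.hi p) := by
  have e : ext w.F (clamp w.lo w.hi p) = w.G p := rfl
  rw [IsSol, e]
  rcases h with ⟨h1, h2⟩ | ⟨h1, h2⟩
  · left
    have : ∀ i, clamp w.lo w.hi p i = max (w.lo i) (p i) := fun i => by
      rw [clamp, min_eq_right ((h1 i).trans (w.G_le_hi p i))]
    refine ⟨fun i => by rw [this]; exact max_le (w.lo_le_G p i) (h1 i), h2.trans ?_⟩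
    exact Finset.sum_le_sum fun i _ => by rw [this]; exact le_max_right _ _
  · right
    have : ∀ i, clamp w.lo w.hi p i = min (w.hi i) (p i) := fun i => by
      rw [clamp, max_eq_right (le_min (w.lo_le_hi i) ((w.lo_le_G p i).trans (h1 i)))]
    refine ⟨fun i => by rw [this]; exact le_min (w.G_le_hi p i) (h1 i), le_trans ?_ h2⟩
    exact Finset.sum_le_sum fun i _ => by rw [this]; exact min_le_right _ _

theorem n_le_N (i : Fin 3) : w.n i ≤ w.N := Finset.single_le_sum (fun _ _ => Nat.zero_le _)
  (Finset.mem_univ i)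

theorem hi_le_N (i : Fin 3) : w.hi i ≤ w.N := (w.hi_le i).trans (by exact_mod_cast w.n_le_N i)

theorem sum_hi_le : ∑ i, w.hi i ≤ w.N := by
  rw [N, gridSize]; push_cast
  exact Finset.sum_le_sum fun i _ => w.hi_le i

theorem three_le_sum_lo : 3 ≤ ∑ i, w.lo i := by
  have h0 := w.one_le 0; have h1 := w.one_le 1; have h2 := w.one_le 2
  rw [Fin.sum_univ_three]; omega

theorem three_le_N : 3 ≤ w.N := by
  have := w.three_le_sum_lo; have := w.le_k; have := w.k_le; have := w.sum_hi_le
  omega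

theorem k_bounds : 3 ≤ w.k ∧ w.k ≤ w.N :=
  ⟨w.three_le_sum_lo.trans w.le_k, w.k_le.trans w.sum_hi_le⟩

end Inst

/-! ### The variables -/

/-!
Variables `0, 1, 2` hold the input and output, `3` the level, `4, 5, 6` and `7, 8, 9` the corners of
the box; `11` tells whether a solution has been found, which is then held by `24, 25, 26`; a point
for which the value of the map is wanted is put into `12, 13, 14`, the value is returned in
`15, 16, 17`, and `18, 19, 20` hold the clamped point; `21, 22, 23` are the two ends and the middle
of a binary search, whose arguments are in `50, …, 55`; `27` is a flag; `30 + 3 i + j` holds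
coordinate `j` of the lower witness in direction `i`, and `40 + 3 i + j` that of the upper
witness. -/

/-- The point held by the variables `b, b + 1, b + 2`. -/
def vec (σ : Store) (b : ℕ) : Fin 3 → ℤ := fun a => σ (b + a)

/-- The variables for the level, the box and the witnesses. -/
def IsMain (v : ℕ) : Prop := v < 10 ∨ (30 ≤ v ∧ v < 50)

instance : DecidablePred IsMain := fun _ => inferInstanceAs (Decidable (_ ∨ _))

/-- The contents of the main variables. -/
def snap (σ : Store) : Store := fun v => if IsMain v then σ v else 0

theorem snap_eq {σ τ : Store} (h : ∀ v, IsMain v → τ v = σ v) : snap τ = snap σ := by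
  ext v; by_cases hv : IsMain v <;> simp [snap, hv, h]

theorem eq_of_snap_eq {σ τ : Store} (h : snap τ = snap σ) {v : ℕ} (hv : IsMain v) : τ v = σ v := by
  simpa [snap, hv] using congrFun h v

theorem Term.eval_snap {t : Term} (ht : t.All IsMain) (σ : Store) : t.eval (snap σ) = t.eval σ :=
  Term.eval_congr (fun v hv => by simp [snap, hv]) ht

/-- What holds of the store throughout the search for a solution of the instance. The bounds are
generous: the box, the level and the witnesses are at most `20 N` in absolute value, and the points
computed from them at most `10000 N`. -/
structure Inv (w : Inst) (σ : Store) : Prop where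
  bound : ∀ v, |σ v| ≤ (10000 * w.N : ℕ)
  main : ∀ v, IsMain v → |σ v| ≤ (20 * w.N : ℕ)
  level : σ 3 = w.k
  lo : vec σ 4 = w.lo
  hi : vec σ 7 = w.hi
  found : σ 11 = 0 ∨ (σ 11 = 1 ∧ IsSol w.G w.k (vec σ 24))

/-- The invariant survives changes of the remaining variables. -/
theorem Inv.of_eq {w : Inst} {σ τ : Store} (h : Inv w σ) (hb : ∀ v, |τ v| ≤ (10000 * w.N : ℕ))
    (hm : ∀ v, IsMain v ∨ v = 11 ∨ v = 24 ∨ v = 25 ∨ v = 26 → τ v = σ v) : Inv w τ := by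
  have hv : ∀ b, (b = 4 ∨ b = 7 ∨ b = 24) → vec τ b = vec σ b := by
    intro b hb
    ext a
    refine hm _ ?_
    simp only [IsMain]
    omega
  refine ⟨hb, fun v hv => by rw [hm v (Or.inl hv)]; exact h.main v hv, ?_, ?_, ?_, ?_⟩
  · rw [hm 3 (Or.inl (by decide)), h.level]
  · rw [hv 4 (by simp), h.lo]
  · rw [hv 7 (by simp), h.hi]
  · rw [hm 11 (by simp), hv 24 (by simp)]; exact h.found

/-- Put a point into the variables `b, b + 1, b + 2`. -/
def setVec (b : ℕ) (e : Fin 3 → Term) : List (ℕ × Term) := [(b, e 0), (b + 1, e 1), (b + 2, e 2)]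

theorem runBlock_setVec {b : ℕ} {e : Fin 3 → Term} (h : ∀ a, (e a).All fun v => v < b ∨ b + 2 < v)
    (σ : Store) : vec (runBlock (setVec b e) σ) b = (fun a => (e a).eval σ) ∧
      ∀ v, v < b ∨ b + 2 < v → runBlock (setVec b e) σ v = σ v := by
  have h1 : (e 1).eval (Function.update σ b ((e 0).eval σ)) = (e 1).eval σ :=
    Term.eval_congr (fun v hv => Function.update_of_ne (by omega) _ _) (h 1)
  have h2 : (e 2).eval (Function.update (Function.update σ b ((e 0).eval σ)) (b + 1)
      ((e 1).eval (Function.update σ b ((e 0).eval σ)))) = (e 2).eval σ :=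
    Term.eval_congr (fun v hv => by
      rw [Function.update_of_ne (by omega), Function.update_of_ne (by omega)]) (h 2)
  refine ⟨?_, fun v hv => runBlock_of_notMem (by simp [setVec]; omega) σ⟩
  ext a
  fin_cases a
  · simp [vec, setVec, runBlock]
  · simp [vec, setVec, runBlock, h1]
  · simp [vec, setVec, runBlock, h2]

theorem vec_apply (σ : Store) (b : ℕ) (a : Fin 3) : vec σ b a = σ (b + a) := rfl

/-- Evaluate the map of the instance. -/
def ask : Prog :=
  .seq (block (setVec 18 fun a => (Term.var (4 + a)).max ((Term.var (7 + a)).min (.var (12 + a)))))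
    (.query 18 19 20 15 16 17)

theorem exec_ask : ∃ c : ℕ, ∀ w : Inst, c * w.N ≤ w.W → ∀ σ, Inv w σ →
    ∃ τ, Exec w.F w.W ask σ τ c ∧ Inv w τ ∧ vec τ 15 = w.G (vec σ 12) ∧
      ∀ v, v < 15 ∨ 20 < v → τ v = σ v := by
  obtain ⟨c, hc⟩ := exec_block
    (setVec 18 fun a => (Term.var (4 + a)).max ((Term.var (7 + a)).min (.var (12 + a))))
  refine ⟨10000 * c + 1, fun w hW σ hσ => ?_⟩
  have hN := w.three_le_N
  have h1 := hc w.F w.W (10000 * w.N) σ (by omega) hσ.bound (by nlinarith)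
  obtain ⟨e1, e2⟩ := runBlock_setVec (b := 18)
    (e := fun a => (Term.var (4 + a)).max ((Term.var (7 + a)).min (.var (12 + a))))
    (fun a => by simp only [Term.max, Term.min, Term.All]; omega) σ
  set ρ := runBlock (setVec 18 _) σ
  have e3 : vec ρ 18 = clamp w.lo w.hi (vec σ 12) := by
    rw [e1]; ext a
    simp only [Term.eval_max, Term.eval_min, Term.eval, clamp, ← hσ.lo, ← hσ.hi, vec_apply]
  have hmem := w.mem_grid (w.clamp_mem (vec σ 12)).1 (w.clamp_mem (vec σ 12)).2
  have h2 := Run.query (F := w.F) (W := w.W) 18 19 20 15 16 17 ρ ⟨clamp w.lo w.hi (vec σ 12), hmem⟩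
    (by change clamp w.lo w.hi (vec σ 12) = _; rw [← e3]; ext a; fin_cases a <;> rfl)
  set τ := Function.update (Function.update (Function.update ρ 15 _) 16 _) 17 _ with hτ
  have e4 : vec τ 15 = w.G (vec σ 12) := by
    rw [Inst.G, ext, dif_pos hmem]
    ext a; fin_cases a <;> simp [vec, hτ]
  have e5 : ∀ v, v < 15 ∨ 17 < v → τ v = ρ v := by
    intro v hv
    rw [hτ, Function.update_of_ne (by omega), Function.update_of_ne (by omega),
      Function.update_of_ne (by omega)]
  have e6 : ∀ v, v < 15 ∨ 20 < v → τ v = σ v := by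
    intro v hv
    rw [e5 v (by omega), e2 v (by omega)]
  refine ⟨τ, (h1.seq ⟨_, _, h2, le_rfl, le_rfl⟩).mono (by omega), ?_, e4, e6⟩
  refine hσ.of_eq (fun v => ?_) (fun v hv => e6 v (by simp only [IsMain] at hv; omega))
  by_cases hv : v < 15 ∨ 20 < v
  · rw [e6 v hv]; exact hσ.bound v
  have key : ∀ p : Fin 3 → ℤ, w.lo ≤ p → p ≤ w.hi → ∀ a, |p a| ≤ (10000 * w.N : ℕ) := by
    intro p hp1 hp2 a
    have := hp1 a; have := hp2 a; have := w.one_le a; have := w.hi_le_N a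
    rw [abs_le]; push_cast; constructor <;> linarith
  by_cases hv' : v < 18
  · have := key _ (w.lo_le_G (vec σ 12)) (w.G_le_hi _)
    rw [← e4] at this
    obtain ⟨a, rfl⟩ : ∃ a : Fin 3, v = 15 + a := ⟨⟨v - 15, by omega⟩, by simp; omega⟩
    exact this a
  · have := key _ (w.clamp_mem (vec σ 12)).1 (w.clamp_mem _).2
    rw [← e3] at this
    obtain ⟨a, rfl⟩ : ∃ a : Fin 3, v = 18 + a := ⟨⟨v - 18, by omega⟩, by simp; omega⟩
    rw [e5 _ (by omega)]
    exact this a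

/-- Evaluate the map of the instance at the point with coordinates `e`. -/
def probe (e : Fin 3 → Term) : Prog := .seq (block (setVec 12 e)) ask

theorem exec_probe (e : Fin 3 → Term) (he : ∀ a, (e a).All fun v => v < 12 ∨ 14 < v) :
    ∃ c : ℕ, ∀ w : Inst, c * w.N ≤ w.W → ∀ σ, Inv w σ →
      (∀ a, |(e a).eval σ| ≤ (10000 * w.N : ℕ)) →
      ∃ τ, Exec w.F w.W (probe e) σ τ c ∧ Inv w τ ∧ vec τ 12 = (fun a => (e a).eval σ) ∧
        vec τ 15 = w.G (fun a => (e a).eval σ) ∧ ∀ v, v < 12 ∨ 20 < v → τ v = σ v := by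
  obtain ⟨c, hc⟩ := exec_block (setVec 12 e)
  obtain ⟨d, hd⟩ := exec_ask
  refine ⟨10000 * c + d, fun w hW σ hσ hb => ?_⟩
  have hN := w.three_le_N
  have h1 := hc w.F w.W (10000 * w.N) σ (by omega) hσ.bound (by nlinarith)
  obtain ⟨e1, e2⟩ := runBlock_setVec (b := 12) he σ
  set ρ := runBlock (setVec 12 _) σ
  have hρ : Inv w ρ := by
    refine hσ.of_eq (fun v => ?_) (fun v hv => e2 v (by simp only [IsMain] at hv; omega))
    by_cases hv : v < 12 ∨ 14 < v
    · rw [e2 v hv]; exact hσ.bound v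
    · obtain ⟨a, rfl⟩ : ∃ a : Fin 3, v = 12 + a := ⟨⟨v - 12, by omega⟩, by simp; omega⟩
      change |vec ρ 12 a| ≤ _; rw [e1]; exact hb a
  obtain ⟨τ, t1, t2, t3, t4⟩ := hd w (by nlinarith) ρ hρ
  refine ⟨τ, (h1.seq t1).mono (by omega), t2, ?_, by rw [t3, e1], fun v hv => ?_⟩
  · rw [← e1]; ext a; exact t4 _ (by omega)
  · rw [t4 v (by omega), e2 v (by omega)]

/-- The coordinate sum of the point held by `12, 13, 14`. -/
def levelT : Term := .add (.add (.var 12) (.var 13)) (.var 14)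

/-- Whether the point held by `12, 13, 14`, with value held by `15, 16, 17`, is upward and at level
at least `k`. -/
def upT : Term :=
  ((Term.leT (.var 12) (.var 15)).and
    ((Term.leT (.var 13) (.var 16)).and (Term.leT (.var 14) (.var 17)))).and
    (Term.leT (.var 3) levelT)

/-- Whether that point is downward and at level at most `k`. -/
def downT : Term :=
  ((Term.leT (.var 15) (.var 12)).and
    ((Term.leT (.var 16) (.var 13)).and (Term.leT (.var 17) (.var 14)))).and
    (Term.leT levelT (.var 3))

theorem holds_upT (σ : Store) :
    upT.Holds σ ↔ vec σ 12 ≤ vec σ 15 ∧ σ 3 ≤ ∑ i, vec σ 12 i := by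
  simp [upT, levelT, Pi.le_def, Fin.forall_fin_succ, Fin.sum_univ_three, vec, Term.eval]

theorem holds_downT (σ : Store) :
    downT.Holds σ ↔ vec σ 15 ≤ vec σ 12 ∧ ∑ i, vec σ 12 i ≤ σ 3 := by
  simp [downT, levelT, Pi.le_def, Fin.forall_fin_succ, Fin.sum_univ_three, vec, Term.eval]

/-- Record the point held by `12, 13, 14` if it is the first solution found. -/
def record : List (ℕ × Term) :=
  [(27, Term.sel ((Term.leT (.var 11) (.const 0)).and (upT.or downT)) (.const 1) (.const 0)),
    (24, Term.sel (.var 27) (.var 12) (.var 24)), (25, Term.sel (.var 27) (.var 13) (.var 25)),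
    (26, Term.sel (.var 27) (.var 14) (.var 26)), (11, Term.sel (.var 27) (.const 1) (.var 11))]

theorem exec_record : ∃ c : ℕ, ∀ w : Inst, c * w.N ≤ w.W → ∀ σ, Inv w σ →
    vec σ 15 = w.G (vec σ 12) →
    ∃ τ, Exec w.F w.W (block record) σ τ c ∧ Inv w τ ∧ (σ 11 = 1 → τ 11 = 1) ∧
      (IsSol w.G w.k (vec σ 12) → τ 11 = 1) ∧ ∀ v, v ≠ 11 ∧ (v < 24 ∨ 27 < v) → τ v = σ v := by
  obtain ⟨c, hc⟩ := exec_block record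
  refine ⟨10000 * c, fun w hW σ hσ hR => ?_⟩
  classical
  have hN := w.three_le_N
  have h1 := hc w.F w.W (10000 * w.N) σ (by omega) hσ.bound (by nlinarith)
  have e1 : ∀ v, v ≠ 11 ∧ (v < 24 ∨ 27 < v) → runBlock record σ v = σ v := fun v hv =>
    runBlock_of_notMem (by simp [record]; omega) σ
  have hsol : (upT.or downT).Holds σ ↔ IsSol w.G w.k (vec σ 12) := by
    rw [Term.holds_or, holds_upT, holds_downT, hR, hσ.level, IsSol]
  have hcond : ((Term.leT (.var 11) (.const 0)).and (upT.or downT)).Holds σ ↔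
      σ 11 ≤ 0 ∧ IsSol w.G w.k (vec σ 12) := by
    rw [Term.holds_and, hsol, Term.holds_leT]; rfl
  set x : ℤ := (Term.sel ((Term.leT (.var 11) (.const 0)).and (upT.or downT)) (.const 1)
    (.const 0)).eval σ with hx
  rw [Term.eval_sel] at hx
  have h27 : Term.Holds (Function.update σ 27 x) (.var 27) ↔
      σ 11 ≤ 0 ∧ IsSol w.G w.k (vec σ 12) := by
    rw [← hcond, hx]
    simp only [Term.Holds, Term.eval, Function.update_self]
    split_ifs with h <;> simp [h]
  have e11 : runBlock record σ 11 = if σ 11 ≤ 0 ∧ IsSol w.G w.k (vec σ 12) then 1 else σ 11 := by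
    rw [← if_congr h27 rfl rfl]
    simp [record, runBlock, Term.eval, Term.Holds, x]
  have e24 : vec (runBlock record σ) 24 =
      if σ 11 ≤ 0 ∧ IsSol w.G w.k (vec σ 12) then vec σ 12 else vec σ 24 := by
    rw [← if_congr h27 rfl rfl]
    ext a
    rw [ite_apply]
    fin_cases a <;> simp [record, runBlock, Term.eval, Term.Holds, vec, x]
  have hb : ∀ v, |runBlock record σ v| ≤ (10000 * w.N : ℕ) := by
    intro v
    by_cases hv : v ≠ 11 ∧ (v < 24 ∨ 27 < v)
    · rw [e1 v hv]; exact hσ.bound v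
    have h : v = 11 ∨ v = 27 ∨ (24 ≤ v ∧ v < 27) := by omega
    rcases h with rfl | rfl | h
    · rw [e11]; split_ifs
      · simp; omega
      · exact hσ.bound _
    · have : runBlock record σ 27 = x := by simp [record, runBlock, x]
      rw [this, hx]
      split_ifs
      · simp [Term.eval]; omega
      · simp [Term.eval]
    · obtain ⟨a, rfl⟩ : ∃ a : Fin 3, v = 24 + a := ⟨⟨v - 24, by omega⟩, by simp; omega⟩
      change |vec (runBlock record σ) 24 a| ≤ _
      rw [e24]
      split_ifs
      · exact hσ.bound _
      · exact hσ.bound _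
  refine ⟨_, h1.mono (by omega), ⟨hb, fun v hv => ?_, ?_, ?_, ?_, ?_⟩, ?_, ?_, e1⟩
  · rw [e1 v (by simp only [IsMain] at hv; omega)]; exact hσ.main v hv
  · rw [e1 3 (by omega), hσ.level]
  · rw [← hσ.lo]; ext a; exact e1 _ (by omega)
  · rw [← hσ.hi]; ext a; exact e1 _ (by omega)
  · rw [e11, e24]
    split_ifs with h
    · exact Or.inr ⟨rfl, h.2⟩
    · exact hσ.found
  · rw [e11]; intro h; rw [h]; simp
  · rw [e11]; intro h
    rcases hσ.found with h' | h'
    · rw [if_pos ⟨h'.le, h⟩]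
    · rw [h'.1]; simp

/-! ### Pieces of the final stage -/

theorem exec_tryPt (e : Fin 3 → Term) (he : ∀ a, (e a).All fun v => v < 12 ∨ 14 < v) :
    ∃ c : ℕ, ∀ w : Inst, c * w.N ≤ w.W → ∀ σ, Inv w σ →
      (∀ a, |(e a).eval σ| ≤ (10000 * w.N : ℕ)) →
      ∃ τ, Exec w.F w.W (.seq (probe e) (block record)) σ τ c ∧ Inv w τ ∧
        (σ 11 = 1 → τ 11 = 1) ∧ (IsSol w.G w.k (fun a => (e a).eval σ) → τ 11 = 1) ∧
        ∀ v, v < 11 ∨ (20 < v ∧ v < 24) ∨ 27 < v → τ v = σ v := by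
  obtain ⟨c, hc⟩ := exec_probe e he
  obtain ⟨d, hd⟩ := exec_record
  refine ⟨c + d, fun w hW σ hσ hb => ?_⟩
  obtain ⟨ρ, r1, r2, r3, r4, r5⟩ := hc w (by nlinarith) σ hσ hb
  obtain ⟨τ, t1, t2, t3, t4, t5⟩ := hd w (by nlinarith) ρ r2 (by rw [r4, r3])
  refine ⟨τ, r1.seq t1, t2, fun h => t3 (by rw [r5 11 (by omega), h]), fun h => t4 (by rwa [r3]),
    fun v hv => ?_⟩
  rw [t5 v (by omega), r5 v (by omega)]

/-- Record the first solution, if any, among the points with coordinates in the list. -/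
def tries : List (Fin 3 → Term) → Prog
  | [] => .skip
  | e :: l => .seq (.seq (probe e) (block record)) (tries l)

theorem exec_tries (l : List (Fin 3 → Term))
    (hl : ∀ e ∈ l, ∀ a, (e a).All fun v => v < 11 ∨ (20 < v ∧ v < 24) ∨ 27 < v) :
    ∃ c : ℕ, ∀ w : Inst, c * w.N ≤ w.W → ∀ σ, Inv w σ →
      (∀ e ∈ l, ∀ a, |(e a).eval σ| ≤ (10000 * w.N : ℕ)) →
      ∃ τ, Exec w.F w.W (tries l) σ τ c ∧ Inv w τ ∧ (σ 11 = 1 → τ 11 = 1) ∧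
        (∀ e ∈ l, IsSol w.G w.k (fun a => (e a).eval σ) → τ 11 = 1) ∧
        ∀ v, v < 11 ∨ (20 < v ∧ v < 24) ∨ 27 < v → τ v = σ v := by
  induction l with
  | nil =>
    exact ⟨1, fun w _ σ hσ _ => ⟨σ, ⟨1, 0, .skip σ, by omega, le_rfl⟩, hσ, id, by simp, by simp⟩⟩
  | cons e l ih =>
    obtain ⟨c, hc⟩ := exec_tryPt e fun a => (hl e (by simp) a).mono fun v hv => by omega
    obtain ⟨d, hd⟩ := ih fun e' he' => hl e' (by simp [he'])
    refine ⟨c + d, fun w hW σ hσ hb => ?_⟩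
    obtain ⟨ρ, r1, r2, r3, r4, r5⟩ := hc w (by nlinarith) σ hσ (hb e (by simp))
    have hev : ∀ e' ∈ l, ∀ a, (e' a).eval ρ = (e' a).eval σ := fun e' he' a =>
      Term.eval_congr r5 (hl e' (by simp [he']) a)
    obtain ⟨τ, t1, t2, t3, t4, t5⟩ := hd w (by nlinarith) ρ r2 fun e' he' a => by
      rw [hev e' he']; exact hb e' (by simp [he']) a
    refine ⟨τ, r1.seq t1, t2, fun h => t3 (r3 h), fun e' he' hs => ?_, fun v hv => ?_⟩
    · rcases List.mem_cons.1 he' with rfl | he'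
      · exact t3 (r4 hs)
      · exact t4 e' he' (by simpa only [hev e' he'] using hs)
    · rw [t5 v hv, r5 v hv]

/-- The program `P` runs in time `O(log N)`, changes no main variable, and ends with a solution if
one was recorded before or the main variables satisfy `S`. -/
def IsPiece (P : Prog) (S : Inst → Store → Prop) : Prop :=
  ∃ c : ℕ, ∀ w : Inst, c * w.N ≤ w.W → ∀ σ, Inv w σ →
    ∃ τ, Exec w.F w.W P σ τ (c * (Nat.log 2 w.N + 1)) ∧ Inv w τ ∧ snap τ = snap σ ∧
      (σ 11 = 1 → τ 11 = 1) ∧ (S w (snap σ) → τ 11 = 1)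

theorem IsPiece.seq {P Q : Prog} {S T : Inst → Store → Prop} (hP : IsPiece P S) (hQ : IsPiece Q T) :
    IsPiece (.seq P Q) (fun w σ => S w σ ∨ T w σ) := by
  obtain ⟨c, hc⟩ := hP
  obtain ⟨d, hd⟩ := hQ
  refine ⟨c + d, fun w hW σ hσ => ?_⟩
  obtain ⟨ρ, r1, r2, r3, r4, r5⟩ := hc w (by nlinarith) σ hσ
  obtain ⟨τ, t1, t2, t3, t4, t5⟩ := hd w (by nlinarith) ρ r2
  refine ⟨τ, (r1.seq t1).mono (by rw [add_mul]), t2, t3.trans r3, fun h => t4 (r4 h), ?_⟩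
  rintro (h | h)
  · exact t4 (r5 h)
  · exact t5 (by rwa [r3])

theorem IsPiece.imp {P : Prog} {S T : Inst → Store → Prop} (hP : IsPiece P S)
    (h : ∀ w σ, T w σ → S w σ) : IsPiece P T := by
  obtain ⟨c, hc⟩ := hP
  refine ⟨c, fun w hW σ hσ => ?_⟩
  obtain ⟨ρ, r1, r2, r3, r4, r5⟩ := hc w hW σ hσ
  exact ⟨ρ, r1, r2, r3, r4, fun hT => r5 (h _ _ hT)⟩

/-- Run the programs `P i`, for all `i` of a finite type, in some order. -/
noncomputable def forAll {ι : Type} [Fintype ι] (P : ι → Prog) : Prog :=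
  (Finset.univ.toList.map P).foldr .seq .skip

theorem IsPiece.forAll {ι : Type} [Fintype ι] {P : ι → Prog} {S : ι → Inst → Store → Prop}
    (h : ∀ i, IsPiece (P i) (S i)) : IsPiece (forAll P) (fun w σ => ∃ i, S i w σ) := by
  have key : ∀ l : List ι, IsPiece ((l.map P).foldr .seq .skip)
      (fun w σ => ∃ i ∈ l, S i w σ) := by
    intro l
    induction l with
    | nil =>
      refine ⟨1, fun w hW σ hσ => ⟨σ, ⟨1, 0, .skip σ, by omega, by omega⟩, hσ, rfl, id, ?_⟩⟩
      simp
    | cons i l ih => exact ((h i).seq ih).imp fun w σ hT => by simpa using hT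
  exact (key _).imp fun w σ ⟨i, hi⟩ => ⟨i, by simp, hi⟩

/-- The point with coordinates `x` in the coordinate system of `conjMap s π`. -/
def actTerm (s : ℤ) (π : Equiv.Perm (Fin 3)) (x : Fin 3 → Term) : Fin 3 → Term :=
  fun a => .smul s (x (π a))

theorem eval_actTerm (s : ℤ) (π : Equiv.Perm (Fin 3)) (x : Fin 3 → Term) (σ : Store) :
    (fun a => (actTerm s π x a).eval σ) = actPt s π fun a => (x a).eval σ := rfl

theorem abs_eval_main {w : Inst} {σ : Store} (hσ : Inv w σ) {t : Term} (ht : t.All IsMain)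
    (hg : t.grow ≤ 50) : |t.eval σ| ≤ (1000 * w.N : ℕ) := by
  have hN := w.three_le_N
  refine (Term.abs_eval_le (B := 20 * w.N) (by omega) hσ.main ht).trans ?_
  exact_mod_cast (by nlinarith : t.grow * (20 * w.N) ≤ 1000 * w.N)

theorem isMain_cases {v : ℕ} (h : IsMain v) : v < 11 ∨ (20 < v ∧ v < 24) ∨ 27 < v := by
  simp only [IsMain] at h; omega

theorem isPiece_try {s : ℤ} (hs : s = 1 ∨ s = -1) (e : Fin 3 → Term)
    (he : ∀ a, (e a).All IsMain ∧ (e a).grow ≤ 50) :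
    IsPiece (tries [actTerm s 1 e])
      (fun w σ => IsSol (conjMap s 1 w.G) (s * w.k) fun a => (e a).eval σ) := by
  obtain ⟨c, hc⟩ := exec_tries [actTerm s 1 e] (by
    simp only [List.mem_singleton, forall_eq]
    exact fun a => (he a).1.mono fun v hv => isMain_cases hv)
  refine ⟨c, fun w hW σ hσ => ?_⟩
  obtain ⟨τ, t1, t2, t3, t4, t5⟩ := hc w hW σ hσ (by
    simp only [List.mem_singleton, forall_eq]
    intro a
    have h : |(actTerm s 1 e a).eval σ| = |(e a).eval σ| := by
      rcases hs with rfl | rfl <;> simp [actTerm, Term.eval]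
    rw [h]
    refine (abs_eval_main hσ (he a).1 (he a).2).trans ?_
    push_cast; omega)
  refine ⟨τ, t1.mono (Nat.le_mul_of_pos_right _ (Nat.succ_pos _)), t2,
    snap_eq fun v hv => t5 v (isMain_cases hv), t3, fun h => t4 (actTerm s 1 e) (by simp) ?_⟩
  simp only [Term.eval_snap (he _).1] at h
  exact h.of_conjMap hs

/-! ### Binary search along a line -/

/-- The second coordinate of the point at level `s * k` with first coordinate `x` on the line. -/
def secondT (s : ℤ) (x : Term) : Term := .sub (.sub (.smul s (.var 3)) (.var 52)) x

/-- The point of the line with first coordinate `x`. -/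
def lineT (s : ℤ) (π : Equiv.Perm (Fin 3)) (x : Term) : Fin 3 → Term :=
  actTerm s π ![x, secondT s x, .var 52]

/-- Whether the map increases the last coordinate at the point just probed. -/
def lastT (s : ℤ) (π : Equiv.Perm (Fin 3)) (a b : Term) : Term :=
  .ifLe (.add (.var 52) (.const 1)) (.smul s (.var (15 + π.symm 2))) a b

/-- Query the middle of the current interval of the line, and move one of its ends there. -/
def searchBody (s : ℤ) (π : Equiv.Perm (Fin 3)) : Prog :=
  .seq (block [(23, .div (.add (.var 21) (.var 22)) 1)]) (.seq (probe (lineT s π (.var 23)))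
    (block [(21, lastT s π (.var 23) (.var 21)), (22, lastT s π (.var 22) (.var 23))]))

/-- The two ends of the interval are not adjacent. -/
def searchGuard : Term := .leT (.add (.var 21) (.const 2)) (.var 22)

/-- The four points of `LinePair.isSol`. -/
def searchCandidates (s : ℤ) (π : Equiv.Perm (Fin 3)) : List (Fin 3 → Term) :=
  [actTerm s π ![.var 53, secondT s (.var 21), .var 55],
    actTerm s π ![.var 50, secondT s (.var 22), .var 52],
    actTerm s π ![.var 22, secondT s (.var 21), .var 52],
    actTerm s π ![.var 21, secondT s (.var 22), .var 52]]

/-- Search a solution between `A` and `B`, given in signed coordinates, for a line pair with respect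
to `conjMap s π`. -/
def search (s : ℤ) (π : Equiv.Perm (Fin 3)) (A B : Fin 3 → Term) : Prog :=
  .seq (block (setVec 50 (A ∘ π.symm))) (.seq (block (setVec 53 (B ∘ π.symm)))
    (.seq (block [(21, .var 50), (22, .add (.var 53) (.const 1))])
      (.seq (whileT searchGuard (searchBody s π)) (tries (searchCandidates s π)))))

theorem all_vec3 {p : ℕ → Prop} {x y z : Term} (hx : x.All p) (hy : y.All p) (hz : z.All p)
    (s : ℤ) (π : Equiv.Perm (Fin 3)) (a : Fin 3) : (actTerm s π ![x, y, z] a).All p := by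
  simp only [actTerm, Term.All]
  generalize π a = b
  fin_cases b <;> assumption

theorem eval_vec3 (x y z : Term) (σ : Store) :
    (fun a => ((![x, y, z] : Fin 3 → Term) a).eval σ) = ![x.eval σ, y.eval σ, z.eval σ] := by
  ext a; fin_cases a <;> rfl

theorem abs_vec3 {s : ℤ} (hs : s = 1 ∨ s = -1) (π : Equiv.Perm (Fin 3)) {x y z : Term} {σ : Store}
    {B : ℤ} (hx : |x.eval σ| ≤ B) (hy : |y.eval σ| ≤ B) (hz : |z.eval σ| ≤ B) (a : Fin 3) :
    |(actTerm s π ![x, y, z] a).eval σ| ≤ B := by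
  simp only [actTerm, Term.eval, abs_mul]
  have : |s| = 1 := by rcases hs with rfl | rfl <;> rfl
  rw [this, one_mul]
  generalize π a = b
  fin_cases b <;> assumption

theorem abs_secondT {s : ℤ} (hs : s = 1 ∨ s = -1) {w : Inst} {σ : Store} (hσ : Inv w σ)
    (h : |σ 52| ≤ 1000 * w.N) {x : Term} (hx : |x.eval σ| ≤ 1001 * w.N) :
    |(secondT s x).eval σ| ≤ (10000 * w.N : ℕ) := by
  have := w.k_bounds
  have := hσ.level
  simp only [secondT, Term.eval]
  rw [abs_le] at *
  push_cast
  rcases hs with rfl | rfl <;> constructor <;> linarith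

/-- The part of the loop invariant of the binary search that makes it succeed: at the left end the
map `H` increases the last coordinate; at the right end it does not, unless that is just beyond
`w'`. -/
structure Straddles (H : (Fin 3 → ℤ) → Fin 3 → ℤ) (k : ℤ) (w w' : Fin 3 → ℤ) (a b : ℤ) : Prop where
  le_a : w 0 ≤ a
  lt : a < b
  b_le : b ≤ w' 0 + 1
  at_a : w 2 < H ![a, k - w 2 - a, w 2] 2
  at_b : b = w' 0 + 1 ∨ H ![b, k - w 2 - b, w 2] 2 ≤ w 2

theorem exec_searchBody {s : ℤ} (hs : s = 1 ∨ s = -1) (π : Equiv.Perm (Fin 3)) :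
    ∃ c : ℕ, ∀ w : Inst, c * w.N ≤ w.W → ∀ σ, Inv w σ → σ 21 + 2 ≤ σ 22 →
      |σ 52| ≤ 1000 * w.N → |σ 21| ≤ 1001 * w.N → |σ 22| ≤ 1001 * w.N →
      ∃ τ m, Exec w.F w.W (searchBody s π) σ τ c ∧ Inv w τ ∧ m = (σ 21 + σ 22) / 2 ∧
        (∀ v, v < 12 ∨ 23 < v → τ v = σ v) ∧
        ((σ 52 < conjMap s π w.G ![m, s * w.k - σ 52 - m, σ 52] 2 ∧ τ 21 = m ∧ τ 22 = σ 22) ∨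
          (conjMap s π w.G ![m, s * w.k - σ 52 - m, σ 52] 2 ≤ σ 52 ∧ τ 21 = σ 21 ∧ τ 22 = m)) := by
  obtain ⟨c1, h1⟩ := exec_block [(23, .div (.add (.var 21) (.var 22)) 1)]
  obtain ⟨c2, h2⟩ := exec_probe (lineT s π (.var 23))
    (all_vec3 (by simp [Term.All]) (by simp [secondT, Term.All]) (by simp [Term.All]) s π)
  obtain ⟨c3, h3⟩ := exec_block
    [(21, lastT s π (.var 23) (.var 21)), (22, lastT s π (.var 22) (.var 23))]
  refine ⟨10000 * c1 + c2 + 10000 * c3, fun w hW σ hσ hlt h52 h21 h22 => ?_⟩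
  have hN := w.three_le_N
  have r1 := h1 w.F w.W (10000 * w.N) σ (by omega) hσ.bound (by nlinarith)
  set m : ℤ := (σ 21 + σ 22) / 2 with hm
  have e1 : runBlock [(23, .div (.add (.var 21) (.var 22)) 1)] σ = Function.update σ 23 m := by
    simp [runBlock, Term.eval, hm]
  rw [e1] at r1
  set ρ := Function.update σ 23 m
  have hmb : |m| ≤ 1001 * w.N := by
    rw [abs_le] at *; omega
  have f1 : ∀ v, v ≠ 23 → ρ v = σ v := fun v hv => Function.update_of_ne hv _ _
  have f2 : ρ 23 = m := Function.update_self _ _ _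
  have hρ : Inv w ρ := by
    refine hσ.of_eq (fun v => ?_) (fun v hv => f1 v (by simp only [IsMain] at hv; omega))
    by_cases hv : v = 23
    · subst hv; rw [f2]; refine hmb.trans ?_; push_cast; omega
    · rw [f1 v hv]; exact hσ.bound v
  obtain ⟨ρ', s1, s2, -, s4, s5⟩ := h2 w (by nlinarith) ρ hρ (abs_vec3 hs π
    (by simp only [Term.eval]; rw [f2]; refine hmb.trans ?_; push_cast; omega)
    (abs_secondT hs hρ (by rw [f1 _ (by omega)]; exact h52)
      (by simpa only [Term.eval, f2] using hmb))
    (hρ.bound 52))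
  have r3 := h3 w.F w.W (10000 * w.N) ρ' (by omega) s2.bound (by nlinarith)
  set τ := runBlock [(21, lastT s π (.var 23) (.var 21)), (22, lastT s π (.var 22) (.var 23))] ρ'
  have g1 : ∀ v, v ≠ 21 → v ≠ 22 → τ v = ρ' v := fun v h h' =>
    runBlock_of_notMem (by simp; omega) _
  have hH : s * ρ' (15 + π.symm 2) = conjMap s π w.G ![m, s * w.k - σ 52 - m, σ 52] 2 := by
    have : ρ' (15 + π.symm 2) = vec ρ' 15 (π.symm 2) := rfl
    rw [this, s4, lineT, eval_actTerm, eval_vec3, conjMap]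
    simp only [secondT, Term.eval, f2, f1 52 (by omega), f1 3 (by omega), hσ.level]
  have k52 : ρ' 52 = σ 52 := by rw [s5 _ (by omega), f1 _ (by omega)]
  have k21 : ρ' 21 = σ 21 := by rw [s5 _ (by omega), f1 _ (by omega)]
  have k22 : ρ' 22 = σ 22 := by rw [s5 _ (by omega), f1 _ (by omega)]
  have k23 : ρ' 23 = m := by rw [s5 _ (by omega), f2]
  have hne : 15 + ((π.symm 2 : Fin 3) : ℕ) ≠ 21 := by omega
  have t21 : τ 21 = if σ 52 + 1 ≤ conjMap s π w.G ![m, s * w.k - σ 52 - m, σ 52] 2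
      then m else σ 21 := by
    rw [← hH, ← k52, ← k21, ← k23]
    simp [τ, runBlock, lastT, Term.eval]
  have t22 : τ 22 = if σ 52 + 1 ≤ conjMap s π w.G ![m, s * w.k - σ 52 - m, σ 52] 2
      then σ 22 else m := by
    rw [← hH, ← k52, ← k22, ← k23]
    simp [τ, runBlock, lastT, Term.eval, hne]
  refine ⟨τ, m, (r1.seq (s1.seq r3)).mono (by omega), ?_, rfl, fun v hv => ?_, ?_⟩
  · refine s2.of_eq (fun v => ?_) (fun v hv => g1 v ?_ ?_)
    · by_cases hv : v = 21 ∨ v = 22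
      · have : |τ v| ≤ 1001 * w.N := by
          rcases hv with rfl | rfl
          · rw [t21]; split_ifs <;> assumption
          · rw [t22]; split_ifs <;> assumption
        refine this.trans ?_; push_cast; omega
      · rw [g1 v (by omega) (by omega)]; exact s2.bound v
    all_goals simp only [IsMain] at hv; omega
  · rw [g1 v (by omega) (by omega), s5 v (by omega), f1 v (by omega)]
  · by_cases hc : σ 52 + 1 ≤ conjMap s π w.G ![m, s * w.k - σ 52 - m, σ 52] 2
    · left; rw [t21, t22, if_pos hc, if_pos hc]; exact ⟨hc, rfl, rfl⟩
    · right; rw [t21, t22, if_neg hc, if_neg hc]; exact ⟨by omega, rfl, rfl⟩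

/-- The loop of the binary search takes time `O(log N)`; if it starts from a straddling pair of
ends, it leads to an adjacent one. -/
theorem exec_searchLoop {s : ℤ} (hs : s = 1 ∨ s = -1) (π : Equiv.Perm (Fin 3)) :
    ∃ c : ℕ, ∀ w : Inst, c * w.N ≤ w.W → ∀ σ, Inv w σ → |σ 52| ≤ 1000 * w.N →
      |σ 21| ≤ 1001 * w.N → |σ 22| ≤ 1001 * w.N →
      ∃ τ, Exec w.F w.W (whileT searchGuard (searchBody s π)) σ τ (c * (Nat.log 2 w.N + 1)) ∧
        Inv w τ ∧ (∀ v, v < 12 ∨ 23 < v → τ v = σ v) ∧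
        |τ 21| ≤ 1001 * w.N ∧ |τ 22| ≤ 1001 * w.N ∧
        (Straddles (conjMap s π w.G) (s * w.k) (vec σ 50) (vec σ 53) (σ 21) (σ 22) →
          Straddles (conjMap s π w.G) (s * w.k) (vec σ 50) (vec σ 53) (τ 21) (τ 22) ∧
            τ 22 = τ 21 + 1) := by
  obtain ⟨d, hd⟩ := exec_searchBody hs π
  obtain ⟨c, hc⟩ := exec_whileT searchGuard (searchBody s π)
  refine ⟨13 * (10000 * c + d), fun w hW σ hσ h52 h21 h22 => ?_⟩
  have hN := w.three_le_N
  have hguard : ∀ ρ : Store, searchGuard.Holds ρ ↔ ρ 21 + 2 ≤ ρ 22 := fun ρ => by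
    simp [searchGuard, Term.eval]
  -- The ends are at most `2002 N` apart, which is less than `2 ^ (log N + 12)`.
  obtain ⟨τ, T', t1, ⟨i1, i2, i3, i4, i5, i6⟩, t3⟩ := hc w.F w.W (10000 * w.N) d
    (fun T ρ => Inv w ρ ∧ (∀ v, v < 12 ∨ 23 < v → ρ v = σ v) ∧
      |ρ 21| ≤ 1001 * w.N ∧ |ρ 22| ≤ 1001 * w.N ∧ ρ 22 - ρ 21 ≤ 2 ^ T ∧
      (Straddles (conjMap s π w.G) (s * w.k) (vec σ 50) (vec σ 53) (σ 21) (σ 22) →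
        Straddles (conjMap s π w.G) (s * w.k) (vec σ 50) (vec σ 53) (ρ 21) (ρ 22)))
    (by omega) (by nlinarith) (by
      rintro T ρ ⟨i1, i2, i3, i4, i5, i6⟩
      refine ⟨i1.bound, fun hg => ?_⟩
      rw [hguard] at hg
      obtain ⟨T, rfl⟩ : ∃ T', T = T' + 1 := by
        cases T with
        | zero => simp at i5; omega
        | succ T => exact ⟨T, rfl⟩
      rw [pow_succ] at i5
      have e52 : ρ 52 = σ 52 := i2 52 (by omega)
      obtain ⟨τ, m, t1, t2, hm, t3, t4⟩ := hd w (by nlinarith) ρ i1 hg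
        (by rw [e52]; exact h52) i3 i4
      refine ⟨T, τ, rfl, t1, t2, fun v hv => by rw [t3 v hv, i2 v hv], ?_, ?_, ?_, fun hS => ?_⟩
      · rw [abs_le] at *; rcases t4 with t4 | t4 <;> omega
      · rw [abs_le] at *; rcases t4 with t4 | t4 <;> omega
      · rcases t4 with t4 | t4 <;> omega
      · obtain ⟨j1, j2, j3, j4, j5⟩ := i6 hS
        have ev : vec σ 50 2 = σ 52 := rfl
        rw [e52] at t4
        rw [ev] at *
        rcases t4 with ⟨t4, t5, t6⟩ | ⟨t4, t5, t6⟩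
        · rw [t5, t6]
          exact ⟨by omega, by omega, j3, t4, j5⟩
        · rw [t5, t6]
          exact ⟨j1, by omega, by omega, j4, Or.inr t4⟩)
    (Nat.log 2 w.N + 12) σ ⟨hσ, fun _ _ => rfl, h21, h22, by
      have := Nat.lt_pow_succ_log_self (b := 2) (by omega) w.N
      have e : 2 ^ (Nat.log 2 w.N + 12) = 2048 * 2 ^ (Nat.log 2 w.N).succ := by
        rw [Nat.succ_eq_add_one, pow_add, pow_add]; ring
      have : 2048 * w.N ≤ 2 ^ (Nat.log 2 w.N + 12) := by omega
      have : ((2048 * w.N : ℕ) : ℤ) ≤ 2 ^ (Nat.log 2 w.N + 12) := by exact_mod_cast this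
      rw [abs_le] at *
      push_cast at this
      omega, id⟩
  refine ⟨τ, t1.mono ?_, i1, i2, i3, i4, fun hS => ⟨i6 hS, ?_⟩⟩
  · nlinarith [Nat.zero_le (Nat.log 2 w.N), Nat.zero_le c, Nat.zero_le (c * Nat.log 2 w.N),
      Nat.zero_le (d * Nat.log 2 w.N)]
  · rw [hguard] at t3
    have := (i6 hS).lt
    omega

theorem LinePair.straddles {H : (Fin 3 → ℤ) → Fin 3 → ℤ} {k : ℤ} {w w' : Fin 3 → ℤ}
    (h : LinePair H k w w') : Straddles H k w w' (w 0) (w' 0 + 1) := by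
  have e : ![w 0, k - w 2 - w 0, w 2] = w := by
    have := h.lower.level_eq
    rw [Fin.sum_univ_three] at this
    ext a; fin_cases a <;> simp; omega
  exact ⟨le_rfl, by have := h.left; omega, le_rfl, by rw [e]; exact h.lower.lt, Or.inl rfl⟩

theorem isPiece_search {s : ℤ} (hs : s = 1 ∨ s = -1) (π : Equiv.Perm (Fin 3)) {A B : Fin 3 → Term}
    (hA : ∀ a, (A a).All IsMain ∧ (A a).grow ≤ 50) (hB : ∀ a, (B a).All IsMain ∧ (B a).grow ≤ 50) :
    IsPiece (search s π A B) (fun w σ => LinePair (conjMap s π w.G) (s * w.k)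
      ((fun a => (A a).eval σ) ∘ π.symm) ((fun a => (B a).eval σ) ∘ π.symm)) := by
  obtain ⟨c1, h1⟩ := exec_block (setVec 50 (A ∘ π.symm))
  obtain ⟨c2, h2⟩ := exec_block (setVec 53 (B ∘ π.symm))
  obtain ⟨c3, h3⟩ := exec_block [(21, .var 50), (22, .add (.var 53) (.const 1))]
  obtain ⟨c4, h4⟩ := exec_searchLoop hs π
  obtain ⟨c5, h5⟩ := exec_tries (searchCandidates s π) (by
    simp only [searchCandidates, List.mem_cons, List.not_mem_nil, or_false]
    rintro e (rfl | rfl | rfl | rfl) <;>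
    exact all_vec3 (by simp [Term.All]) (by simp [Term.All, secondT])
      (by simp [Term.All]) s π)
  refine ⟨10000 * c1 + 10000 * c2 + 10000 * c3 + c4 + c5, fun w hW σ hσ => ?_⟩
  have hN := w.three_le_N
  -- The arguments of the search are copied.
  have r1 := h1 w.F w.W (10000 * w.N) σ (by omega) hσ.bound (by nlinarith)
  obtain ⟨a1, a2⟩ := runBlock_setVec (b := 50) (e := A ∘ π.symm)
    (fun a => (hA _).1.mono fun v hv => by simp only [IsMain] at hv; omega) σ
  set σ1 := runBlock (setVec 50 (A ∘ π.symm)) σ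
  have hσ1 : Inv w σ1 := by
    refine hσ.of_eq (fun v => ?_) (fun v hv => a2 v (by simp only [IsMain] at hv; omega))
    by_cases hv : v < 50 ∨ 50 + 2 < v
    · rw [a2 v hv]; exact hσ.bound v
    · obtain ⟨a, rfl⟩ : ∃ a : Fin 3, v = 50 + a := ⟨⟨v - 50, by omega⟩, by simp; omega⟩
      change |vec σ1 50 a| ≤ _
      rw [a1]
      refine (abs_eval_main hσ (hA _).1 (hA _).2).trans ?_
      push_cast; omega
  have r2 := h2 w.F w.W (10000 * w.N) σ1 (by omega) hσ1.bound (by nlinarith)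
  obtain ⟨b1, b2⟩ := runBlock_setVec (b := 53) (e := B ∘ π.symm)
    (fun a => (hB _).1.mono fun v hv => by simp only [IsMain] at hv; omega) σ1
  set σ2 := runBlock (setVec 53 (B ∘ π.symm)) σ1
  have hBe : ∀ a, (B a).eval σ1 = (B a).eval σ := fun a => Term.eval_congr
    (fun v hv => a2 v (by simp only [IsMain] at hv; omega)) (hB a).1
  have hσ2 : Inv w σ2 := by
    refine hσ1.of_eq (fun v => ?_) (fun v hv => b2 v (by simp only [IsMain] at hv; omega))
    by_cases hv : v < 53 ∨ 53 + 2 < v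
    · rw [b2 v hv]; exact hσ1.bound v
    · obtain ⟨a, rfl⟩ : ∃ a : Fin 3, v = 53 + a := ⟨⟨v - 53, by omega⟩, by simp; omega⟩
      change |vec σ2 53 a| ≤ _
      rw [b1]
      refine (abs_eval_main hσ1 (hB _).1 (hB _).2).trans ?_
      push_cast; omega
  have v50 : vec σ2 50 = (fun a => (A a).eval σ) ∘ π.symm := by
    ext a; rw [vec_apply, b2 _ (by omega)]; exact congrFun a1 a
  have v53 : vec σ2 53 = (fun a => (B a).eval σ) ∘ π.symm := by
    rw [b1]; ext a; exact hBe _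
  have n50 : ∀ a, |vec σ2 50 a| ≤ (1000 * w.N : ℕ) := fun a => by
    rw [v50]; exact abs_eval_main hσ (hA _).1 (hA _).2
  have n53 : ∀ a, |vec σ2 53 a| ≤ (1000 * w.N : ℕ) := fun a => by
    rw [v53]; exact abs_eval_main hσ (hB _).1 (hB _).2
  have r3 := h3 w.F w.W (10000 * w.N) σ2 (by omega) hσ2.bound (by nlinarith)
  set σ3 := runBlock [(21, .var 50), (22, .add (.var 53) (.const 1))] σ2 with hσ3d
  have c21 : σ3 21 = vec σ2 50 0 := by simp [σ3, runBlock, Term.eval, vec]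
  have c22 : σ3 22 = vec σ2 53 0 + 1 := by simp [σ3, runBlock, Term.eval, vec]
  have cv : ∀ v, v ≠ 21 → v ≠ 22 → σ3 v = σ2 v := fun v h h' =>
    runBlock_of_notMem (by simp; omega) _
  have m21 : |σ3 21| ≤ 1001 * w.N := by
    have := n50 0; rw [c21]; rw [abs_le] at *; push_cast at *; omega
  have m22 : |σ3 22| ≤ 1001 * w.N := by
    have := n53 0; rw [c22]; rw [abs_le] at *; push_cast at *; omega
  have hσ3 : Inv w σ3 := by
    refine hσ2.of_eq (fun v => ?_) (fun v hv => cv v ?_ ?_)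
    · by_cases hv : v = 21 ∨ v = 22
      · rcases hv with rfl | rfl
        · refine m21.trans ?_; push_cast; omega
        · refine m22.trans ?_; push_cast; omega
      · rw [cv v (by omega) (by omega)]; exact hσ2.bound v
    all_goals simp only [IsMain] at hv; omega
  have e50 : vec σ3 50 = vec σ2 50 := by ext a; exact cv _ (by omega) (by omega)
  have e53 : vec σ3 53 = vec σ2 53 := by ext a; exact cv _ (by omega) (by omega)
  have m50 : ∀ a, |vec σ3 50 a| ≤ 1000 * w.N := fun a => by rw [e50]; exact_mod_cast n50 a
  have m53 : ∀ a, |vec σ3 53 a| ≤ 1000 * w.N := fun a => by rw [e53]; exact_mod_cast n53 a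
  obtain ⟨σ4, r4, i4, d4, m21', m22', hS⟩ := h4 w (by nlinarith) σ3 hσ3 (m50 2) m21 m22
  have d52 : |σ4 52| ≤ 1000 * w.N := by rw [d4 _ (by omega)]; exact m50 2
  obtain ⟨τ, r5, i5, d5, hsol, f5⟩ := h5 w (by nlinarith) σ4 i4 (by
    have l21 := abs_secondT hs i4 d52 (x := .var 21) m21'
    have l22 := abs_secondT hs i4 d52 (x := .var 22) m22'
    simp only [searchCandidates, List.mem_cons, List.not_mem_nil, or_false]
    rintro e (rfl | rfl | rfl | rfl) <;>
    exact abs_vec3 hs π (i4.bound _) (by assumption) (i4.bound _))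
  refine ⟨τ, (r1.seq (r2.seq (r3.seq (r4.seq r5)))).mono ?_, i5, snap_eq fun v hv => ?_, ?_, ?_⟩
  · nlinarith [Nat.zero_le ((c1 + c2 + c3 + c5) * Nat.log 2 w.N)]
  · rw [f5 v (isMain_cases hv)]
    simp only [IsMain] at hv
    rw [d4 v (by omega), cv v (by omega) (by omega), b2 v (by omega), a2 v (by omega)]
  · intro h
    refine d5 ?_
    rw [d4 11 (by omega), cv 11 (by omega) (by omega), b2 11 (by omega), a2 11 (by omega), h]
  · intro hL
    simp only [Term.eval_snap (hA _).1, Term.eval_snap (hB _).1] at hL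
    rw [← v50, ← v53, ← e50, ← e53] at hL
    have hS0 := hL.straddles
    have q21 : σ3 21 = vec σ3 50 0 := by rw [c21, e50]
    have q22 : σ3 22 = vec σ3 53 0 + 1 := by rw [c22, e53]
    rw [← q21, ← q22] at hS0
    obtain ⟨⟨j1, j2, j3, j4, j5⟩, hadj⟩ := hS hS0
    have key := hL.isSol (conjMap_monotone hs π w.G_monotone) rfl rfl j1 (by omega) hadj j4
      (by rcases j5 with j5 | j5
          · left; omega
          · right; exact j5)
    have p1 : vec σ3 50 0 = σ4 50 := (d4 50 (by omega)).symm
    have p2 : vec σ3 50 2 = σ4 52 := (d4 52 (by omega)).symm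
    have p3 : vec σ3 53 0 = σ4 53 := (d4 53 (by omega)).symm
    have p4 : vec σ3 53 2 = σ4 55 := (d4 55 (by omega)).symm
    rw [p1, p2, p3, p4] at key
    have fin : ∀ x y z : Term, actTerm s π ![x, y, z] ∈ searchCandidates s π →
        IsSol (conjMap s π w.G) (s * w.k) ![x.eval σ4, y.eval σ4, z.eval σ4] → τ 11 = 1 := by
      intro x y z hmem h
      refine hsol _ hmem ?_
      rw [eval_actTerm, eval_vec3]
      exact h.of_conjMap hs
    have hsec : ∀ v : ℕ, (secondT s (.var v)).eval σ4 = s * w.k - σ4 52 - σ4 v := fun v => by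
      rw [← i4.level]; rfl
    rcases key with key | key | key | key
    · exact fin (.var 53) (secondT s (.var 21)) (.var 55) (by simp [searchCandidates])
        (by rw [hsec]; exact key)
    · exact fin (.var 50) (secondT s (.var 22)) (.var 52) (by simp [searchCandidates])
        (by rw [hsec]; exact key)
    · exact fin (.var 22) (secondT s (.var 21)) (.var 52) (by simp [searchCandidates])
        (by rw [hsec]; exact key)
    · exact fin (.var 21) (secondT s (.var 22)) (.var 52) (by simp [searchCandidates])
        (by rw [hsec]; exact key)

/-! ### The final stage -/

theorem conjMap_conjMap (s : ℤ) (π : Equiv.Perm (Fin 3)) (G : (Fin 3 → ℤ) → Fin 3 → ℤ) :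
    conjMap 1 π (conjMap s 1 G) = conjMap s π G := by
  ext y b
  have : actPt s 1 (actPt 1 π y) = actPt s π y := by ext a; simp [actPt]
  change 1 * (s * G (actPt s 1 (actPt 1 π y)) (π.symm b)) = s * G (actPt s π y) (π.symm b)
  rw [this, one_mul]

/-- The terms for `corner`, in terms of those for the witnesses. -/
def cornerT (e : Fin 3 → Fin 3 → Term) (i : Fin 3) : Fin 3 → Term :=
  fun a => if a = i then .add (e a a) (.const 1) else e a a

/-- The terms for `midpt`. -/
def midptT (e : Fin 3 → Fin 3 → Term) (i : Fin 3) : Fin 3 → Term :=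
  fun a => if a = i then e a a else .add (e a a) (.const 1)

/-- The terms for `cornerMeet`. -/
def cornerMeetT (e : Fin 3 → Fin 3 → Term) (i : Fin 3) : Fin 3 → Term := fun a =>
  if a = i then (e (i + 1) i).min (e (i + 2) i)
  else if a = i + 1 then (e (i + 1) (i + 1)).min (e (i + 2) (i + 1))
  else (e (i + 2) (i + 2)).min (e (i + 1) (i + 2))

/-- The points that the terms `e` stand for. -/
def evalAll (σ : Store) (e : Fin 3 → Fin 3 → Term) : Fin 3 → Fin 3 → ℤ := fun i a => (e i a).eval σ

section
variable (σ : Store) (e : Fin 3 → Fin 3 → Term) (i : Fin 3)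

theorem eval_cornerT : (fun a => (cornerT e i a).eval σ) = corner (evalAll σ e) i := by
  ext a; simp only [cornerT, corner, evalAll]; split_ifs <;> rfl

theorem eval_midptT : (fun a => (midptT e i a).eval σ) = midpt (evalAll σ e) i := by
  ext a; simp only [midptT, midpt, evalAll]; split_ifs <;> rfl

theorem eval_cornerMeetT : (fun a => (cornerMeetT e i a).eval σ) = cornerMeet (evalAll σ e) i := by
  ext a; simp only [cornerMeetT, cornerMeet, evalAll]; split_ifs <;> simp

end

/-- Find a solution from three lower witnesses bounding a triangle of side length one. -/
noncomputable def unitStage (s : ℤ) (e : Fin 3 → Fin 3 → Term) : Prog :=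
  .seq (tries [actTerm s 1 fun a => e a a])
    (.seq (forAll fun i => tries [actTerm s 1 (cornerT e i)])
      (.seq (forAll fun i => tries [actTerm s 1 (cornerMeetT e i)])
        (forAll fun p : Fin 3 × Equiv.Perm (Fin 3) =>
          search s p.2 (e (p.2.symm 2)) (cornerT e p.1))))

theorem isPiece_unitStage {s : ℤ} (hs : s = 1 ∨ s = -1) {e : Fin 3 → Fin 3 → Term}
    (he : ∀ i a, (e i a).All IsMain ∧ (e i a).grow ≤ 5) :
    IsPiece (unitStage s e)
      (fun w σ => UnitTriangle (conjMap s 1 w.G) (s * w.k) (evalAll σ e)) := by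
  have he' : ∀ i a, (e i a).All IsMain ∧ (e i a).grow ≤ 50 := fun i a =>
    ⟨(he i a).1, (he i a).2.trans (by norm_num)⟩
  have hc : ∀ i a, (cornerT e i a).All IsMain ∧ (cornerT e i a).grow ≤ 50 := by
    intro i a
    have := he a a
    simp only [cornerT]
    split_ifs
    · simp only [Term.All, Term.grow]; exact ⟨⟨this.1, trivial⟩, by simp; omega⟩
    · exact he' a a
  have hm : ∀ i a, (cornerMeetT e i a).All IsMain ∧ (cornerMeetT e i a).grow ≤ 50 := by
    have key : ∀ i j a b, ((e i a).min (e j b)).All IsMain ∧ ((e i a).min (e j b)).grow ≤ 50 := by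
      intro i j a b
      have h1 := he i a; have h2 := he j b
      simp only [Term.min, Term.All, Term.grow]
      exact ⟨⟨h1.1, h2.1, h1.1, h2.1⟩, by omega⟩
    intro i a
    simp only [cornerMeetT]
    split_ifs <;> exact key _ _ _ _
  refine ((isPiece_try hs _ fun a => he' a a).seq
    ((IsPiece.forAll fun i => isPiece_try hs _ (hc i)).seq
      ((IsPiece.forAll fun i => isPiece_try hs _ (hm i)).seq
        (IsPiece.forAll fun p : Fin 3 × Equiv.Perm (Fin 3) =>
          isPiece_search hs p.2 (he' (p.2.symm 2)) (hc p.1))))).imp fun w σ h => ?_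
  simp only [eval_cornerT, eval_cornerMeetT]
  rcases h.isSol (conjMap_monotone hs 1 w.G_monotone) with h | h | h | ⟨i, π, h⟩
  · exact Or.inl h
  · exact Or.inr (Or.inl h)
  · exact Or.inr (Or.inr (Or.inl h))
  · rw [conjMap_conjMap] at h
    exact Or.inr (Or.inr (Or.inr ⟨(i, π), h⟩))

/-- Find a solution from three lower witnesses bounding a triangle of side length two. -/
noncomputable def twoStage (s : ℤ) (e : Fin 3 → Fin 3 → Term) : Prog :=
  .seq (tries [actTerm s 1 fun a => .add (e a a) (.const 1)])
    (.seq (forAll fun i => tries [actTerm s 1 (midptT e i)])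
      (.seq (forAll fun p : Fin 3 × Equiv.Perm (Fin 3) =>
          search s p.2 (e (p.2.symm 2)) (midptT e p.1))
        (forAll fun p : Fin 3 × Fin 3 =>
          unitStage s (Function.update e p.2 (midptT e p.1)))))

theorem isPiece_twoStage {s : ℤ} (hs : s = 1 ∨ s = -1) {e : Fin 3 → Fin 3 → Term}
    (he : ∀ i a, (e i a).All IsMain ∧ (e i a).grow ≤ 2) :
    IsPiece (twoStage s e)
      (fun w σ => (∀ i, IsLower (conjMap s 1 w.G) (s * w.k) i (evalAll σ e i)) ∧
        ∑ i, evalAll σ e i i = s * w.k - 2) := by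
  have he' : ∀ i a, (e i a).All IsMain ∧ (e i a).grow ≤ 50 := fun i a =>
    ⟨(he i a).1, (he i a).2.trans (by norm_num)⟩
  have h1 : ∀ a, (Term.add (e a a) (.const 1)).All IsMain ∧
      (Term.add (e a a) (.const 1)).grow ≤ 5 := by
    intro a
    have := he a a
    simp only [Term.All, Term.grow]; exact ⟨⟨this.1, trivial⟩, by simp; omega⟩
  have hm : ∀ i a, (midptT e i a).All IsMain ∧ (midptT e i a).grow ≤ 5 := by
    intro i a
    simp only [midptT]
    split_ifs
    · exact ⟨(he a a).1, (he a a).2.trans (by norm_num)⟩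
    · exact h1 a
  have hm' : ∀ i a, (midptT e i a).All IsMain ∧ (midptT e i a).grow ≤ 50 := fun i a =>
    ⟨(hm i a).1, (hm i a).2.trans (by norm_num)⟩
  have hu : ∀ p : Fin 3 × Fin 3, ∀ i a, (Function.update e p.2 (midptT e p.1) i a).All IsMain ∧
      (Function.update e p.2 (midptT e p.1) i a).grow ≤ 5 := by
    intro p i a
    by_cases hi : i = p.2
    · subst hi; simpa using hm p.1 a
    · rw [Function.update_of_ne hi]; exact ⟨(he i a).1, (he i a).2.trans (by norm_num)⟩
  refine ((isPiece_try hs _ fun a => ⟨(h1 a).1, (h1 a).2.trans (by norm_num)⟩).seq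
    ((IsPiece.forAll fun i => isPiece_try hs _ (hm' i)).seq
      ((IsPiece.forAll fun p : Fin 3 × Equiv.Perm (Fin 3) =>
          isPiece_search hs p.2 (he' (p.2.symm 2)) (hm' p.1)).seq
        (IsPiece.forAll fun p : Fin 3 × Fin 3 =>
          isPiece_unitStage hs (hu p))))).imp fun w σ ⟨h, hsum⟩ => ?_
  simp only [eval_midptT]
  rcases exists_unitTriangle (conjMap_monotone hs 1 w.G_monotone) h hsum with
    h | h | ⟨i, π, h⟩ | ⟨i, j, h⟩
  · exact Or.inl h
  · exact Or.inr (Or.inl h)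
  · rw [conjMap_conjMap] at h
    exact Or.inr (Or.inr (Or.inl ⟨(i, π), h⟩))
  · refine Or.inr (Or.inr (Or.inr ⟨(i, j), ?_⟩))
    have : evalAll σ (Function.update e j (midptT e i)) =
        Function.update (evalAll σ e) j (midpt (evalAll σ e) i) := by
      ext a b
      by_cases ha : a = j
      · subst ha; simp [evalAll, ← eval_midptT]
      · simp [evalAll, ha]
    rw [this]; exact h

/-- The terms for the witnesses held by the variables `b + 3 i + a`. -/
def witT (b : ℕ) (i a : Fin 3) : Term := .var (b + 3 * i + a)

/-- The witnesses held by the variables `b + 3 i + a`. -/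
def wit (σ : Store) (b : ℕ) (i a : Fin 3) : ℤ := σ (b + 3 * i + a)

/-- The final stage: the region between the lines is empty. -/
noncomputable def finalStage : Prog :=
  .seq (forAll fun π : Equiv.Perm (Fin 3) => search 1 π (witT 30 (π.symm 2)) (witT 40 (π.symm 2)))
    (.seq (twoStage 1 (witT 30)) (twoStage (-1) fun i a => .smul (-1) (witT 40 i a)))

theorem isMain_wit (i a : Fin 3) : IsMain (30 + 3 * i + a) ∧ IsMain (40 + 3 * i + a) := by
  simp only [IsMain]; omega

/-- The witnesses bound the region: the lower lines are below the upper ones, and both triangles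
formed by them have side length at least two. -/
structure Bounded (w : Inst) (p q : Fin 3 → Fin 3 → ℤ) : Prop where
  lower : ∀ i, IsLower w.G w.k i (p i)
  upper : ∀ i, IsUpper w.G w.k i (q i)
  lt : ∀ i, p i i < q i i
  sum_lower : ∑ i, p i i + 2 ≤ w.k
  sum_upper : w.k + 2 ≤ ∑ i, q i i

theorem isPiece_finalStage : IsPiece finalStage (fun w σ =>
    Bounded w (wit σ 30) (wit σ 40) ∧
      ¬ HasInterior w.k (fun i => wit σ 30 i i) (fun i => wit σ 40 i i)) := by
  have h30 : ∀ i a, (witT 30 i a).All IsMain ∧ (witT 30 i a).grow ≤ 2 := fun i a =>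
    ⟨(isMain_wit i a).1, by simp [witT, Term.grow]⟩
  have h40 : ∀ i a, (witT 40 i a).All IsMain ∧ (witT 40 i a).grow ≤ 2 := fun i a =>
    ⟨(isMain_wit i a).2, by simp [witT, Term.grow]⟩
  refine ((IsPiece.forAll fun π : Equiv.Perm (Fin 3) => isPiece_search (Or.inl rfl) π
    (fun a => ⟨(h30 _ a).1, (h30 (π.symm 2) a).2.trans (by norm_num)⟩)
    (fun a => ⟨(h40 _ a).1, (h40 (π.symm 2) a).2.trans (by norm_num)⟩)).seq
    ((isPiece_twoStage (Or.inl rfl) h30).seq (isPiece_twoStage (Or.inr rfl)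
      (e := fun i a => .smul (-1) (witT 40 i a)) fun i a =>
        ⟨(h40 i a).1, by simp [witT, Term.grow]⟩))).imp fun w σ ⟨⟨h1, h2, h3, h4, h5⟩, h6⟩ => ?_
  have e30 : evalAll σ (witT 30) = wit σ 30 := rfl
  have e40 : (evalAll σ fun i a => .smul (-1) (witT 40 i a)) = fun i => -wit σ 40 i := by
    ext i a; simp [evalAll, Term.eval, witT, wit]
  rw [e30, e40]
  simp only [one_mul, neg_one_mul]
  have hG : conjMap 1 1 w.G = w.G := by
    ext y b
    have : actPt 1 1 y = y := by ext; simp [actPt]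
    change 1 * w.G (actPt 1 1 y) b = _
    rw [this, one_mul]
  rw [hG]
  have h6' : ¬ ((∀ i, wit σ 30 i i + 2 ≤ wit σ 40 i i) ∧ ∑ i, wit σ 30 i i + 3 ≤ w.k ∧
    w.k + 3 ≤ ∑ i, wit σ 40 i i) := h6
  by_cases c1 : ∀ i, wit σ 30 i i + 2 ≤ wit σ 40 i i
  · by_cases c2 : ∑ i, wit σ 30 i i + 3 ≤ w.k
    · right; right
      have c3 : ¬ w.k + 3 ≤ ∑ i, wit σ 40 i i := fun c3 => h6' ⟨c1, c2, c3⟩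
      refine ⟨fun i => (h2 i).neg, ?_⟩
      simp only [Pi.neg_apply, Finset.sum_neg_distrib]
      omega
    · right; left
      exact ⟨h1, by omega⟩
  · left
    push Not at c1
    obtain ⟨i, hi⟩ := c1
    have l1 := (h1 i).lt
    have l2 := (h2 i).lt
    have l3 := h3 i
    obtain ⟨π, p2, hπ⟩ := exists_linePair (h1 i) (h2 i).level_eq (h2 i).le (by omega) (by omega)
    exact ⟨π, by rw [p2]; exact hπ⟩

/-! ### The main loop -/

/-- Assign to the variables `b + 3 i + a`. -/
def setWit (b : ℕ) (e : Fin 3 → Fin 3 → Term) : List (ℕ × Term) :=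
  [(b, e 0 0), (b + 1, e 0 1), (b + 2, e 0 2), (b + 3, e 1 0), (b + 4, e 1 1), (b + 5, e 1 2),
    (b + 6, e 2 0), (b + 7, e 2 1), (b + 8, e 2 2)]

theorem runBlock_setWit {b : ℕ} {e : Fin 3 → Fin 3 → Term}
    (h : ∀ i a, (e i a).All fun v => v = b + 3 * i + a ∨ v < b ∨ b + 8 < v) (σ : Store) :
    wit (runBlock (setWit b e) σ) b = evalAll σ e ∧
      ∀ v, v < b ∨ b + 8 < v → runBlock (setWit b e) σ v = σ v := by
  refine ⟨?_, fun v hv => runBlock_of_notMem (by simp [setWit]; omega) σ⟩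
  have key := runBlock_of_mem (l := setWit b e) (by simp [setWit]) (by
    simp only [setWit, List.mem_cons, List.not_mem_nil, or_false]
    rintro a (rfl | rfl | rfl | rfl | rfl | rfl | rfl | rfl | rfl) <;>
    refine (h _ _).mono fun v hv => hv.imp (fun h => by simpa using h) fun h => ?_ <;>
    simp <;> omega) σ
  have hm : ∀ i a : Fin 3, ((b + 3 * i + a, e i a) : ℕ × Term) ∈ setWit b e := by
    intro i a; fin_cases i <;> fin_cases a <;> simp [setWit]
  ext i a
  exact key _ (hm i a)

/-- The coordinate `i` of the lower line in direction `i`. -/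
def lineLow (i : Fin 3) : Term := witT 30 i i

/-- The coordinate `i` of the upper line in direction `i`. -/
def lineHigh (i : Fin 3) : Term := witT 40 i i

/-- The term for `tightLow`. -/
def tightLowT (i : Fin 3) : Term :=
  (Term.add (lineLow i) (.const 1)).max
    (.sub (.sub (.var 3) (.sub (lineHigh (i + 1)) (.const 1))) (.sub (lineHigh (i + 2)) (.const 1)))

/-- The term for `tightHigh`. -/
def tightHighT (i : Fin 3) : Term :=
  (Term.sub (lineHigh i) (.const 1)).min
    (.sub (.sub (.var 3) (.add (lineLow (i + 1)) (.const 1))) (.add (lineLow (i + 2)) (.const 1)))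

/-- The term for `thirdLow`. -/
def thirdLowT (i : Fin 3) : Term :=
  .add (tightLowT i) (.div (.sub (tightHighT i) (tightLowT i)) 2)

/-- The term for `thirdHigh`. -/
def thirdHighT (i : Fin 3) : Term :=
  .sub (tightHighT i) (.div (.sub (tightHighT i) (tightLowT i)) 2)

/-- The terms for `center`. -/
def centerT : Fin 3 → Term :=
  let x := (thirdLowT 0).max (.sub (.sub (.var 3) (thirdHighT 1)) (thirdHighT 2))
  let y := (thirdLowT 1).max (.sub (.sub (.var 3) x) (thirdHighT 2))
  ![x, y, .sub (.sub (.var 3) x) y]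

theorem all_centerT (a : Fin 3) : (centerT a).All IsMain := by
  have h3 : IsMain 3 := by decide
  have hL : ∀ i, (tightLowT i).All IsMain := fun i => by
    simp [tightLowT, lineLow, lineHigh, witT, Term.max, Term.All, isMain_wit, h3]
  have hH : ∀ i, (tightHighT i).All IsMain := fun i => by
    simp [tightHighT, lineLow, lineHigh, witT, Term.min, Term.All, isMain_wit, h3]
  have hl : ∀ i, (thirdLowT i).All IsMain := fun i => by simp [thirdLowT, Term.All, hL, hH]
  have hh : ∀ i, (thirdHighT i).All IsMain := fun i => by simp [thirdHighT, Term.All, hL, hH]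
  fin_cases a <;> simp [centerT, Term.All, Term.max, hl, hh, h3]

theorem eval_centerT {w : Inst} {σ : Store} (hσ : Inv w σ) :
    (fun a => (centerT a).eval σ) =
      center w.k (fun i => wit σ 30 i i) (fun i => wit σ 40 i i) := by
  have hL : ∀ i, (tightLowT i).eval σ = tightLow w.k (fun i => wit σ 30 i i)
      (fun i => wit σ 40 i i) i := fun i => by
    simp only [tightLowT, Term.eval_max, Term.eval, tightLow, hσ.level]; rfl
  have hH : ∀ i, (tightHighT i).eval σ = tightHigh w.k (fun i => wit σ 30 i i)
      (fun i => wit σ 40 i i) i := fun i => by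
    simp only [tightHighT, Term.eval_min, Term.eval, tightHigh, hσ.level]; rfl
  have hl : ∀ i, (thirdLowT i).eval σ = thirdLow w.k (fun i => wit σ 30 i i)
      (fun i => wit σ 40 i i) i := fun i => by
    simp only [thirdLowT, Term.eval, hL, hH]; rfl
  have hh : ∀ i, (thirdHighT i).eval σ = thirdHigh w.k (fun i => wit σ 30 i i)
      (fun i => wit σ 40 i i) i := fun i => by
    simp only [thirdHighT, Term.eval, hL, hH]; rfl
  ext a
  fin_cases a <;> simp [centerT, center, Term.eval, hl, hh, hσ.level]

/-- Whether the point just probed is a lower witness in direction `i`. -/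
def isLowerT (i : Fin 3) : Term :=
  (Term.leT (.add (.var (12 + i)) (.const 1)) (.var (15 + i))).and
    ((Term.leT (.var (15 + (i + 1 : Fin 3))) (.var (12 + (i + 1 : Fin 3)))).and
      (Term.leT (.var (15 + (i + 2 : Fin 3))) (.var (12 + (i + 2 : Fin 3)))))

/-- Whether the point just probed is an upper witness in direction `i`. -/
def isUpperT (i : Fin 3) : Term :=
  (Term.leT (.add (.var (15 + i)) (.const 1)) (.var (12 + i))).and
    ((Term.leT (.var (12 + (i + 1 : Fin 3))) (.var (15 + (i + 1 : Fin 3)))).and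
      (Term.leT (.var (12 + (i + 2 : Fin 3))) (.var (15 + (i + 2 : Fin 3)))))

theorem holds_isLowerT {w : Inst} {σ : Store} (hR : vec σ 15 = w.G (vec σ 12))
    (hk : ∑ a, vec σ 12 a = w.k) (i : Fin 3) :
    (isLowerT i).Holds σ ↔ IsLower w.G w.k i (vec σ 12) := by
  obtain ⟨n1, n2, n3, n4⟩ := fin_three_ne i
  simp only [isLowerT, Term.holds_and, Term.holds_leT, Term.eval, ← vec_apply, hR]
  refine ⟨fun ⟨h1, h2, h3⟩ => ⟨hk, by omega, (forall_fin_three i).2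
    ⟨fun h => absurd rfl h, fun _ => h2, fun _ => h3⟩⟩,
    fun h => ⟨by have := h.lt; omega, h.le _ n1, h.le _ n2⟩⟩

theorem holds_isUpperT {w : Inst} {σ : Store} (hR : vec σ 15 = w.G (vec σ 12))
    (hk : ∑ a, vec σ 12 a = w.k) (i : Fin 3) :
    (isUpperT i).Holds σ ↔ IsUpper w.G w.k i (vec σ 12) := by
  obtain ⟨n1, n2, n3, n4⟩ := fin_three_ne i
  simp only [isUpperT, Term.holds_and, Term.holds_leT, Term.eval, ← vec_apply, hR]
  refine ⟨fun ⟨h1, h2, h3⟩ => ⟨hk, by omega, (forall_fin_three i).2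
    ⟨fun h => absurd rfl h, fun _ => h2, fun _ => h3⟩⟩,
    fun h => ⟨by have := h.lt; omega, h.le _ n1, h.le _ n2⟩⟩

/-- Replace the witness in direction `i` by the point just probed if the condition `c i` holds. -/
def replace (b : ℕ) (c : Fin 3 → Term) : List (ℕ × Term) :=
  setWit b fun i a => Term.sel (c i) (.var (12 + a)) (witT b i a)

theorem exec_replace {b : ℕ} (hb : b = 30 ∨ b = 40) (c : Fin 3 → Term)
    (hc : ∀ i, (c i).All fun v => v < 30) : ∃ d : ℕ, ∀ w : Inst, d * w.N ≤ w.W → ∀ σ, Inv w σ →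
      (∀ a, |vec σ 12 a| ≤ (20 * w.N : ℕ)) →
      ∃ τ, Exec w.F w.W (block (replace b c)) σ τ d ∧ Inv w τ ∧
        (∀ i, ((c i).Holds σ → wit τ b i = vec σ 12) ∧ (¬ (c i).Holds σ → wit τ b i = wit σ b i)) ∧
        ∀ v, v < b ∨ b + 8 < v → τ v = σ v := by
  obtain ⟨d, hd⟩ := exec_block (replace b c)
  refine ⟨10000 * d, fun w hW σ hσ hm => ?_⟩
  have hN := w.three_le_N
  have h1 := hd w.F w.W (10000 * w.N) σ (by omega) hσ.bound (by nlinarith)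
  obtain ⟨e1, e2⟩ := runBlock_setWit (b := b)
    (e := fun i a => Term.sel (c i) (.var (12 + a)) (witT b i a)) (fun i a => by
      simp only [Term.sel, Term.All, witT, true_and]
      exact ⟨(hc i).mono fun v hv => by omega, by omega, Or.inl trivial⟩) σ
  refine ⟨_, h1.mono (by omega), ?_, fun i => ⟨fun h => ?_, fun h => ?_⟩, e2⟩
  · have e3 : ∀ i a, wit (runBlock (replace b c) σ) b i a =
        if (c i).Holds σ then vec σ 12 a else wit σ b i a := fun i a =>
      (congrFun (congrFun e1 i) a).trans (Term.eval_sel _ _ _ _)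
    have hb' : ∀ v, b ≤ v → v ≤ b + 8 → |runBlock (replace b c) σ v| ≤ (20 * w.N : ℕ) := by
      intro v hv1 hv2
      obtain ⟨i, a, rfl⟩ : ∃ i a : Fin 3, v = b + 3 * i + a :=
        ⟨⟨(v - b) / 3, by omega⟩, ⟨(v - b) % 3, by omega⟩, by simp; omega⟩
      change |wit (runBlock (replace b c) σ) b i a| ≤ _
      rw [e3]
      split_ifs
      · exact hm a
      · refine hσ.main _ ?_
        rcases hb with rfl | rfl
        · exact (isMain_wit i a).1
        · exact (isMain_wit i a).2
    have hv' : ∀ b' : ℕ, b' = 4 ∨ b' = 7 ∨ b' = 24 →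
        vec (runBlock (replace b c) σ) b' = vec σ b' := by
      intro b' h; ext a; exact e2 _ (by omega)
    refine ⟨fun v => ?_, fun v hv => ?_, ?_, ?_, ?_, ?_⟩
    · by_cases h : v < b ∨ b + 8 < v
      · exact (congrArg abs (e2 v h)).trans_le (hσ.bound v)
      · refine (hb' v (by omega) (by omega)).trans ?_
        push_cast; omega
    · by_cases h : v < b ∨ b + 8 < v
      · exact (congrArg abs (e2 v h)).trans_le (hσ.main v hv)
      · exact hb' v (by omega) (by omega)
    · exact (e2 3 (by omega)).trans hσ.level
    · rw [hv' 4 (by simp), hσ.lo]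
    · rw [hv' 7 (by simp), hσ.hi]
    · rw [hv' 24 (by simp)]
      have : runBlock (replace b c) σ 11 = σ 11 := e2 11 (by omega)
      rw [this]; exact hσ.found
  · ext a; exact (congrFun (congrFun e1 i) a).trans ((Term.eval_sel _ _ _ _).trans (if_pos h))
  · ext a; exact (congrFun (congrFun e1 i) a).trans ((Term.eval_sel _ _ _ _).trans (if_neg h))

/-- Query the center of the region, and cut the region along a line through it. -/
def mainBody : Prog :=
  .seq (.seq (probe centerT) (block record))
    (.seq (block (replace 30 isLowerT)) (block (replace 40 isUpperT)))

/-- No solution has been found and the region between the lines is not empty. -/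
def mainGuard : Term :=
  (Term.leT (.var 11) (.const 0)).and
    (((Term.leT (.add (lineLow 0) (.const 2)) (lineHigh 0)).and
      ((Term.leT (.add (lineLow 1) (.const 2)) (lineHigh 1)).and
        (Term.leT (.add (lineLow 2) (.const 2)) (lineHigh 2)))).and
      ((Term.leT (.add (.add (.add (lineLow 0) (lineLow 1)) (lineLow 2)) (.const 3)) (.var 3)).and
        (Term.leT (.add (.var 3) (.const 3))
          (.add (.add (lineHigh 0) (lineHigh 1)) (lineHigh 2)))))

theorem holds_mainGuard {w : Inst} {σ : Store} (hσ : Inv w σ) : mainGuard.Holds σ ↔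
    σ 11 ≤ 0 ∧ HasInterior w.k (fun i => wit σ 30 i i) (fun i => wit σ 40 i i) := by
  have e1 : ∀ i, (lineLow i).eval σ = wit σ 30 i i := fun i => rfl
  have e2 : ∀ i, (lineHigh i).eval σ = wit σ 40 i i := fun i => rfl
  simp only [mainGuard, Term.holds_and, Term.holds_leT, Term.eval, e1, e2, hσ.level, HasInterior,
    Fin.sum_univ_three, Fin.forall_fin_succ, Fin.forall_fin_zero]
  simp

/-- The product of the numbers of values of the coordinates in the region. -/
def potential (w : Inst) (σ : Store) : ℤ :=
  ∏ a, width w.k (fun i => wit σ 30 i i) (fun i => wit σ 40 i i) a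

theorem isLowerT_all (i : Fin 3) : (isLowerT i).All fun v => v < 30 := by
  simp only [isLowerT, Term.and, Term.leT, Term.All, true_and, and_true]; omega

theorem isUpperT_all (i : Fin 3) : (isUpperT i).All fun v => v < 30 := by
  simp only [isUpperT, Term.and, Term.leT, Term.All, true_and, and_true]; omega

/-- One round of the main loop finds a solution, empties the region, or shrinks the potential by a
factor `2 / 3`. -/
theorem exec_mainBody : ∃ c : ℕ, ∀ w : Inst, c * w.N ≤ w.W → ∀ σ, Inv w σ →
    Bounded w (wit σ 30) (wit σ 40) →
    HasInterior w.k (fun i => wit σ 30 i i) (fun i => wit σ 40 i i) →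
    ∃ τ, Exec w.F w.W mainBody σ τ c ∧ Inv w τ ∧ Bounded w (wit τ 30) (wit τ 40) ∧
      (∀ v, v < 11 → τ v = σ v) ∧
      (τ 11 ≤ 0 → HasInterior w.k (fun i => wit τ 30 i i) (fun i => wit τ 40 i i) →
        3 * potential w τ ≤ 2 * potential w σ) := by
  obtain ⟨c1, h1⟩ := exec_probe centerT fun a => (all_centerT a).mono fun v hv => by
    simp only [IsMain] at hv; omega
  obtain ⟨c2, h2⟩ := exec_record
  obtain ⟨c3, h3⟩ := exec_replace (Or.inl rfl) isLowerT isLowerT_all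
  obtain ⟨c4, h4⟩ := exec_replace (Or.inr rfl) isUpperT isUpperT_all
  refine ⟨c1 + c2 + c3 + c4, fun w hW σ hσ hB hI => ?_⟩
  have hN := w.three_le_N
  set l : Fin 3 → ℤ := fun i => wit σ 30 i i with hl
  set h : Fin 3 → ℤ := fun i => wit σ 40 i i with hh
  set m := center w.k l h with hm
  have hmlt : ∀ a, l a < m a ∧ m a < h a := fun a => hI.lt_center a
  have hev : (fun a => (centerT a).eval σ) = m := eval_centerT hσ
  have hmb : ∀ a, |m a| ≤ (20 * w.N : ℕ) := by
    intro a
    have b1 : |l a| ≤ (20 * w.N : ℕ) := hσ.main _ (isMain_wit a a).1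
    have b2 : |h a| ≤ (20 * w.N : ℕ) := hσ.main _ (isMain_wit a a).2
    have := hmlt a
    rw [abs_le] at *; omega
  obtain ⟨σ1, r1, i1, p1, q1, f1⟩ := h1 w (by nlinarith) σ hσ (fun a => by
    rw [congrFun hev a]; refine (hmb a).trans ?_; push_cast; omega)
  rw [hev] at p1 q1
  obtain ⟨σ2, r2, i2, -, s2, f2⟩ := h2 w (by nlinarith) σ1 i1 (by rw [p1, q1])
  have p2 : vec σ2 12 = m := by rw [← p1]; ext a; exact f2 _ (by omega)
  have q2 : vec σ2 15 = w.G m := by rw [← q1]; ext a; exact f2 _ (by omega)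
  have hk : ∑ a, m a = w.k := sum_center
  obtain ⟨σ3, r3, i3, s3, f3⟩ := h3 w (by nlinarith) σ2 i2 (by rw [p2]; exact hmb)
  have p3 : vec σ3 12 = m := by rw [← p2]; ext a; exact f3 _ (by omega)
  have q3 : vec σ3 15 = w.G m := by rw [← q2]; ext a; exact f3 _ (by omega)
  obtain ⟨τ, r4, i4, s4, f4⟩ := h4 w (by nlinarith) σ3 i3 (by rw [p3]; exact hmb)
  have t30 : ∀ i, (IsLower w.G w.k i m → wit τ 30 i = m) ∧
      (¬ IsLower w.G w.k i m → wit τ 30 i = wit σ 30 i) := by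
    intro i
    have e : wit τ 30 i = wit σ3 30 i := by ext a; exact f4 _ (by omega)
    have e' : wit σ2 30 i = wit σ 30 i := by
      ext a; exact (f2 _ (by omega)).trans (f1 _ (by omega))
    have := s3 i
    rw [holds_isLowerT (by rw [p2, q2]) (by rw [p2, hk]), p2, e'] at this
    rwa [e]
  have t40 : ∀ i, (IsUpper w.G w.k i m → wit τ 40 i = m) ∧
      (¬ IsUpper w.G w.k i m → wit τ 40 i = wit σ 40 i) := by
    intro i
    have e' : wit σ3 40 i = wit σ 40 i := by
      ext a; exact (f3 _ (by omega)).trans ((f2 _ (by omega)).trans (f1 _ (by omega)))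
    have := s4 i
    rwa [holds_isUpperT (by rw [p3, q3]) (by rw [p3, hk]), p3, e'] at this
  have l30 : ∀ i, (IsLower w.G w.k i m ∧ wit τ 30 i i = m i) ∨
      (¬ IsLower w.G w.k i m ∧ wit τ 30 i i = l i) := fun i => by
    by_cases hc : IsLower w.G w.k i m
    · left; exact ⟨hc, by rw [(t30 i).1 hc]⟩
    · right; exact ⟨hc, by rw [(t30 i).2 hc]⟩
  have h40 : ∀ i, (IsUpper w.G w.k i m ∧ wit τ 40 i i = m i) ∨
      (¬ IsUpper w.G w.k i m ∧ wit τ 40 i i = h i) := fun i => by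
    by_cases hc : IsUpper w.G w.k i m
    · left; exact ⟨hc, by rw [(t40 i).1 hc]⟩
    · right; exact ⟨hc, by rw [(t40 i).2 hc]⟩
  -- At most one lower line and at most one upper line moves, and they are in different directions.
  have x1 : ∀ i j, IsLower w.G w.k i m → IsLower w.G w.k j m → i = j := fun i j hi hj => by
    by_contra hij
    have := hi.lt; have := hj.le i hij; omega
  have x2 : ∀ i j, IsUpper w.G w.k i m → IsUpper w.G w.k j m → i = j := fun i j hi hj => by
    by_contra hij
    have := hi.lt; have := hj.le i hij; omega
  have x3 : ∀ i, IsLower w.G w.k i m → ¬ IsUpper w.G w.k i m := fun i hi hj => by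
    have := hi.lt; have := hj.lt; omega
  refine ⟨τ, ((r1.seq r2).seq (r3.seq r4)).mono (by omega), i4,
    ⟨fun i => ?_, fun i => ?_, fun i => ?_, ?_, ?_⟩, fun v hv => ?_, fun h11 hI' => ?_⟩
  · by_cases hc : IsLower w.G w.k i m
    · rw [(t30 i).1 hc]; exact hc
    · rw [(t30 i).2 hc]; exact hB.lower i
  · by_cases hc : IsUpper w.G w.k i m
    · rw [(t40 i).1 hc]; exact hc
    · rw [(t40 i).2 hc]; exact hB.upper i
  · have := hmlt i
    rcases l30 i with ⟨c, e⟩ | ⟨c, e⟩ <;> rcases h40 i with ⟨c', e'⟩ | ⟨c', e'⟩ <;> rw [e, e']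
    · exact absurd c' (x3 i c)
    · omega
    · omega
    · omega
  · have hI2 : ∑ i, l i + 3 ≤ w.k := hI.2.1
    by_cases hc : ∃ i, IsLower w.G w.k i m
    · obtain ⟨i, hi⟩ := hc
      obtain ⟨n1, n2, n3, n4⟩ := fin_three_ne i
      have e0 := l30 i; have e1 := l30 (i + 1); have e2 := l30 (i + 2)
      have y1 : ¬ IsLower w.G w.k (i + 1) m := fun hh => n1 (x1 _ _ hh hi)
      have y2 : ¬ IsLower w.G w.k (i + 2) m := fun hh => n2 (x1 _ _ hh hi)
      have z1 := (hmlt (i + 1)).1; have z2 := (hmlt (i + 2)).1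
      rw [sum_fin_three i] at hk ⊢
      simp only [hi, y1, y2, true_and, false_and, not_true, not_false_iff, or_false,
        false_or] at e0 e1 e2
      omega
    · push Not at hc
      have : ∀ i, wit τ 30 i i = l i := fun i => by rw [(t30 i).2 (hc i)]
      simp only [this]
      omega
  · have hI3 : w.k + 3 ≤ ∑ i, h i := hI.2.2
    by_cases hc : ∃ i, IsUpper w.G w.k i m
    · obtain ⟨i, hi⟩ := hc
      obtain ⟨n1, n2, n3, n4⟩ := fin_three_ne i
      have e0 := h40 i; have e1 := h40 (i + 1); have e2 := h40 (i + 2)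
      have y1 : ¬ IsUpper w.G w.k (i + 1) m := fun hh => n1 (x2 _ _ hh hi)
      have y2 : ¬ IsUpper w.G w.k (i + 2) m := fun hh => n2 (x2 _ _ hh hi)
      have z1 := (hmlt (i + 1)).2; have z2 := (hmlt (i + 2)).2
      rw [sum_fin_three i] at hk ⊢
      simp only [hi, y1, y2, true_and, false_and, not_true, not_false_iff, or_false,
        false_or] at e0 e1 e2
      omega
    · push Not at hc
      have : ∀ i, wit τ 40 i i = h i := fun i => by rw [(t40 i).2 (hc i)]
      simp only [this]
      omega
  · rw [f4 v (by omega), f3 v (by omega), f2 v (by omega), f1 v (by omega)]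
  · have hns : ¬ IsSol w.G w.k m := fun hs => by
      have : σ2 11 = 1 := s2 (by rw [p1]; exact hs)
      rw [f4 11 (by omega), f3 11 (by omega), this] at h11
      omega
    have hll : l ≤ fun i => wit τ 30 i i := fun i => by
      rcases l30 i with ⟨-, e⟩ | ⟨-, e⟩
      · simp only [e]; exact (hmlt i).1.le
      · simp only [e]; exact le_rfl
    have hhh : (fun i => wit τ 40 i i) ≤ h := fun i => by
      rcases h40 i with ⟨-, e⟩ | ⟨-, e⟩
      · simp only [e]; exact (hmlt i).2.le
      · simp only [e]; exact le_rfl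
    rcases isSol_or_isLower_or_isUpper (G := w.G) hk with hs | ⟨i, hs | hs⟩
    · exact absurd hs hns
    · exact hI.three_mul_prod_width_le hI' hll hhh (i := i)
        (Or.inl (congrFun ((t30 i).1 hs) i))
    · exact hI.three_mul_prod_width_le hI' hll hhh (i := i)
        (Or.inr (congrFun ((t40 i).1 hs) i))

/-- The main loop takes time `O(log N)`, and ends when a solution has been found or the region
between the lines has no lattice point. -/
theorem exec_mainLoop : ∃ c : ℕ, ∀ w : Inst, c * w.N ≤ w.W → ∀ σ, Inv w σ →
    Bounded w (wit σ 30) (wit σ 40) →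
    ∃ τ, Exec w.F w.W (whileT mainGuard mainBody) σ τ (c * (Nat.log 2 w.N + 1)) ∧ Inv w τ ∧
      Bounded w (wit τ 30) (wit τ 40) ∧ (∀ v, v < 11 → τ v = σ v) ∧
      (τ 11 = 1 ∨ ¬ HasInterior w.k (fun i => wit τ 30 i i) (fun i => wit τ 40 i i)) := by
  obtain ⟨d, hd⟩ := exec_mainBody
  obtain ⟨c, hc⟩ := exec_whileT mainGuard mainBody
  refine ⟨43 * (10000 * c + d), fun w hW σ hσ hB => ?_⟩
  have hN := w.three_le_N
  -- Each round multiplies the potential by at most `2 / 3`. It is below `2 ^ (3 * (log N + 7))` in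
  -- the beginning, so `(3 / 2) ^ 2 > 2` shows that `6 * (log N + 7)` rounds suffice.
  obtain ⟨τ, T', t1, ⟨i1, i2, i3, i4⟩, t3⟩ := hc w.F w.W (10000 * w.N) d
    (fun T ρ => Inv w ρ ∧ Bounded w (wit ρ 30) (wit ρ 40) ∧ (∀ v, v < 11 → ρ v = σ v) ∧
      (ρ 11 ≤ 0 → HasInterior w.k (fun i => wit ρ 30 i i) (fun i => wit ρ 40 i i) →
        potential w ρ * 2 ^ T < 3 ^ T))
    (by omega) (by nlinarith) (by
      rintro T ρ ⟨i1, i2, i3, i4⟩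
      refine ⟨i1.bound, fun hg => ?_⟩
      obtain ⟨g1, g2⟩ := (holds_mainGuard i1).1 hg
      have hp := i4 g1 g2
      have hpos : 1 ≤ potential w ρ := Order.one_le_iff_pos.2
        (Finset.prod_pos fun a _ => zero_lt_one.trans_le (g2.width_pos a))
      obtain ⟨T, rfl⟩ : ∃ T', T = T' + 1 := by
        cases T with
        | zero => simp at hp; omega
        | succ T => exact ⟨T, rfl⟩
      obtain ⟨τ, t1, t2, t3, t4, t5⟩ := hd w (by nlinarith) ρ i1 i2 g2
      refine ⟨T, τ, rfl, t1, t2, t3, fun v hv => by rw [t4 v hv, i3 v hv], fun h11 hI => ?_⟩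
      have := t5 h11 hI
      rw [pow_succ, pow_succ] at hp
      have h2 : (0 : ℤ) < 2 ^ T := by positivity
      nlinarith)
    (6 * (Nat.log 2 w.N + 7)) σ ⟨hσ, hB, fun _ _ => rfl, fun _ hI => by
      have hw : ∀ a, width w.k (fun i => wit σ 30 i i) (fun i => wit σ 40 i i) a ≤ 64 * w.N := by
        intro a
        have b1 : |wit σ 30 a a| ≤ (20 * w.N : ℕ) := hσ.main _ (isMain_wit a a).1
        have b2 : |wit σ 40 a a| ≤ (20 * w.N : ℕ) := hσ.main _ (isMain_wit a a).2
        simp only [width, tightHigh, tightLow]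
        rw [abs_le] at b1 b2
        push_cast at b1 b2
        omega
      have hp : potential w σ ≤ (64 * w.N) ^ 3 := by
        refine (Finset.prod_le_prod (fun a _ => zero_le_one.trans (hI.width_pos a))
          fun a _ => hw a).trans ?_
        simp
      set L := Nat.log 2 w.N
      have hL : w.N < 2 ^ (L + 1) := Nat.lt_pow_succ_log_self (by omega) w.N
      have hL' : ((64 * w.N : ℕ) : ℤ) < 2 ^ (L + 7) := by
        have e : 2 ^ (L + 7) = 64 * 2 ^ (L + 1) := by rw [pow_add, pow_add]; ring
        have : 64 * w.N < 2 ^ (L + 7) := by omega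
        exact_mod_cast this
      have hp' : potential w σ < (2 ^ (L + 7)) ^ 3 := by
        refine hp.trans_lt (pow_lt_pow_left₀ ?_ (by positivity) (by norm_num))
        push_cast at hL'; exact hL'
      calc potential w σ * 2 ^ (6 * (L + 7)) < (2 ^ (L + 7)) ^ 3 * 2 ^ (6 * (L + 7)) := by
            gcongr
        _ = 8 ^ (3 * (L + 7)) := by
            rw [← pow_mul, ← pow_add, show (8 : ℤ) = 2 ^ 3 by norm_num, ← pow_mul]; ring_nf
        _ ≤ 9 ^ (3 * (L + 7)) := by gcongr; norm_num
        _ = 3 ^ (6 * (L + 7)) := by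
            rw [show (9 : ℤ) = 3 ^ 2 by norm_num, ← pow_mul]; ring_nf⟩
  refine ⟨τ, t1.mono ?_, i1, i2, i3, ?_⟩
  · nlinarith [Nat.zero_le (Nat.log 2 w.N), Nat.zero_le (c * Nat.log 2 w.N),
      Nat.zero_le (d * Nat.log 2 w.N), Nat.zero_le c]
  · rw [holds_mainGuard i1] at t3
    rcases i1.found with h | h
    · right; exact fun hI => t3 ⟨h.le, hI⟩
    · exact Or.inl h.1

/-! ### Solving the level problem -/

/-- The coordinate `a` of the least point of the box. -/
def boxLow (a : Fin 3) : Term := .var (4 + a)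

/-- The coordinate `a` of the greatest point of the box. -/
def boxHigh (a : Fin 3) : Term := .var (7 + a)

/-- The number of levels that meet the box. -/
def boxLevels : Term :=
  .add (.sub (.add (.add (boxHigh 0) (boxHigh 1)) (boxHigh 2))
    (.add (.add (boxLow 0) (boxLow 1)) (boxLow 2))) (.const 1)

/-- The first lower witnesses: all coordinates but one are so large that the remaining one is below
the box. -/
def startLow (i a : Fin 3) : Term :=
  if a = i then .sub (.sub (.var 3) (.add (boxHigh (i + 1)) boxLevels))
    (.add (boxHigh (i + 2)) boxLevels)
  else .add (boxHigh a) boxLevels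

/-- The first upper witnesses: all coordinates but one are so small that the remaining one is above
the box. -/
def startHigh (i a : Fin 3) : Term :=
  if a = i then .sub (.sub (.var 3) (.sub (boxLow (i + 1)) boxLevels))
    (.sub (boxLow (i + 2)) boxLevels)
  else .sub (boxLow a) boxLevels

/-- The store holds the level and the box of the instance. -/
structure Start (w : Inst) (σ : Store) : Prop where
  bound : ∀ v, |σ v| ≤ (10000 * w.N : ℕ)
  main : ∀ v, IsMain v → |σ v| ≤ (20 * w.N : ℕ)
  level : σ 3 = w.k
  lo : vec σ 4 = w.lo
  hi : vec σ 7 = w.hi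

/-- Set up the first witnesses. -/
def startProg : Prog :=
  .seq (block [(11, .const 0)]) (.seq (block (setWit 30 startLow)) (block (setWit 40 startHigh)))

theorem all_start (i a : Fin 3) :
    (startLow i a).All (· < 10) ∧ (startHigh i a).All (· < 10) := by
  have hl : ∀ a, (boxLow a).All (· < 10) := fun a => by simp only [boxLow, Term.All]; omega
  have hh : ∀ a, (boxHigh a).All (· < 10) := fun a => by simp only [boxHigh, Term.All]; omega
  have hS : boxLevels.All (· < 10) := by simp [boxLevels, Term.All, hl, hh]
  constructor
  · simp only [startLow]; split_ifs <;> simp [Term.All, hh, hS]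
  · simp only [startHigh]; split_ifs <;> simp [Term.All, hl, hS]

theorem exec_startProg : ∃ c : ℕ, ∀ w : Inst, c * w.N ≤ w.W → ∀ σ, Start w σ →
    ∃ τ, Exec w.F w.W startProg σ τ c ∧ Inv w τ ∧ Bounded w (wit τ 30) (wit τ 40) ∧
      ∀ v, v < 10 → τ v = σ v := by
  obtain ⟨c1, h1⟩ := exec_block [(11, .const 0)]
  obtain ⟨c2, h2⟩ := exec_block (setWit 30 startLow)
  obtain ⟨c3, h3⟩ := exec_block (setWit 40 startHigh)
  refine ⟨10000 * (c1 + c2 + c3), fun w hW σ hσ => ?_⟩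
  have hN := w.three_le_N
  set S : ℤ := ∑ i, w.hi i - ∑ i, w.lo i + 1 with hS
  have hlo := w.one_le; have hhi := w.hi_le_N; have hlh : ∀ a, w.lo a ≤ w.hi a := w.lo_le_hi
  have hk := w.k_bounds; have hk1 := w.le_k; have hk2 := w.k_le
  have hs1 := w.three_le_sum_lo; have hs2 := w.sum_hi_le
  -- The terms have the same values on every store with the same level and box.
  have eL : ∀ ρ : Store, (∀ v, v < 10 → ρ v = σ v) → ∀ a, (boxLow a).eval ρ = w.lo a :=
    fun ρ hρ a => (hρ _ (by omega)).trans (congrFun hσ.lo a)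
  have eH : ∀ ρ : Store, (∀ v, v < 10 → ρ v = σ v) → ∀ a, (boxHigh a).eval ρ = w.hi a :=
    fun ρ hρ a => (hρ _ (by omega)).trans (congrFun hσ.hi a)
  have eS : ∀ ρ : Store, (∀ v, v < 10 → ρ v = σ v) → boxLevels.eval ρ = S := fun ρ hρ => by
    simp only [boxLevels, Term.eval, eL ρ hρ, eH ρ hρ, hS, Fin.sum_univ_three]
  have eP : ∀ ρ : Store, (∀ v, v < 10 → ρ v = σ v) → ∀ i a, (startLow i a).eval ρ =
      if a = i then w.k - (w.hi (i + 1) + S) - (w.hi (i + 2) + S) else w.hi a + S := by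
    intro ρ hρ i a
    simp only [startLow]
    split_ifs <;> simp only [Term.eval, eH ρ hρ, eS ρ hρ, hρ 3 (by omega), hσ.level]
  have eQ : ∀ ρ : Store, (∀ v, v < 10 → ρ v = σ v) → ∀ i a, (startHigh i a).eval ρ =
      if a = i then w.k - (w.lo (i + 1) - S) - (w.lo (i + 2) - S) else w.lo a - S := by
    intro ρ hρ i a
    simp only [startHigh]
    split_ifs <;> simp only [Term.eval, eL ρ hρ, eS ρ hρ, hρ 3 (by omega), hσ.level]
  have bP : ∀ ρ : Store, (∀ v, v < 10 → ρ v = σ v) → ∀ i a,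
      |(startLow i a).eval ρ| ≤ (20 * w.N : ℕ) := by
    intro ρ hρ i a
    have := hlo a; have := hhi a; have := hlh a
    have := hlo (i + 1); have := hhi (i + 1); have := hlh (i + 1)
    have := hlo (i + 2); have := hhi (i + 2); have := hlh (i + 2)
    rw [eP ρ hρ, abs_le]; push_cast; split_ifs <;> omega
  have bQ : ∀ ρ : Store, (∀ v, v < 10 → ρ v = σ v) → ∀ i a,
      |(startHigh i a).eval ρ| ≤ (20 * w.N : ℕ) := by
    intro ρ hρ i a
    have := hlo a; have := hhi a; have := hlh a
    have := hlo (i + 1); have := hhi (i + 1); have := hlh (i + 1)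
    have := hlo (i + 2); have := hhi (i + 2); have := hlh (i + 2)
    rw [eQ ρ hρ, abs_le]; push_cast; split_ifs <;> omega
  have r1 := h1 w.F w.W (10000 * w.N) σ (by omega) hσ.bound (by nlinarith)
  set σ1 := runBlock [(11, .const 0)] σ with hσ1
  have f1 : ∀ v, v ≠ 11 → σ1 v = σ v := fun v hv => by
    simp [hσ1, runBlock, hv]
  have g1 : σ1 11 = 0 := by simp [hσ1, runBlock, Term.eval]
  have b1 : ∀ v, |σ1 v| ≤ (10000 * w.N : ℕ) := fun v => by
    by_cases hv : v = 11
    · subst hv; rw [g1]; simp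
    · rw [f1 v hv]; exact hσ.bound v
  have r2 := h2 w.F w.W (10000 * w.N) σ1 (by omega) b1 (by nlinarith)
  obtain ⟨e2, f2⟩ := runBlock_setWit (b := 30) (e := startLow)
    (fun i a => (all_start i a).1.mono fun v hv => by omega) σ1
  set σ2 := runBlock (setWit 30 startLow) σ1
  have hρ1 : ∀ v, v < 10 → σ1 v = σ v := fun v hv => f1 v (by omega)
  have m2 : ∀ v, 30 ≤ v ∧ v ≤ 38 → |σ2 v| ≤ (20 * w.N : ℕ) := fun v hv => by
    obtain ⟨i, a, rfl⟩ : ∃ i a : Fin 3, v = 30 + 3 * i + a :=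
      ⟨⟨(v - 30) / 3, by omega⟩, ⟨(v - 30) % 3, by omega⟩, by simp; omega⟩
    exact (congrArg abs (congrFun (congrFun e2 i) a)).trans_le (bP σ1 hρ1 i a)
  have b2 : ∀ v, |σ2 v| ≤ (10000 * w.N : ℕ) := fun v => by
    by_cases hv : 30 ≤ v ∧ v ≤ 38
    · refine (m2 v hv).trans ?_; push_cast; omega
    · rw [f2 v (by omega)]; exact b1 v
  have r3 := h3 w.F w.W (10000 * w.N) σ2 (by omega) b2 (by nlinarith)
  obtain ⟨e3, f3⟩ := runBlock_setWit (b := 40) (e := startHigh)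
    (fun i a => (all_start i a).2.mono fun v hv => by omega) σ2
  set σ3 := runBlock (setWit 40 startHigh) σ2
  have hρ2 : ∀ v, v < 10 → σ2 v = σ v := fun v hv => by rw [f2 v (by omega), hρ1 v hv]
  have hρ3 : ∀ v, v < 10 → σ3 v = σ v := fun v hv => by rw [f3 v (by omega), hρ2 v hv]
  have m3 : ∀ v, 40 ≤ v ∧ v ≤ 48 → |σ3 v| ≤ (20 * w.N : ℕ) := fun v hv => by
    obtain ⟨i, a, rfl⟩ : ∃ i a : Fin 3, v = 40 + 3 * i + a :=
      ⟨⟨(v - 40) / 3, by omega⟩, ⟨(v - 40) % 3, by omega⟩, by simp; omega⟩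
    exact (congrArg abs (congrFun (congrFun e3 i) a)).trans_le (bQ σ2 hρ2 i a)
  have hI : Inv w σ3 := by
    refine ⟨fun v => ?_, fun v hv => ?_, (hρ3 3 (by omega)).trans hσ.level, ?_, ?_, Or.inl ?_⟩
    · by_cases hv : 40 ≤ v ∧ v ≤ 48
      · refine (m3 v hv).trans ?_; push_cast; omega
      · rw [f3 v (by omega)]; exact b2 v
    · by_cases h4 : 40 ≤ v ∧ v ≤ 48
      · exact m3 v h4
      · rw [f3 v (by omega)]
        by_cases h3 : 30 ≤ v ∧ v ≤ 38
        · exact m2 v h3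
        · rw [f2 v (by omega), f1 v (by simp only [IsMain] at hv; omega)]
          exact hσ.main v hv
    · rw [← hσ.lo]; ext a; exact hρ3 _ (by omega)
    · rw [← hσ.hi]; ext a; exact hρ3 _ (by omega)
    · rw [f3 11 (by omega), f2 11 (by omega), g1]
  have p30 : ∀ i a, wit σ3 30 i a =
      if a = i then w.k - (w.hi (i + 1) + S) - (w.hi (i + 2) + S) else w.hi a + S := by
    intro i a
    rw [← eP σ1 hρ1]
    exact (f3 _ (by omega)).trans (congrFun (congrFun e2 i) a)
  have p40 : ∀ i a, wit σ3 40 i a =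
      if a = i then w.k - (w.lo (i + 1) - S) - (w.lo (i + 2) - S) else w.lo a - S := by
    intro i a
    rw [← eQ σ2 hρ2]
    exact congrFun (congrFun e3 i) a
  have t : ∀ i, w.lo i + w.lo (i + 1) + w.lo (i + 2) = ∑ a, w.lo a ∧
      w.hi i + w.hi (i + 1) + w.hi (i + 2) = ∑ a, w.hi a := fun i =>
    ⟨(sum_fin_three i _).symm, (sum_fin_three i _).symm⟩
  refine ⟨σ3, (r1.seq (r2.seq r3)).mono (by omega), hI, ⟨fun i => ⟨?_, ?_, fun j hj => ?_⟩,
    fun i => ⟨?_, ?_, fun j hj => ?_⟩, fun i => ?_, ?_, ?_⟩, hρ3⟩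
  · obtain ⟨n1, n2, -, -⟩ := fin_three_ne i
    rw [sum_fin_three i, p30, p30, p30, if_pos rfl, if_neg n1, if_neg n2]; ring
  · have : w.lo i ≤ w.G (wit σ3 30 i) i := w.lo_le_G _ i
    rw [p30, if_pos rfl]
    have := t i; have := hlh (i + 1); have := hlh (i + 2); have := hlh i; omega
  · have : w.G (wit σ3 30 i) j ≤ w.hi j := w.G_le_hi _ j
    rw [p30, if_neg hj]; omega
  · obtain ⟨n1, n2, -, -⟩ := fin_three_ne i
    rw [sum_fin_three i, p40, p40, p40, if_pos rfl, if_neg n1, if_neg n2]; ring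
  · have : w.G (wit σ3 40 i) i ≤ w.hi i := w.G_le_hi _ i
    rw [p40, if_pos rfl]
    have := t i; have := hlh (i + 1); have := hlh (i + 2); have := hlh i; omega
  · have : w.lo j ≤ w.G (wit σ3 40 i) j := w.lo_le_G _ j
    rw [p40, if_neg hj]; omega
  · rw [p30, p40, if_pos rfl, if_pos rfl]
    have := t i; have := hlh (i + 1); have := hlh (i + 2); have := hlh i; omega
  · simp only [p30, if_true]
    have := t 0; have := t 1; have := t 2; have := Fin.sum_univ_three w.hi
    rw [Fin.sum_univ_three]; omega
  · simp only [p40, if_true]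
    have := t 0; have := t 1; have := t 2; have := Fin.sum_univ_three w.lo
    rw [Fin.sum_univ_three]; omega

/-- Move the point found into the box. -/
def clampFound : List (ℕ × Term) :=
  setVec 24 fun a => (boxLow a).max ((boxHigh a).min (.var (24 + a)))

/-- Solve the level problem. -/
noncomputable def levelProg : Prog :=
  .seq startProg (.seq (whileT mainGuard mainBody) (.seq finalStage (block clampFound)))

theorem exec_levelProg : ∃ c : ℕ, ∀ w : Inst, c * w.N ≤ w.W → ∀ σ, Start w σ →
    ∃ τ, Exec w.F w.W levelProg σ τ (c * (Nat.log 2 w.N + 1)) ∧ Inv w τ ∧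
      (∀ v, v < 10 → τ v = σ v) ∧ w.lo ≤ vec τ 24 ∧ vec τ 24 ≤ w.hi ∧
      IsSol (ext w.F) w.k (vec τ 24) := by
  obtain ⟨c1, h1⟩ := exec_startProg
  obtain ⟨c2, h2⟩ := exec_mainLoop
  obtain ⟨c3, h3⟩ := isPiece_finalStage
  obtain ⟨c4, h4⟩ := exec_block clampFound
  refine ⟨c1 + c2 + c3 + 10000 * c4, fun w hW σ hσ => ?_⟩
  have hN := w.three_le_N
  obtain ⟨σ1, r1, i1, B1, f1⟩ := h1 w (by nlinarith) σ hσ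
  obtain ⟨σ2, r2, i2, B2, f2, e2⟩ := h2 w (by nlinarith) σ1 i1 B1
  obtain ⟨σ3, r3, i3, s3, k3, e3⟩ := h3 w (by nlinarith) σ2 i2
  have r4 := h4 w.F w.W (10000 * w.N) σ3 (by omega) i3.bound (by nlinarith)
  set τ := runBlock clampFound σ3 with hτ
  have f4 : ∀ v, v < 24 ∨ 26 < v → τ v = σ3 v := fun v hv =>
    runBlock_of_notMem (by simp [clampFound, setVec]; omega) σ3
  have f34 : ∀ v, v < 10 → σ3 v = σ v := fun v hv => by
    rw [eq_of_snap_eq s3 (Or.inl hv), f2 v (by omega), f1 v hv]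
  have p4 : vec τ 24 = clamp w.lo w.hi (vec σ3 24) := by
    have key := runBlock_of_mem (l := clampFound) (by simp [clampFound, setVec]) (by
      simp only [clampFound, setVec, List.mem_cons, List.not_mem_nil, or_false]
      rintro a (rfl | rfl | rfl) <;> simp [Term.All, Term.max, Term.min, boxLow, boxHigh]) σ3
    have hm : ∀ a : Fin 3, ((24 + a, (boxLow a).max ((boxHigh a).min (.var (24 + a)))) : ℕ × Term) ∈
        clampFound := by intro a; fin_cases a <;> simp [clampFound, setVec]
    ext a
    refine (key _ (hm a)).trans ?_
    simp only [Term.eval_max, Term.eval_min, Term.eval, boxLow, boxHigh, clamp, ← i3.lo, ← i3.hi,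
      vec_apply]
  have h11 : σ3 11 = 1 := by
    rcases e2 with h | h
    · exact k3 h
    · have e30 : wit (snap σ2) 30 = wit σ2 30 := by
        ext i a; exact if_pos (isMain_wit i a).1
      have e40 : wit (snap σ2) 40 = wit σ2 40 := by
        ext i a; exact if_pos (isMain_wit i a).2
      refine e3 ?_
      beta_reduce
      rw [e30, e40]; exact ⟨B2, h⟩
  have hs : IsSol w.G w.k (vec σ3 24) := by
    rcases i3.found with h | h
    · omega
    · exact h.2
  have hs' := w.isSol_clamp hs
  rw [← p4] at hs'
  have m1 : w.lo ≤ vec τ 24 := by rw [p4]; exact (w.clamp_mem _).1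
  have m2 : vec τ 24 ≤ w.hi := by rw [p4]; exact (w.clamp_mem _).2
  refine ⟨τ, ?_, ?_, fun v hv => by rw [f4 v (by omega), f34 v hv], m1, m2, hs'⟩
  · refine (r1.seq (r2.seq (r3.seq r4))).mono ?_
    nlinarith [Nat.zero_le (Nat.log 2 w.N), Nat.zero_le (c1 * Nat.log 2 w.N),
      Nat.zero_le (c4 * Nat.log 2 w.N)]
  · refine ⟨fun v => ?_, fun v hv => ?_, ?_, ?_, ?_, Or.inr ⟨?_, ?_⟩⟩
    · by_cases hv : v < 24 ∨ 26 < v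
      · rw [f4 v hv]; exact i3.bound v
      · obtain ⟨a, rfl⟩ : ∃ a : Fin 3, v = 24 + a := ⟨⟨v - 24, by omega⟩, by simp; omega⟩
        have := w.one_le a; have := w.hi_le_N a
        have := m1 a; have := m2 a
        change |vec τ 24 a| ≤ _
        rw [abs_le]; push_cast; constructor <;> linarith
    · rw [f4 v (by simp only [IsMain] at hv; omega)]; exact i3.main v hv
    · rw [f4 3 (by omega)]; exact i3.level
    · rw [← i3.lo]; ext a; exact f4 _ (by omega)
    · rw [← i3.hi]; ext a; exact f4 _ (by omega)
    · rw [f4 11 (by omega)]; exact h11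
    · rw [IsSol, w.G_eq m1 m2]; exact hs'

/-! ### The two algorithms -/

theorem ext_coe {n : Fin 3 → ℕ} (F : Grid n → Grid n) (x : Grid n) : ext F x.1 = (F x).1 :=
  dif_pos x.2

/-- Let the box be the whole grid. -/
def wholeGrid : List (ℕ × Term) :=
  [(4, .const 1), (5, .const 1), (6, .const 1), (7, .var 0), (8, .var 1), (9, .var 2)]

theorem abs_input_le {n : Fin 3 → ℕ} {k : ℕ} (hk : k ≤ gridSize n) (v : ℕ) :
    |input n k v| ≤ gridSize n := by
  simp only [input]
  split_ifs
  · have : n ⟨v, by assumption⟩ ≤ gridSize n :=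
      Finset.single_le_sum (fun _ _ => Nat.zero_le _) (Finset.mem_univ _)
    simp; exact_mod_cast this
  · simp; exact_mod_cast hk
  · simp

theorem three_le_gridSize {n : Fin 3 → ℕ} (hn : ∀ i, 1 ≤ n i) : 3 ≤ gridSize n := by
  have := hn 0; have := hn 1; have := hn 2
  rw [gridSize, Fin.sum_univ_three]; omega

/-- A store that holds a box `[lo, hi]` with upward least point and downward greatest point. -/
structure HoldsBox {n : Fin 3 → ℕ} (F : Grid n → Grid n) (lo hi : Fin 3 → ℤ) (σ : Store) :
    Prop where
  one_le : ∀ i, 1 ≤ lo i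
  lo_le_hi : lo ≤ hi
  hi_le : ∀ i, hi i ≤ n i
  up : lo ≤ ext F lo
  down : ext F hi ≤ hi
  bound : ∀ v, |σ v| ≤ (10000 * gridSize n : ℕ)
  main : ∀ v, IsMain v → |σ v| ≤ (20 * gridSize n : ℕ)
  lo_eq : vec σ 4 = lo
  hi_eq : vec σ 7 = hi

/-- The instance of the level problem for the box held by the store. -/
def HoldsBox.toInst {n : Fin 3 → ℕ} {F : Grid n → Grid n} {lo hi : Fin 3 → ℤ} {σ : Store}
    (h : HoldsBox F lo hi σ) (hF : Monotone F) (W : ℕ) {k : ℤ} (h1 : ∑ i, lo i ≤ k)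
    (h2 : k ≤ ∑ i, hi i) : Inst where
  n := n
  F := F
  mono := hF
  lo := lo
  hi := hi
  k := k
  W := W
  one_le := h.one_le
  lo_le_hi := h.lo_le_hi
  hi_le := h.hi_le
  up := h.up
  down := h.down
  le_k := h1
  k_le := h2

theorem exec_wholeGrid : ∃ c : ℕ, ∀ (n : Fin 3 → ℕ), (∀ i, 1 ≤ n i) → ∀ F : Grid n → Grid n,
    ∀ W, c * gridSize n ≤ W → ∀ k ≤ gridSize n, ∃ τ,
      Exec F W (block wholeGrid) (input n k) τ c ∧ τ 3 = k ∧
        HoldsBox F (fun _ => 1) (fun i => n i) τ := by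
  obtain ⟨c, hc⟩ := exec_block wholeGrid
  refine ⟨c, fun n hn F W hW k hk => ?_⟩
  have hN := three_le_gridSize hn
  have hb := abs_input_le hk
  refine ⟨_, hc F W _ _ (by omega) hb hW, by simp [runBlock, wholeGrid, input], ?_⟩
  have b : ∀ v, |runBlock wholeGrid (input n k) v| ≤ (gridSize n : ℕ) := by
    intro v
    by_cases hv : 4 ≤ v ∧ v ≤ 9
    · obtain ⟨h1, h2⟩ := hv
      have h0 := hb 0; have h1' := hb 1; have h2' := hb 2
      interval_cases v <;> simp [runBlock, wholeGrid, Term.eval, Function.update] <;>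
        first | assumption | omega
    · rw [runBlock_of_notMem (by simp [wholeGrid]; omega)]; exact hb v
  have h1 : ∀ i, (1 : ℤ) ≤ 1 ∧ (1 : ℤ) ≤ (n i : ℤ) := fun i => ⟨le_rfl, by exact_mod_cast hn i⟩
  have h2 : ∀ i, (1 : ℤ) ≤ (n i : ℤ) ∧ (n i : ℤ) ≤ (n i : ℤ) := fun i =>
    ⟨by exact_mod_cast hn i, le_rfl⟩
  refine ⟨fun _ => le_rfl, fun i => (h1 i).2, fun _ => le_rfl, ?_, ?_, fun v => ?_, fun v _ => ?_,
    ?_, ?_⟩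
  · rw [show ext F (fun _ => 1) = _ from ext_coe F ⟨fun _ => 1, h1⟩]
    exact fun i => ((F _).2 i).1
  · rw [show ext F (fun i => n i) = _ from ext_coe F ⟨fun i => n i, h2⟩]
    exact fun i => ((F _).2 i).2
  · refine (b v).trans ?_; push_cast; omega
  · refine (b v).trans ?_; push_cast; omega
  · ext a; fin_cases a <;> simp [vec, runBlock, wholeGrid, Term.eval]
  · ext a; fin_cases a <;> simp [vec, runBlock, wholeGrid, Term.eval, input]

/-- The algorithm for a given level. -/
noncomputable def levelAlg : Prog :=
  .seq (block wholeGrid) (.seq levelProg (block (setVec 0 fun a => .var (24 + a))))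

theorem exec_levelAlg : ∃ c : ℕ, ∀ (n : Fin 3 → ℕ), (∀ i, 1 ≤ n i) → ∀ F : Grid n → Grid n,
    Monotone F → ∀ W, c * gridSize n ≤ W → ∀ k : ℕ, 3 ≤ k → k ≤ gridSize n → ∃ τ, ∃ x : Grid n,
      Exec F W levelAlg (input n k) τ (c * (Nat.log 2 (gridSize n) + 1)) ∧ Outputs τ x ∧
        ((IsUpward F x ∧ (k : ℤ) ≤ level x) ∨ (IsDownward F x ∧ level x ≤ (k : ℤ))) := by
  obtain ⟨c1, h1⟩ := exec_wholeGrid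
  obtain ⟨c2, h2⟩ := exec_levelProg
  obtain ⟨c3, h3⟩ := exec_block (setVec 0 fun a => .var (24 + a))
  refine ⟨c1 + c2 + 10000 * c3, fun n hn F hF W hW k hk1 hk2 => ?_⟩
  have hN := three_le_gridSize hn
  obtain ⟨σ1, r1, k1, b1⟩ := h1 n hn F W (by nlinarith) k hk2
  let w : Inst := b1.toInst hF W (k := k) (by simp; omega) (by
    rw [gridSize] at hk2; exact_mod_cast hk2)
  obtain ⟨σ2, r2, i2, -, m1, m2, s2⟩ := h2 w (by change c2 * gridSize n ≤ W; nlinarith) σ1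
    ⟨b1.bound, b1.main, k1, b1.lo_eq, b1.hi_eq⟩
  have r3 := h3 F W (10000 * gridSize n) σ2 (by omega) i2.bound (by nlinarith)
  obtain ⟨e3, -⟩ := runBlock_setVec (b := 0) (e := fun a => .var (24 + a))
    (fun a => by simp only [Term.All]; omega) σ2
  let x : Grid n := ⟨vec σ2 24, w.mem_grid m1 m2⟩
  have hx : ext F (vec σ2 24) = (F x).1 := ext_coe F x
  refine ⟨_, x, (r1.seq (r2.seq r3)).mono ?_, fun i => ?_, ?_⟩
  · change c1 + (c2 * (Nat.log 2 (gridSize n) + 1) + c3) ≤ _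
    nlinarith [Nat.zero_le (c1 * Nat.log 2 (gridSize n)), Nat.zero_le (c3 * Nat.log 2 (gridSize n))]
  · have := congrFun e3 i
    rw [vec_apply, zero_add] at this
    exact this
  · rw [IsSol] at s2
    change _ ≤ ext F _ ∧ _ ∨ ext F _ ≤ _ ∧ _ at s2
    rw [hx] at s2
    exact s2

/-- Cut the box to one half: up from an upward point, or down from a downward one. -/
def halve : List (ℕ × Term) :=
  [(4, Term.sel upT (.var 12) (.var 4)), (5, Term.sel upT (.var 13) (.var 5)),
    (6, Term.sel upT (.var 14) (.var 6)), (7, Term.sel upT (.var 7) (.var 12)),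
    (8, Term.sel upT (.var 8) (.var 13)), (9, Term.sel upT (.var 9) (.var 14))]

/-- One round of the search for a fixed point. -/
noncomputable def roundProg : Prog :=
  .seq (block [(3, .div (.add (.add (.add (boxHigh 0) (boxHigh 1)) (boxHigh 2))
      (.add (.add (boxLow 0) (boxLow 1)) (boxLow 2))) 1)])
    (.seq levelProg (.seq (probe fun a => .var (24 + a)) (block halve)))

/-- One round takes time `O(log N)` and halves the number of levels of the box. -/
theorem exec_roundProg : ∃ c : ℕ, ∀ (n : Fin 3 → ℕ), (∀ i, 1 ≤ n i) → ∀ F : Grid n → Grid n,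
    Monotone F → ∀ W, c * gridSize n ≤ W → ∀ lo hi σ, HoldsBox F lo hi σ →
      ∃ lo' hi' τ, Exec F W roundProg σ τ (c * (Nat.log 2 (gridSize n) + 1)) ∧
        HoldsBox F lo' hi' τ ∧ 2 * (∑ i, hi' i - ∑ i, lo' i) ≤ ∑ i, hi i - ∑ i, lo i + 1 := by
  obtain ⟨c1, h1⟩ := exec_block [(3, .div (.add (.add (.add (boxHigh 0) (boxHigh 1)) (boxHigh 2))
      (.add (.add (boxLow 0) (boxLow 1)) (boxLow 2))) 1)]
  obtain ⟨c2, h2⟩ := exec_levelProg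
  obtain ⟨c3, h3⟩ := exec_probe (fun a => .var (24 + a))
    (fun a => by simp only [Term.All]; omega)
  obtain ⟨c4, h4⟩ := exec_block halve
  refine ⟨10000 * c1 + c2 + c3 + 10000 * c4, fun n hn F hF W hW lo hi σ hσ => ?_⟩
  have hN := three_le_gridSize hn
  have hlh : ∑ i, lo i ≤ ∑ i, hi i := Finset.sum_le_sum fun i _ => hσ.lo_le_hi i
  let w : Inst := hσ.toInst hF W (k := (∑ i, hi i + ∑ i, lo i) / 2) (by omega) (by omega)
  have r1 := h1 F W _ σ (by omega) hσ.bound (by nlinarith)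
  set σ1 := runBlock _ σ with hσ1
  have f1 : ∀ v, v ≠ 3 → σ1 v = σ v := fun v hv => by simp [hσ1, runBlock, hv]
  have k1 : σ1 3 = w.k := by
    change σ1 3 = (∑ i, hi i + ∑ i, lo i) / 2
    rw [← hσ.lo_eq, ← hσ.hi_eq]
    simp [hσ1, runBlock, Term.eval, boxHigh, boxLow, Fin.sum_univ_three, vec]
  have b1 : |w.k| ≤ (gridSize n : ℤ) := by
    have := w.k_bounds
    rw [abs_of_nonneg (by omega)]; exact this.2
  obtain ⟨σ2, r2, i2, f2, m1, m2, s2⟩ := h2 w (by change c2 * gridSize n ≤ W; nlinarith) σ1 (by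
    refine ⟨fun v => ?_, fun v hv => ?_, k1, ?_, ?_⟩
    · by_cases hv : v = 3
      · subst hv; rw [k1]; refine b1.trans ?_
        change (gridSize n : ℤ) ≤ (10000 * gridSize n : ℕ); push_cast; omega
      · rw [f1 v hv]; exact hσ.bound v
    · by_cases hv' : v = 3
      · subst hv'; rw [k1]; refine b1.trans ?_
        change (gridSize n : ℤ) ≤ (20 * gridSize n : ℕ); push_cast; omega
      · rw [f1 v hv']; exact hσ.main v hv
    · change _ = lo; rw [← hσ.lo_eq]; ext a; exact f1 _ (by omega)
    · change _ = hi; rw [← hσ.hi_eq]; ext a; exact f1 _ (by omega))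
  obtain ⟨σ3, r3, i3, p3, q3, f3⟩ := h3 w (by change c3 * gridSize n ≤ W; nlinarith) σ2 i2
    (fun a => i2.bound _)
  have r4 := h4 F W (10000 * gridSize n) σ3 (by omega) i3.bound
    (by nlinarith)
  set τ := runBlock halve σ3 with hτ
  have p3' : vec σ3 12 = vec σ2 24 := p3
  have q3' : vec σ3 15 = ext F (vec σ2 24) := q3.trans (w.G_eq m1 m2)
  set x := vec σ2 24 with hx
  have f4 : ∀ v, v < 4 ∨ 9 < v → τ v = σ3 v := fun v hv =>
    runBlock_of_notMem (by simp [halve]; omega) σ3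
  have hup : upT.Holds σ3 ↔ x ≤ ext F x ∧ w.k ≤ ∑ i, x i := by
    rw [holds_upT, p3', q3', i3.level]
  have key := runBlock_of_mem (l := halve) (by simp [halve]) (by
    simp only [halve, List.mem_cons, List.not_mem_nil, or_false]
    rintro a (rfl | rfl | rfl | rfl | rfl | rfl) <;>
      simp [Term.All, Term.sel, upT, Term.and, Term.leT, levelT]) σ3
  have p4 : vec τ 4 = if upT.Holds σ3 then x else lo := by
    rw [← p3', ← (show vec σ3 4 = lo from i3.lo)]
    ext a
    have hm : ((4 + a, Term.sel upT (.var (12 + a)) (.var (4 + a))) : ℕ × Term) ∈ halve := by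
      fin_cases a <;> simp [halve]
    refine (key _ hm).trans ?_
    rw [Term.eval_sel, ite_apply]; rfl
  have p7 : vec τ 7 = if upT.Holds σ3 then hi else x := by
    rw [← p3', ← (show vec σ3 7 = hi from i3.hi)]
    ext a
    have hm : ((7 + a, Term.sel upT (.var (7 + a)) (.var (12 + a))) : ℕ × Term) ∈ halve := by
      fin_cases a <;> simp [halve]
    refine (key _ hm).trans ?_
    rw [Term.eval_sel, ite_apply]; rfl
  have hr : Exec F W roundProg σ τ
      ((10000 * c1 + c2 + c3 + 10000 * c4) * (Nat.log 2 (gridSize n) + 1)) := by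
    refine (r1.seq (r2.seq (r3.seq r4))).mono ?_
    change c1 + (c2 * (Nat.log 2 (gridSize n) + 1) + (c3 + c4)) ≤ _
    nlinarith [Nat.zero_le (c1 * Nat.log 2 (gridSize n)),
      Nat.zero_le (c3 * Nat.log 2 (gridSize n)), Nat.zero_le (c4 * Nat.log 2 (gridSize n))]
  have hb : (∀ p : Fin 3 → ℤ, lo ≤ p → p ≤ hi → ∀ a, |p a| ≤ (gridSize n : ℤ)) := fun p h h' a => by
    have e1 := h a; have e2 := h' a; have e3 := hσ.one_le a; have e4 : hi a ≤ _ := w.hi_le_N a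
    rw [abs_of_nonneg (by linarith)]; exact e2.trans e4
  have hbox : ∀ lo' hi' : Fin 3 → ℤ, vec τ 4 = lo' → vec τ 7 = hi' → lo ≤ lo' → lo' ≤ hi' →
      hi' ≤ hi → lo' ≤ ext F lo' → ext F hi' ≤ hi' → HoldsBox F lo' hi' τ := by
    intro lo' hi' e4 e7 l1 l2 l3 hu hd
    have b : ∀ v, 4 ≤ v ∧ v ≤ 9 → |τ v| ≤ (gridSize n : ℤ) := by
      intro v hv
      by_cases h : v < 7
      · obtain ⟨a, rfl⟩ : ∃ a : Fin 3, v = 4 + a := ⟨⟨v - 4, by omega⟩, by simp; omega⟩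
        change |vec τ 4 a| ≤ _; rw [e4]; exact hb _ l1 (l2.trans l3) a
      · obtain ⟨a, rfl⟩ : ∃ a : Fin 3, v = 7 + a := ⟨⟨v - 7, by omega⟩, by simp; omega⟩
        change |vec τ 7 a| ≤ _; rw [e7]; exact hb _ (l1.trans l2) l3 a
    refine ⟨fun i => (hσ.one_le i).trans (l1 i), l2, fun i => (l3 i).trans (hσ.hi_le i), hu, hd,
      fun v => ?_, fun v hv => ?_, e4, e7⟩
    · by_cases h : 4 ≤ v ∧ v ≤ 9
      · refine (b v h).trans ?_; push_cast; omega
      · rw [f4 v (by omega)]; exact i3.bound v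
    · by_cases h : 4 ≤ v ∧ v ≤ 9
      · refine (b v h).trans ?_; push_cast; omega
      · rw [f4 v (by omega)]; exact i3.main v hv
  have hk : w.k = (∑ i, hi i + ∑ i, lo i) / 2 := rfl
  have s2' : (x ≤ ext F x ∧ w.k ≤ ∑ i, x i) ∨ (ext F x ≤ x ∧ ∑ i, x i ≤ w.k) := s2
  by_cases hc : upT.Holds σ3
  · rw [if_pos hc] at p4 p7
    have hc' := hup.1 hc
    refine ⟨x, hi, τ, hr, hbox x hi p4 p7 m1 m2 le_rfl hc'.1 hσ.down, ?_⟩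
    omega
  · rw [if_neg hc] at p4 p7
    have hc' := s2'.resolve_left fun h => hc (hup.2 h)
    refine ⟨lo, x, τ, hr, hbox lo x p4 p7 le_rfl m1 m2 hσ.up hc'.1, ?_⟩
    omega

/-- The box contains points on more than two levels. -/
def roundGuard : Term :=
  Term.leT (.add (.add (.add (boxLow 0) (boxLow 1)) (boxLow 2)) (.const 2))
    (.add (.add (boxHigh 0) (boxHigh 1)) (boxHigh 2))

/-- The algorithm for fixed points: when the points of the box are on at most two levels, the value
of the map at the least point is a fixed point. -/
noncomputable def fixedPointAlg : Prog :=
  .seq (block wholeGrid) (.seq (whileT roundGuard roundProg) (.query 4 5 6 0 1 2))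

theorem HoldsBox.holds_roundGuard {n : Fin 3 → ℕ} {F : Grid n → Grid n} {lo hi : Fin 3 → ℤ}
    {σ : Store} (h : HoldsBox F lo hi σ) :
    roundGuard.Holds σ ↔ ∑ i, lo i + 2 ≤ ∑ i, hi i := by
  rw [← h.lo_eq, ← h.hi_eq]
  simp [roundGuard, Term.eval, boxHigh, boxLow, Fin.sum_univ_three, vec]

theorem eq_of_le_of_sum_le {x y : Fin 3 → ℤ} (h : x ≤ y) (hs : ∑ i, y i ≤ ∑ i, x i) : x = y := by
  ext i
  exact (Finset.sum_eq_sum_iff_of_le fun i _ => h i).1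
    (le_antisymm (Finset.sum_le_sum fun i _ => h i) hs) i (Finset.mem_univ i)

theorem exec_fixedPointAlg : ∃ c : ℕ, ∀ (n : Fin 3 → ℕ), (∀ i, 1 ≤ n i) → ∀ F : Grid n → Grid n,
    Monotone F → ∀ W, c * gridSize n ≤ W → ∃ τ, ∃ x : Grid n,
      Exec F W fixedPointAlg (input n 0) τ (c * (Nat.log 2 (gridSize n) + 1) ^ 2) ∧
        Outputs τ x ∧ F x = x := by
  obtain ⟨c1, h1⟩ := exec_wholeGrid
  obtain ⟨c2, h2⟩ := exec_roundProg
  obtain ⟨c3, h3⟩ := exec_whileT roundGuard roundProg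
  refine ⟨c1 + 2 * c2 + 20000 * c3 + 1, fun n hn F hF W hW => ?_⟩
  have hN := three_le_gridSize hn
  set L := Nat.log 2 (gridSize n) with hL
  obtain ⟨σ1, r1, -, b1⟩ := h1 n hn F W (by nlinarith) 0 (Nat.zero_le _)
  obtain ⟨σ2, T', r2, ⟨lo, hi, b2, -⟩, g2⟩ := h3 F W (10000 * gridSize n) (c2 * (L + 1))
    (fun T σ => ∃ lo hi, HoldsBox F lo hi σ ∧ ∑ i, hi i - ∑ i, lo i - 1 < 2 ^ T)
    (by omega) (by nlinarith) (by
      rintro T σ ⟨lo, hi, hb, hT⟩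
      refine ⟨hb.bound, fun hg => ?_⟩
      rw [hb.holds_roundGuard] at hg
      obtain ⟨T, rfl⟩ : ∃ T', T = T' + 1 := by
        cases T with
        | zero => simp at hT; omega
        | succ T => exact ⟨T, rfl⟩
      obtain ⟨lo', hi', τ, t1, t2, t3⟩ := h2 n hn F hF W (by nlinarith) lo hi σ hb
      refine ⟨T, τ, rfl, t1, lo', hi', t2, ?_⟩
      rw [pow_succ] at hT
      omega)
    (L + 1) σ1 ⟨_, _, b1, by
      have h : gridSize n < 2 ^ (L + 1) := Nat.lt_pow_succ_log_self (by omega) _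
      have h' : ((∑ i, n i : ℕ) : ℤ) < 2 ^ (L + 1) := by exact_mod_cast h
      push_cast at h'
      simp
      omega⟩
  rw [b2.holds_roundGuard] at g2
  let x : Grid n := ⟨lo, fun i => ⟨b2.one_le i, (b2.lo_le_hi i).trans (b2.hi_le i)⟩⟩
  let z : Grid n := ⟨hi, fun i => ⟨(b2.one_le i).trans (b2.lo_le_hi i), b2.hi_le i⟩⟩
  have hx : x ≤ F x := by have := b2.up; rwa [show ext F lo = _ from ext_coe F x] at this
  have hz : F z ≤ z := by have := b2.down; rwa [show ext F hi = _ from ext_coe F z] at this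
  have hxz : x ≤ z := b2.lo_le_hi
  have h1 : F x ≤ F (F x) := hF hx
  have h2 : F (F x) ≤ z := (hF ((hF hxz).trans hz)).trans hz
  have r3 := Run.query (F := F) (W := W) 4 5 6 0 1 2 σ2 x
    (by change lo = _; rw [← b2.lo_eq]; ext a; fin_cases a <;> rfl)
  refine ⟨_, F x, (r1.seq (r2.seq ⟨_, _, r3, le_rfl, le_rfl⟩)).mono ?_, fun i => ?_, ?_⟩
  · nlinarith [Nat.zero_le L, Nat.zero_le (c3 * L), Nat.zero_le (c2 * L), Nat.zero_le (c1 * L),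
      Nat.zero_le (c1 * L ^ 2),
      Nat.zero_le (c3 * L ^ 2), Nat.zero_le (c2 * L ^ 2)]
  · fin_cases i <;> simp [Function.update]
  · rcases eq_or_ne x (F x) with h | h
    · rw [← h, ← h]
    · have hs : ∑ i, x.1 i < ∑ i, (F x).1 i := by
        by_contra hc
        exact h (Subtype.ext (eq_of_le_of_sum_le hx (not_lt.1 hc)))
      refine (Subtype.ext (eq_of_le_of_sum_le h1 ?_)).symm
      have : ∑ i, (F (F x)).1 i ≤ ∑ i, hi i := Finset.sum_le_sum fun i _ => h2 i
      change ∑ i, lo i < _ at hs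
      omega

/-! ### The bounds in terms of the logarithm -/

theorem natLog_add_one_le_log {N : ℕ} (hN : 3 ≤ N) :
    ((Nat.log 2 N + 1 : ℕ) : ℝ) ≤ 3 * Real.log N := by
  have h1 : 1 ≤ Real.log N := by
    rw [Real.le_log_iff_exp_le (by positivity)]
    have : (3 : ℝ) ≤ N := by exact_mod_cast hN
    exact (Real.exp_one_lt_three.le).trans this
  have h2 : (Nat.log 2 N : ℝ) * Real.log 2 ≤ Real.log N := by
    rw [← Real.log_pow]
    refine Real.log_le_log (by positivity) ?_
    exact_mod_cast Nat.pow_log_le_self 2 (by omega)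
  have h3 := Real.log_two_gt_d9
  have h4 : (0 : ℝ) ≤ Nat.log 2 N := by positivity
  push_cast
  nlinarith

theorem mul_le_pow_of_two_le {N c d : ℕ} (hN : 2 ≤ N) (h : c < d) : c * N ≤ N ^ d := by
  calc c * N ≤ N ^ c * N := by
        gcongr; exact (Nat.lt_pow_self (by omega)).le
    _ = N ^ (c + 1) := (pow_succ _ _).symm
    _ ≤ N ^ d := Nat.pow_le_pow_right (by omega) h

end Tarski

theorem mainTheorem1 :
    -- finding a fixed point
    (∃ (P : Tarski.Prog) (C : ℕ), ∀ (n : Fin 3 → ℕ), (∀ i, 1 ≤ n i) →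
      ∀ F : Tarski.Grid n → Tarski.Grid n, Monotone F →
        ∃ (τ : Tarski.Store) (t q : ℕ) (x : Tarski.Grid n),
          Tarski.Run F (Tarski.gridSize n ^ C) P (Tarski.input n 0) τ t q ∧
          Tarski.Outputs τ x ∧ F x = x ∧
          (q : ℝ) ≤ C * Real.log (Tarski.gridSize n) ^ 2 ∧
          (t : ℝ) ≤ C * Real.log (Tarski.gridSize n) ^ 2) ∧
    -- finding an upward or downward point at a given level
    (∃ (P : Tarski.Prog) (C : ℕ), ∀ (n : Fin 3 → ℕ), (∀ i, 1 ≤ n i) →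
      ∀ k : ℕ, 3 ≤ k → k ≤ Tarski.gridSize n →
      ∀ F : Tarski.Grid n → Tarski.Grid n, Monotone F →
        ∃ (τ : Tarski.Store) (t q : ℕ) (x : Tarski.Grid n),
          Tarski.Run F (Tarski.gridSize n ^ C) P (Tarski.input n k) τ t q ∧
          Tarski.Outputs τ x ∧
          ((Tarski.IsUpward F x ∧ (k : ℤ) ≤ Tarski.level x) ∨
            (Tarski.IsDownward F x ∧ Tarski.level x ≤ (k : ℤ))) ∧
          (q : ℝ) ≤ C * Real.log (Tarski.gridSize n) ∧
          (t : ℝ) ≤ C * Real.log (Tarski.gridSize n)) := by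
  constructor
  · obtain ⟨c, hc⟩ := Tarski.exec_fixedPointAlg
    refine ⟨Tarski.fixedPointAlg, 9 * c + 1, fun n hn F hF => ?_⟩
    have hN := Tarski.three_le_gridSize hn
    obtain ⟨τ, x, ⟨t, q, hr, hq, ht⟩, ho, hx⟩ := hc n hn F hF _
      (Tarski.mul_le_pow_of_two_le (d := 9 * c + 1) (by omega) (by omega))
    have hl := Tarski.natLog_add_one_le_log hN
    have ht' : (t : ℝ) ≤ ((9 * c + 1 : ℕ) : ℝ) * Real.log (Tarski.gridSize n) ^ 2 := by
      calc (t : ℝ) ≤ c * ((Nat.log 2 (Tarski.gridSize n) + 1 : ℕ) : ℝ) ^ 2 := by exact_mod_cast ht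
        _ ≤ c * (3 * Real.log (Tarski.gridSize n)) ^ 2 := by gcongr
        _ ≤ _ := by
          push_cast
          nlinarith [sq_nonneg (Real.log (Tarski.gridSize n))]
    exact ⟨τ, t, q, x, hr, ho, hx, le_trans (by exact_mod_cast hq) ht', ht'⟩
  · obtain ⟨c, hc⟩ := Tarski.exec_levelAlg
    refine ⟨Tarski.levelAlg, 9 * c + 1, fun n hn k hk1 hk2 F hF => ?_⟩
    have hN := Tarski.three_le_gridSize hn
    obtain ⟨τ, x, ⟨t, q, hr, hq, ht⟩, ho, hx⟩ := hc n hn F hF _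
      (Tarski.mul_le_pow_of_two_le (d := 9 * c + 1) (by omega) (by omega)) k hk1 hk2
    have hl := Tarski.natLog_add_one_le_log hN
    have ht' : (t : ℝ) ≤ ((9 * c + 1 : ℕ) : ℝ) * Real.log (Tarski.gridSize n) := by
      have h0 : 0 ≤ Real.log (Tarski.gridSize n) := Real.log_natCast_nonneg _
      calc (t : ℝ) ≤ c * ((Nat.log 2 (Tarski.gridSize n) + 1 : ℕ) : ℝ) := by exact_mod_cast ht
        _ ≤ c * (3 * Real.log (Tarski.gridSize n)) := by gcongr
        _ ≤ _ := by
          push_cast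
          nlinarith [mul_nonneg (Nat.cast_nonneg c : (0 : ℝ) ≤ c) h0]
    exact ⟨τ, t, q, x, hr, ho, hx, le_trans (by exact_mod_cast hq) ht', ht'⟩
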